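/- Let $d\ge 2$, let $P$ be a probability distribution on a measurable space $\mathcal Z$, and let $f:\mathbb R^d\times\mathcal Z\to\mathbb R$ be a loss (measurable and $P$-integrable in $z$ for every $\mathbf w$) such that, for every $z$, the function $f(\cdot;z)$ is twice differentiable, $\mu$-strongly convex with $\mu>0$, has an $L$-Lipschitz gradient, and is (standard) self-concordant: it is $C^3$ and $|D^3f(\mathbf w;z)[u,u,u]|\le 2\,(D^2f(\mathbf w;z)[u,u])^{3/2}$ for all $\mathbf w,u\in\mathbb R^d$. Put $\kappa=L/\mu$. Let $\mathbf z_1,\mathbf z_2,\dots$ be independent samples from $P$, $\mathcal S_n=(\mathbf z_1,\dots,\mathbf z_n)$, $R_n(\mathbf w)=\frac1n\sum_{i=1}^n f(\mathbf w;\mathbf z_i)$, $R(\mathbf w)=\mathbb E_{\mathbf Z\sim P}f(\mathbf w;\mathbf Z)$, and let $\mathbf w_n^*$ and $\mathbf w^*$ be the minimizers of $R_n$ and $R$. All expectations are over the samples. Let $$s:=\sup_{\mathbf w\in\mathbb R^d,\;n\ge1}\left(\frac{\mathbb E\|\nabla^2R_n(\mathbf w)-\nabla^2R(\mathbf w)\|_F}{\mathbb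 E\|\nabla^2R_n(\mathbf w)-\nabla^2R(\mathbf w)\|}\right)^2,$$ where $\|\cdot\|$ is the spectral norm and a ratio $0/0$ is read as $1$ (so that $s\in[1,d]$). Let $(V_n)_{n\ge1}$ satisfy $\mathbb E|R_n(\mathbf w_n^*)-R(\mathbf w^*)|\le V_n$ for all $n\ge1$, and $V_n\le c/n$ for all $n\ge a\,\kappa^2\log d$, where $a,c>0$ are constants. Then there is a constant $C>0$ that depends only on $a$ and $c$ (not on $d,\mathcal Z,P,f,\mu,L$ or $V$) with the following property. If the initial sample size $m_0$ satisfies $$m_0\ \ge\ C\max\{d,\ \kappa^2 s\log d\},$$ and $\mathbf w_{m_0}$ is a (measurable) function of $\mathcal S_{m_0}$ that solves the initial problem within its statistical accuracy, i.e. $\mathbb E[R_{m_0}(\mathbf w_{m_0})-R_{m_0}(\mathbf w^*_{m_0})]\le V_{m_0}$, then for every $n\ge 2m_0$ $$\mathbb E\left\|\nabla^2R_n(\mathbf w_n^*)^{-\frac12}\left[\nabla^2R_{m_0}(\mathbf w_{m_0})-\nabla^2R_n(\mathbf w_n^*)\right]\nabla^2R_n(\mathbf w_n^*)^{-\frac12}\right\|_F\le\frac17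 .$$ -/

import Mathlib

open MeasureTheory

noncomputable section

namespace AdaQN

/-- The Hessian matrix of `g` at `w` in the standard basis. -/
def hess {d : ℕ} (g : EuclideanSpace ℝ (Fin d) → ℝ) (w : EuclideanSpace ℝ (Fin d)) :
    Matrix (Fin d) (Fin d) ℝ :=
  Matrix.of fun i j =>
    iteratedFDeriv ℝ 2 g w ![EuclideanSpace.single i 1, EuclideanSpace.single j 1]

/-- The Frobenius norm of a real matrix. -/
def frobNorm {d : ℕ} (M : Matrix (Fin d) (Fin d) ℝ) : ℝ :=
  √(∑ i, ∑ j, M i j ^ 2)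

/-- The spectral norm: the operator norm for the Euclidean norm. -/
def specNorm {d : ℕ} (M : Matrix (Fin d) (Fin d) ℝ) : ℝ :=
  ‖Matrix.toEuclideanCLM (n := Fin d) (𝕜 := ℝ) M‖

/-- The power `M ^ (-1/2)` of a symmetric positive definite matrix, through the functional
calculus of symmetric matrices. -/
def invSqrt {d : ℕ} (M : Matrix (Fin d) (Fin d) ℝ) : Matrix (Fin d) (Fin d) ℝ :=
  cfc (fun x : ℝ => (√x)⁻¹) M

/-- A minimizer of `g` over the whole space (meaningful when there is one). -/
def argMin {d : ℕ} (g : EuclideanSpace ℝ (Fin d) → ℝ) : EuclideanSpace ℝ (Fin d) :=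
  Classical.epsilon fun w => ∀ v, g w ≤ g v

/-- (Standard) self-concordance of a function that is defined on the whole space:
convex, three times continuously differentiable, `|D³g(w)[u,u,u]| ≤ 2 (D²g(w)[u,u])^(3/2)`. -/
def SelfConcordant {d : ℕ} (g : EuclideanSpace ℝ (Fin d) → ℝ) : Prop :=
  ConvexOn ℝ Set.univ g ∧ ContDiff ℝ 3 g ∧
    ∀ w u : EuclideanSpace ℝ (Fin d),
      |iteratedFDeriv ℝ 3 g w (fun _ => u)| ≤
        2 * (iteratedFDeriv ℝ 2 g w (fun _ => u)) ^ (3 / 2 : ℝ)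

/-- The empirical risk `R_n(w) = (1/n) ∑ f(w; z_i)` of the sample `S = (z_1, …, z_n)`. -/
def empRisk {d : ℕ} {Z : Type*} (f : EuclideanSpace ℝ (Fin d) → Z → ℝ) {n : ℕ} (S : Fin n → Z)
    (w : EuclideanSpace ℝ (Fin d)) : ℝ :=
  (1 / (n : ℝ)) * ∑ i, f w (S i)

/-- The expected risk `R(w) = E f(w; Z)`. -/
def expRisk {d : ℕ} {Z : Type*} [MeasurableSpace Z] (P : Measure Z)
    (f : EuclideanSpace ℝ (Fin d) → Z → ℝ) (w : EuclideanSpace ℝ (Fin d)) : ℝ :=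
  ∫ z, f w z ∂P

/-- The law of `n` independent samples from `P`. -/
def sampleLaw {Z : Type*} [MeasurableSpace Z] (P : Measure Z) (n : ℕ) : Measure (Fin n → Z) :=
  Measure.pi fun _ => P

/-- `E ‖∇²R_n(w) - ∇²R(w)‖_F`. -/
def hessDevFrob {d : ℕ} {Z : Type*} [MeasurableSpace Z] (P : Measure Z)
    (f : EuclideanSpace ℝ (Fin d) → Z → ℝ) (n : ℕ) (w : EuclideanSpace ℝ (Fin d)) : ℝ :=
  ∫ S : Fin n → Z, frobNorm (hess (empRisk f S) w - hess (expRisk P f) w) ∂(sampleLaw P n)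

/-- `E ‖∇²R_n(w) - ∇²R(w)‖`. -/
def hessDevSpec {d : ℕ} {Z : Type*} [MeasurableSpace Z] (P : Measure Z)
    (f : EuclideanSpace ℝ (Fin d) → Z → ℝ) (n : ℕ) (w : EuclideanSpace ℝ (Fin d)) : ℝ :=
  ∫ S : Fin n → Z, specNorm (hess (empRisk f S) w - hess (expRisk P f) w) ∂(sampleLaw P n)

open Classical in
/-- The squared ratio of the two mean deviations; where both vanish it is read as `1`, the value
of `‖A‖_F / ‖A‖` that makes the parameter `s` below always lie in `[1, d]`. -/
def devRatioSq {d : ℕ} {Z : Type*} [MeasurableSpace Z] (P : Measure Z)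
    (f : EuclideanSpace ℝ (Fin d) → Z → ℝ) (n : ℕ) (w : EuclideanSpace ℝ (Fin d)) : ℝ :=
  if hessDevSpec P f n w = 0 then 1 else (hessDevFrob P f n w / hessDevSpec P f n w) ^ 2

/-- The parameter `s`: the supremum over all `w` and all sample sizes `n ≥ 1`. -/
def sParam {d : ℕ} {Z : Type*} [MeasurableSpace Z] (P : Measure Z)
    (f : EuclideanSpace ℝ (Fin d) → Z → ℝ) : ℝ :=
  sSup {r : ℝ | ∃ (w : EuclideanSpace ℝ (Fin d)) (n : ℕ), 1 ≤ n ∧ r = devRatioSq P f n w}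

/-- The standing setting. For every `z` the loss `f(·; z)` is `μ`-strongly convex,
twice differentiable with `L`-Lipschitz gradient, and self-concordant; and the expected risk
is well defined. -/
structure LossAssumptions {d : ℕ} {Z : Type*} [MeasurableSpace Z] (P : Measure Z)
    (f : EuclideanSpace ℝ (Fin d) → Z → ℝ) (μ L : ℝ) : Prop where
  measurable : ∀ w, Measurable (f w)
  integrable : ∀ w, Integrable (f w) P
  strongConvex : ∀ z, StrongConvexOn Set.univ μ fun w => f w z
  gradLipschitz : ∀ z, LipschitzWith L.toNNReal (gradient fun w => f w z)
  selfConcordant : ∀ z, SelfConcordant fun w => f w z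

/-- `V n` bounds the gap between the optimal values of the empirical and of the expected risk:
`E |R_n(w*_n) - R(w*)| ≤ V n` for every `n ≥ 1`. -/
def IsStatAccuracy {d : ℕ} {Z : Type*} [MeasurableSpace Z] (P : Measure Z)
    (f : EuclideanSpace ℝ (Fin d) → Z → ℝ) (V : ℕ → ℝ) : Prop :=
  ∀ n : ℕ, 1 ≤ n →
    Integrable (fun S : Fin n → Z =>
      |empRisk f S (argMin (empRisk f S)) - expRisk P f (argMin (expRisk P f))|)
      (sampleLaw P n) ∧
    ∫ S : Fin n → Z,
      |empRisk f S (argMin (empRisk f S)) - expRisk P f (argMin (expRisk P f))|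
      ∂(sampleLaw P n) ≤ V n

/-- The point `w S`, a function of the sample `S` of size `m`, solves the empirical problem within
the accuracy `v`: `E [R_m(w) - R_m(w*_m)] ≤ v`. -/
def SolvesWithin {d : ℕ} {Z : Type*} [MeasurableSpace Z] (P : Measure Z)
    (f : EuclideanSpace ℝ (Fin d) → Z → ℝ) {m : ℕ} (w : (Fin m → Z) → EuclideanSpace ℝ (Fin d))
    (v : ℝ) : Prop :=
  Integrable (fun S : Fin m → Z => empRisk f S (w S) - empRisk f S (argMin (empRisk f S)))
    (sampleLaw P m) ∧
  ∫ S : Fin m → Z, (empRisk f S (w S) - empRisk f S (argMin (empRisk f S))) ∂(sampleLaw P m) ≤ v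

/-- The first `m` samples of a sample of size `n ≥ m`. -/
def firstSamples {Z : Type*} {m n : ℕ} (h : m ≤ n) (S : Fin n → Z) : Fin m → Z :=
  fun i => S (Fin.castLE h i)

/-- `‖B^(-1/2) (A - B) B^(-1/2)‖_F`. -/
def relFrobError {d : ℕ} (A B : Matrix (Fin d) (Fin d) ℝ) : ℝ :=
  frobNorm (invSqrt B * (A - B) * invSqrt B)

end AdaQN

end

/-! Write m for m₀. The relative error is split along the path ∇²R_m(w_m), ∇²R_m(w*), ∇²R(w*),
∇²R_n(w*), ∇²R_n(w_n*). Concentration is needed only at the deterministic point w*. The two moves of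
the base point are controlled by self-concordance through optimality gaps, whose expectations are
O(1/m).

Moving the base point. For a single loss g, the Bregman error g(y) - g(x) - g'(x)(y - x) is at least
min(r², 1)/8, where r is the length of y - x in the local norm at x (`StrictSC.min_le_breg`). If r ≤
1/2, the Hessians at x and y differ by a relative amount O(r). Otherwise the Bregman error is
bounded below and absorbs the trivial bound L. Hence the Hessians at two points y, w differ, as
quadratic forms, by at most a constant times min(1, √β) ∇²g(w) + β L I, with β the sum of their
Bregman errors from a third point x (`StrictSC.abs_quad_sub_le_of_breg`). If x minimizes the
empirical risk, the gradients sum to zero and the Bregman errors average exactly to optimality gaps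
(`average_breg`). Averaging the matrix bounds, with each Hessian at w* written as mean plus
deviation, gives `relNorm_hess_empRisk_sub_le`. Relative to ∇²R_n(w_n*) the mean Hessian has
Frobenius size about √d instead of κ√d, up to error terms, by a self-bounding argument
(`relNorm_hess_expRisk_le_of_gap`). What remains is of order √(d/m) and κ√d/m, which is why m ≥ C
max{d, κ² s log d} is enough.

Concentration at w*. The mean square Frobenius deviation of ∇²R_m(w*) is σ²/m, with σ² the total
variance of one Hessian, and `hessVar_le` bounds σ² by a constant times s L² log d. As s compares
first moments, this takes two estimates for a sum of n centered Hessians. Its mean Frobenius norm is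
at least √(nσ²/56) for large n, by a fourth moment bound (`le_sq_integral_norm_sum`). Its mean
spectral norm is at most 6L√(n log d) (`integral_specNorm_sum_le`), by a recursion for traces of
even powers in which one summand is exchanged with an independent copy. The definition of s links
the two, and n cancels.

Assembly. Young's inequality with a weight ε turns every square root and product into first moments
of gaps and second moments of deviations (`relFrobError_le`). Only these are integrated, so the
dependence between the gaps, the deviations and the two nested samples plays no role. -/

noncomputable section

namespace AdaQN

/-! ### Scalar differential inequalities along a segment -/

section OneVariable

/-- The inverse square root of a positive solution of `|φ'| ≤ 2 φ ^ (3/2)` is `1`-Lipschitz. -/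
theorem abs_inv_sqrt_sub_le {φ φ' : ℝ → ℝ} (hpos : ∀ t, 0 < φ t)
    (hd : ∀ t, HasDerivAt φ (φ' t) t) (hb : ∀ t, |φ' t| ≤ 2 * (φ t) ^ (3 / 2 : ℝ))
    (s t : ℝ) : |(√(φ t))⁻¹ - (√(φ s))⁻¹| ≤ |t - s| := by
  have hder : ∀ t, HasDerivAt (fun t => (√(φ t))⁻¹)
      (-(φ' t / (2 * √(φ t))) / (√(φ t)) ^ 2) t := fun t =>
    ((hd t).sqrt (hpos t).ne').inv (Real.sqrt_pos.2 (hpos t)).ne'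
  have hbound : ∀ t, ‖-(φ' t / (2 * √(φ t))) / (√(φ t)) ^ 2‖ ≤ 1 := by
    intro t
    have hs : 0 < √(φ t) := Real.sqrt_pos.2 (hpos t)
    have h32 : (φ t) ^ (3 / 2 : ℝ) = √(φ t) ^ 3 := by
      rw [Real.sqrt_eq_rpow, ← Real.rpow_natCast, ← Real.rpow_mul (hpos t).le]
      norm_num
    have h1 := hb t
    rw [h32] at h1
    rw [Real.norm_eq_abs, abs_div, abs_neg, abs_div, abs_of_pos (by positivity : 0 < 2 * √(φ t)),
      abs_of_pos (by positivity : 0 < √(φ t) ^ 2), div_div, div_le_one (by positivity)]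
    linarith
  simpa using Convex.norm_image_sub_le_of_norm_hasDerivWithin_le
    (fun x _ => (hder x).hasDerivWithinAt) (fun x _ => hbound x) convex_univ
    (Set.mem_univ s) (Set.mem_univ t)

/-- Second order lower bound for a function whose second derivative is at least `c` on `[0, 1]`. -/
theorem add_half_le_of_le_second_deriv {ψ ψ₁ ψ₂ : ℝ → ℝ} {c : ℝ}
    (h₁ : ∀ t, HasDerivAt ψ (ψ₁ t) t) (h₂ : ∀ t, HasDerivAt ψ₁ (ψ₂ t) t)
    (hc : ∀ t ∈ Set.Icc (0 : ℝ) 1, c ≤ ψ₂ t) : ψ 0 + ψ₁ 0 + c / 2 ≤ ψ 1 := by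
  have step1 : ∀ t ∈ Set.Icc (0 : ℝ) 1, ψ₁ 0 + c * t ≤ ψ₁ t := by
    have hm : MonotoneOn (fun t => ψ₁ t - c * t) (Set.Icc 0 1) := by
      have hder : ∀ t, HasDerivAt (fun t => ψ₁ t - c * t) (ψ₂ t - c) t := fun t =>
        ((h₂ t).sub ((hasDerivAt_id t).const_mul c)).congr_deriv (by simp)
      refine monotoneOn_of_deriv_nonneg (convex_Icc 0 1)
        (fun t _ => (hder t).continuousAt.continuousWithinAt)
        (fun t _ => (hder t).differentiableAt.differentiableWithinAt) fun t ht => ?_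
      rw [(hder t).deriv]
      linarith [hc t (interior_subset ht)]
    intro t ht
    have := hm (Set.left_mem_Icc.2 zero_le_one) ht ht.1
    simp only [mul_zero, sub_zero] at this
    linarith
  have hm : MonotoneOn (fun t => ψ t - ψ₁ 0 * t - c / 2 * t ^ 2) (Set.Icc 0 1) := by
    have hder : ∀ t, HasDerivAt (fun t => ψ t - ψ₁ 0 * t - c / 2 * t ^ 2)
        (ψ₁ t - ψ₁ 0 - c * t) t := fun t => by
      have := ((h₁ t).sub ((hasDerivAt_id t).const_mul (ψ₁ 0))).sub
        ((hasDerivAt_pow 2 t).const_mul (c / 2))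
      refine this.congr_deriv ?_
      simp; ring
    refine monotoneOn_of_deriv_nonneg (convex_Icc 0 1)
      (fun t _ => (hder t).continuousAt.continuousWithinAt)
      (fun t _ => (hder t).differentiableAt.differentiableWithinAt) fun t ht => ?_
    rw [(hder t).deriv]
    linarith [step1 t (interior_subset ht)]
  have := hm (Set.left_mem_Icc.2 zero_le_one) (Set.right_mem_Icc.2 zero_le_one) zero_le_one
  simp at this
  linarith

end OneVariable

/-! ### Self-concordance: comparison of Hessians through Bregman errors -/

section Calculus

variable {E : Type*} [NormedAddCommGroup E] [NormedSpace ℝ E] {g : E → ℝ}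

/-- The second derivative as a bilinear map. -/
abbrev D2 (g : E → ℝ) : E → E →L[ℝ] E →L[ℝ] ℝ := fderiv ℝ (fderiv ℝ g)

/-- The third derivative as a trilinear map. -/
abbrev D3 (g : E → ℝ) : E → E →L[ℝ] E →L[ℝ] E →L[ℝ] ℝ := fderiv ℝ (D2 g)

/-- The error of the first order expansion of `g` at `x`. -/
def breg (g : E → ℝ) (y x : E) : ℝ := g y - g x - fderiv ℝ g x (y - x)

theorem hasDerivAt_line (hg : Differentiable ℝ g) (x u : E) (t : ℝ) :
    HasDerivAt (fun t : ℝ => g (x + t • u)) (fderiv ℝ g (x + t • u) u) t := by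
  have hl : HasDerivAt (fun t : ℝ => x + t • u) u t := by
    simpa using ((hasDerivAt_id t).smul_const u).const_add x
  exact (hg (x + t • u)).hasFDerivAt.comp_hasDerivAt t hl

theorem hasDerivAt_fderiv_line (hg : Differentiable ℝ (fderiv ℝ g)) (x u v : E) (t : ℝ) :
    HasDerivAt (fun t : ℝ => fderiv ℝ g (x + t • u) v) (D2 g (x + t • u) u v) t := by
  have hl : HasDerivAt (fun t : ℝ => x + t • u) u t := by
    simpa using ((hasDerivAt_id t).smul_const u).const_add x
  have h := (hg (x + t • u)).hasFDerivAt.comp_hasDerivAt t hl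
  simpa using h.clm_apply (hasDerivAt_const t v)

theorem hasDerivAt_D2_line (hg : Differentiable ℝ (D2 g)) (x u v w : E) (t : ℝ) :
    HasDerivAt (fun t : ℝ => D2 g (x + t • u) v w) (D3 g (x + t • u) u v w) t := by
  have hl : HasDerivAt (fun t : ℝ => x + t • u) u t := by
    simpa using ((hasDerivAt_id t).smul_const u).const_add x
  have h : HasDerivAt (fun t : ℝ => D2 g (x + t • u)) (D3 g (x + t • u) u) t :=
    HasFDerivAt.comp_hasDerivAt (E := E →L[ℝ] E →L[ℝ] ℝ) t (hg (x + t • u)).hasFDerivAt hl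
  simpa using (h.clm_apply (hasDerivAt_const t v)).clm_apply (hasDerivAt_const t w)

theorem contDiff_differentiable (hg : ContDiff ℝ 3 g) :
    Differentiable ℝ g ∧ Differentiable ℝ (fderiv ℝ g) ∧ Differentiable ℝ (D2 g) := by
  have h2 : ContDiff ℝ 2 (fderiv ℝ g) := hg.fderiv_right (by norm_num)
  have h1 : ContDiff ℝ 1 (D2 g) := h2.fderiv_right (by norm_num)
  exact ⟨hg.differentiable (by norm_num), h2.differentiable (by norm_num),
    h1.differentiable (by norm_num)⟩

theorem D2_comm (hg : ContDiff ℝ 3 g) (x u v : E) : D2 g x u v = D2 g x v u :=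
  (hg.contDiffAt.isSymmSndFDerivAt (by simp; norm_num)) u v

theorem D3_comm_left (hg : ContDiff ℝ 3 g) (x u v w : E) : D3 g x u v w = D3 g x v u w := by
  have h2 : ContDiff ℝ 2 (fderiv ℝ g) := hg.fderiv_right (by norm_num)
  exact congrArg (fun l => l w) ((h2.contDiffAt.isSymmSndFDerivAt (by simp)) u v)

/-- Differentiate the symmetry of the second derivative along the line in direction u. -/
theorem D3_comm_right (hg : ContDiff ℝ 3 g) (x u v w : E) : D3 g x u v w = D3 g x u w v := by
  have hd := (contDiff_differentiable hg).2.2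
  have h1 := hasDerivAt_D2_line hd x u v w 0
  have h2 := hasDerivAt_D2_line hd x u w v 0
  have : (fun t : ℝ => D2 g (x + t • u) v w) = fun t : ℝ => D2 g (x + t • u) w v := by
    funext t; exact D2_comm hg _ _ _
  rw [this] at h1
  simpa using h1.unique h2

theorem iteratedFDeriv_two_diag (g : E → ℝ) (x u : E) :
    iteratedFDeriv ℝ 2 g x (fun _ => u) = D2 g x u u := by
  rw [iteratedFDeriv_two_apply]

theorem iteratedFDeriv_three_diag (g : E → ℝ) (x u : E) :
    iteratedFDeriv ℝ 3 g x (fun _ => u) = D3 g x u u u := by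
  rw [iteratedFDeriv_succ_apply_right, iteratedFDeriv_two_apply]
  rfl

/-- A `C³` function with positive definite second derivative whose third derivative is bounded as
in the definition of standard self-concordance. -/
structure StrictSC (g : E → ℝ) : Prop where
  contDiff : ContDiff ℝ 3 g
  pos : ∀ x u, u ≠ 0 → 0 < D2 g x u u
  bound : ∀ x u, |D3 g x u u u| ≤ 2 * (D2 g x u u) ^ (3 / 2 : ℝ)

theorem StrictSC.nonneg (h : StrictSC g) (x u : E) : 0 ≤ D2 g x u u := by
  rcases eq_or_ne u 0 with rfl | hu
  · simp
  · exact (h.pos x u hu).le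

/-- Polarization: the cubic form at u + v plus that at u - v equals 2 D³[u,u,u] + 6 D³[u,v,v]. The
quadratic forms at u ± v add up to 4, so the diagonal bounds contribute at most 16, and (16 + 4)/6 ≤
4. The sharp constant is not needed. -/
theorem StrictSC.abs_D3_le_of_unit (h : StrictSC g) (x u v : E) (hu : D2 g x u u = 1)
    (hv : D2 g x v v = 1) : |D3 g x u v v| ≤ 4 := by
  have hsym := D2_comm h.contDiff x
  have l := D3_comm_left h.contDiff x
  have r := D3_comm_right h.contDiff x
  have e1 : D2 g x (u + v) (u + v) + D2 g x (u - v) (u - v) = 4 := by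
    simp only [map_add, map_sub, add_apply, sub_apply]
    linarith
  have e2 : D3 g x (u + v) (u + v) (u + v) + D3 g x (u - v) (u - v) (u - v)
      = 2 * D3 g x u u u + 6 * D3 g x u v v := by
    simp only [map_add, map_sub, add_apply, sub_apply]
    have a1 := l v u v
    have a2 := r v v u
    have a4 := l v u u
    have a5 := r u v u
    linarith
  -- Linearizes the power 3/2, so that only the sum of the two quadratic forms matters.
  have key : ∀ s : ℝ, 0 ≤ s → s ≤ 4 → s ^ (3 / 2 : ℝ) ≤ 2 * s := by
    intro s hs hs4
    have : s ^ (3 / 2 : ℝ) = s * √s := by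
      rw [Real.sqrt_eq_rpow, show (3 / 2 : ℝ) = 1 + 1 / 2 by norm_num,
        Real.rpow_add_of_nonneg hs (by norm_num) (by norm_num), Real.rpow_one]
    rw [this, mul_comm]
    refine mul_le_mul_of_nonneg_right ?_ hs
    rw [Real.sqrt_le_left (by norm_num)]
    linarith
  have n1 := h.nonneg x (u + v)
  have n2 := h.nonneg x (u - v)
  have b1 := (h.bound x (u + v)).trans
    (mul_le_mul_of_nonneg_left (key _ n1 (by linarith)) (by norm_num))
  have b2 := (h.bound x (u - v)).trans
    (mul_le_mul_of_nonneg_left (key _ n2 (by linarith)) (by norm_num))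
  have b3 := h.bound x u
  rw [hu, Real.one_rpow] at b3
  rw [abs_le] at *
  constructor <;> linarith

/-- Homogeneity reduces to local unit vectors. In this mixed form the bound controls how the
quadratic form in a fixed direction v changes when the base point moves along u. -/
theorem StrictSC.abs_D3_le (h : StrictSC g) (x u v : E) :
    |D3 g x u v v| ≤ 4 * √(D2 g x u u) * D2 g x v v := by
  rcases eq_or_ne u 0 with rfl | hu
  · simp
  rcases eq_or_ne v 0 with rfl | hv
  · simp
  have hU := Real.sqrt_pos.2 (h.pos x u hu)
  have hV := Real.sqrt_pos.2 (h.pos x v hv)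
  have sU := Real.sq_sqrt (h.pos x u hu).le
  have sV := Real.sq_sqrt (h.pos x v hv).le
  have := h.abs_D3_le_of_unit x ((√(D2 g x u u))⁻¹ • u) ((√(D2 g x v v))⁻¹ • v)
    (by simp only [map_smul, smul_apply, smul_eq_mul]
        field_simp
        exact sU.symm)
    (by simp only [map_smul, smul_apply, smul_eq_mul]
        field_simp
        exact sV.symm)
  simp only [map_smul, smul_apply, smul_eq_mul, abs_mul, abs_inv,
    abs_of_pos hU, abs_of_pos hV] at this
  rw [← sV]
  set a := √(D2 g x u u)
  set b := √(D2 g x v v)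
  have e : b⁻¹ * (b⁻¹ * (a⁻¹ * |D3 g x u v v|)) = |D3 g x u v v| / (a * b ^ 2) := by
    field_simp
  rw [e, div_le_iff₀ (by positivity)] at this
  linarith

theorem StrictSC.hasDerivAt_quad (h : StrictSC g) (x u v : E) (t : ℝ) :
    HasDerivAt (fun t : ℝ => D2 g (x + t • u) v v) (D3 g (x + t • u) u v v) t :=
  hasDerivAt_D2_line (contDiff_differentiable h.contDiff).2.2 x u v v t

theorem StrictSC.local_norm_bounds (h : StrictSC g) {x u : E} (hu : u ≠ 0) {t : ℝ}
    (ht : t ∈ Set.Icc (0 : ℝ) 1) :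
    (√(D2 g (x + t • u) u u))⁻¹ ≤ (√(D2 g x u u))⁻¹ + 1 ∧
      (√(D2 g x u u))⁻¹ - 1 ≤ (√(D2 g (x + t • u) u u))⁻¹ := by
  have := abs_inv_sqrt_sub_le (φ := fun t : ℝ => D2 g (x + t • u) u u)
    (fun t => h.pos _ u hu) (fun t => h.hasDerivAt_quad x u u t)
    (fun t => h.bound (x + t • u) u) 0 t
  simp only [zero_smul, add_zero, sub_zero, abs_of_nonneg ht.1] at this
  rw [abs_le] at this
  constructor <;> linarith [ht.2]

/-- When the local length of u is at most 1, its inverse at most doubles along the segment. The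
second derivative in direction u thus stays above a quarter of its initial value, and Taylor's
formula contributes another factor 1/2. -/
theorem StrictSC.breg_add_of_le_one (h : StrictSC g) {x u : E}
    (hr : D2 g x u u ≤ 1) : D2 g x u u / 8 ≤ breg g (x + u) x := by
  rcases eq_or_ne u 0 with rfl | hu
  · simp [breg]
  have hd := contDiff_differentiable h.contDiff
  have hs := Real.sqrt_pos.2 (h.pos x u hu)
  have hs1 : √(D2 g x u u) ≤ 1 := by simpa using Real.sqrt_le_sqrt hr
  have key := add_half_le_of_le_second_deriv (c := D2 g x u u / 4)
    (fun t => hasDerivAt_line hd.1 x u t)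
    (fun t => hasDerivAt_fderiv_line hd.2.1 x u u t) (fun t ht => by
      have hb := (h.local_norm_bounds (x := x) hu ht).1
      have hp := Real.sqrt_pos.2 (h.pos (x + t • u) u hu)
      have h2 : (√(D2 g (x + t • u) u u))⁻¹ ≤ 2 * (√(D2 g x u u))⁻¹ := by
        have := (one_le_inv₀ hs).2 hs1
        linarith
      have h3 : √(D2 g x u u) ≤ 2 * √(D2 g (x + t • u) u u) := by
        rw [← div_eq_mul_inv, inv_eq_one_div, div_le_div_iff₀ hp hs] at h2
        linarith
      have h4 := mul_self_le_mul_self hs.le h3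
      rw [Real.mul_self_sqrt (h.nonneg _ _)] at h4
      have := Real.mul_self_sqrt (h.nonneg (x + t • u) u)
      nlinarith)
  simp only [zero_smul, add_zero, one_smul] at key
  simp only [breg, add_sub_cancel_left]
  linarith

/-- For a convex function the first order error dominates its value at a shorter step. -/
theorem breg_smul_le (hc : ConvexOn ℝ Set.univ g) (hpos : ∀ y x, 0 ≤ breg g y x) (x u : E)
    {s : ℝ} (hs0 : 0 ≤ s) (hs1 : s ≤ 1) : breg g (x + s • u) x ≤ breg g (x + u) x := by
  have h1 := hc.2 (Set.mem_univ x) (Set.mem_univ (x + u)) (sub_nonneg.2 hs1) hs0 (by ring)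
  have h2 := hpos (x + u) x
  have e : (1 - s) • x + s • (x + u) = x + s • u := by
    rw [sub_smul, smul_add, one_smul]; abel
  rw [e] at h1
  simp only [breg, add_sub_cancel_left, map_smul, smul_eq_mul] at h1 h2 ⊢
  nlinarith

theorem StrictSC.breg_nonneg (h : StrictSC g) (y x : E) : 0 ≤ breg g y x := by
  have hd := contDiff_differentiable h.contDiff
  have key := add_half_le_of_le_second_deriv (c := 0)
    (fun t => hasDerivAt_line hd.1 x (y - x) t)
    (fun t => hasDerivAt_fderiv_line hd.2.1 x (y - x) (y - x) t) (fun t _ => h.nonneg _ _)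
  simp only [zero_smul, add_zero, one_smul, add_sub_cancel] at key
  simp only [breg]
  linarith

/-- A step of local length above 1 is shortened to length 1. By convexity this does not increase the
Bregman error, and the short-step bound applies. -/
theorem StrictSC.min_le_breg (h : StrictSC g) (hc : ConvexOn ℝ Set.univ g) (y x : E) :
    min (D2 g x (y - x) (y - x)) 1 / 8 ≤ breg g y x := by
  obtain ⟨u, rfl⟩ : ∃ u, y = x + u := ⟨y - x, by simp⟩
  rw [add_sub_cancel_left]
  rcases le_total (D2 g x u u) 1 with hr | hr
  · rw [min_eq_left hr]; exact h.breg_add_of_le_one hr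
  · rw [min_eq_right hr]
    have hr0 : 0 < D2 g x u u := by linarith
    have hs : 1 ≤ √(D2 g x u u) := by simpa using Real.sqrt_le_sqrt hr
    have hs0 : 0 < √(D2 g x u u) := by linarith
    have e : D2 g x ((√(D2 g x u u))⁻¹ • u) ((√(D2 g x u u))⁻¹ • u) = 1 := by
      simp only [map_smul, smul_apply, smul_eq_mul]
      field_simp
      exact (Real.sq_sqrt hr0.le).symm
    have h1 := h.breg_add_of_le_one (x := x) e.le
    rw [e] at h1
    exact h1.trans (breg_smul_le hc h.breg_nonneg x u (by positivity) (inv_le_one_of_one_le₀ hs))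

/-- Within local distance `1 / 2` the logarithm of the second derivative is Lipschitz. -/
theorem StrictSC.abs_log_quad_sub_le (h : StrictSC g) {x u v : E} (hv : v ≠ 0)
    (hr : √(D2 g x u u) ≤ 1 / 2) :
    |Real.log (D2 g (x + u) v v) - Real.log (D2 g x v v)| ≤ 8 * √(D2 g x u u) := by
  rcases eq_or_ne u 0 with rfl | hu
  · simp
  have hs := Real.sqrt_pos.2 (h.pos x u hu)
  -- The logarithmic derivative D³[u,v,v] / D²[v,v] is at most four times the local length of u,
  -- which at most doubles on the segment since it starts below 1/2.
  have hder : ∀ t : ℝ, HasDerivAt (fun t : ℝ => Real.log (D2 g (x + t • u) v v))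
      (D3 g (x + t • u) u v v / D2 g (x + t • u) v v) t := fun t =>
    (h.hasDerivAt_quad x u v t).log (h.pos _ v hv).ne'
  have := norm_image_sub_le_of_norm_deriv_le_segment_01' (C := 8 * √(D2 g x u u))
    (fun t _ => (hder t).hasDerivWithinAt) (fun t ht => by
      have ht' : t ∈ Set.Icc (0 : ℝ) 1 := ⟨ht.1, ht.2.le⟩
      have hb := (h.local_norm_bounds (x := x) hu ht').2
      have hp := Real.sqrt_pos.2 (h.pos (x + t • u) u hu)
      have h2 : (√(D2 g x u u))⁻¹ ≤ 2 * (√(D2 g (x + t • u) u u))⁻¹ := by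
        have : 2 ≤ (√(D2 g x u u))⁻¹ := by
          rw [le_inv_comm₀ (by norm_num) hs]
          linarith
        linarith
      have h3 : √(D2 g (x + t • u) u u) ≤ 2 * √(D2 g x u u) := by
        rw [← div_eq_mul_inv, inv_eq_one_div, div_le_div_iff₀ hs hp] at h2
        linarith
      have hvp := h.pos (x + t • u) v hv
      rw [Real.norm_eq_abs, abs_div, abs_of_pos hvp, div_le_iff₀ hvp]
      refine (h.abs_D3_le _ _ _).trans (mul_le_mul_of_nonneg_right ?_ hvp.le)
      linarith)
  simpa using this

/-- Exponentiate, with exp c ≤ exp 4 ≤ 3⁴ = 81 and exp c - 1 ≤ c exp c. The range c ≤ 4 is what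
local distance 1/2 gives in the logarithmic estimate. -/
theorem abs_sub_le_of_abs_log_sub_le {p q c : ℝ} (hp : 0 < p) (hq : 0 < q) (hc4 : c ≤ 4)
    (h : |Real.log q - Real.log p| ≤ c) :
    q ≤ 81 * p ∧ p ≤ 81 * q ∧ |q - p| ≤ 81 * c * p := by
  have hc : 0 ≤ c := (abs_nonneg _).trans h
  have he : Real.exp c ≤ 81 := by
    have h1 : Real.exp 4 ≤ 81 := by
      have : Real.exp 4 = Real.exp 1 ^ 4 := by rw [← Real.exp_nat_mul]; norm_num
      rw [this]
      calc Real.exp 1 ^ 4 ≤ 3 ^ 4 :=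
            pow_le_pow_left₀ (Real.exp_pos 1).le (by linarith [Real.exp_one_lt_d9]) 4
        _ = 81 := by norm_num
    exact (Real.exp_le_exp.2 hc4).trans h1
  rw [abs_le] at h
  have h1 : q ≤ Real.exp c * p := by
    rw [← Real.exp_log hp, ← Real.exp_add, ← Real.log_le_iff_le_exp hq]; linarith
  have h2 : p ≤ Real.exp c * q := by
    rw [← Real.exp_log hq, ← Real.exp_add, ← Real.log_le_iff_le_exp hp]; linarith
  have h3 : Real.exp c - 1 ≤ c * Real.exp c := by
    have := Real.add_one_le_exp (-c)
    have h4 : Real.exp c * Real.exp (-c) = 1 := by rw [← Real.exp_add]; simp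
    nlinarith [Real.exp_pos c]
  have h4 : (1 - c) * p ≤ q := by
    have := Real.add_one_le_exp (-c)
    have h5 : Real.exp (-c) * p ≤ q := by
      rw [← Real.exp_log hp, ← Real.exp_add, ← Real.le_log_iff_exp_le hq]; linarith
    nlinarith
  refine ⟨h1.trans (mul_le_mul_of_nonneg_right he hp.le),
    h2.trans (mul_le_mul_of_nonneg_right he hq.le), ?_⟩
  have hcp : 0 ≤ c * p := by positivity
  rw [abs_le]
  constructor
  · nlinarith
  · nlinarith [mul_le_mul_of_nonneg_left he hcp, mul_le_mul_of_nonneg_right h3 hp.le]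

/-- Comparison of the second derivatives at two points through the first order error. -/
theorem StrictSC.abs_quad_sub_le (h : StrictSC g) (hc : ConvexOn ℝ Set.univ g) {L : ℝ}
    (hL : ∀ x v, D2 g x v v ≤ L * ‖v‖ ^ 2) (y x v : E) :
    (|D2 g y v v - D2 g x v v| ≤ 2000 * min 1 (√(breg g y x)) * D2 g x v v
        + 32 * breg g y x * (L * ‖v‖ ^ 2)) ∧
      (D2 g x v v ≤ 81 * D2 g y v v + 32 * breg g y x * (L * ‖v‖ ^ 2)) ∧
      (D2 g y v v ≤ 81 * D2 g x v v + 32 * breg g y x * (L * ‖v‖ ^ 2)) := by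
  rcases eq_or_ne v 0 with rfl | hv
  · simp
  have hb := h.min_le_breg hc y x
  have hb0 := h.breg_nonneg y x
  have hx := h.pos x v hv
  have hy := h.pos y v hv
  have hLx := hL x v
  have hLy := hL y v
  have hm0 : 0 ≤ min 1 (√(breg g y x)) := le_min zero_le_one (Real.sqrt_nonneg _)
  have hLv : 0 ≤ L * ‖v‖ ^ 2 := hx.le.trans hLx
  -- Near case: the local distance is at most 3 min(1, √breg), and 81·8·3 ≤ 2000. Far case: the
  -- Bregman error is at least 1/32, so the crude bound L‖v‖² on either form is absorbed by the last
  -- term.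
  rcases le_or_gt (√(D2 g x (y - x) (y - x))) (1 / 2) with hr | hr
  · have hlog := h.abs_log_quad_sub_le hv hr
    rw [add_sub_cancel] at hlog
    obtain ⟨h1, h2, h3⟩ := abs_sub_le_of_abs_log_sub_le hx hy (by linarith) hlog
    have hr0 := Real.sqrt_nonneg (D2 g x (y - x) (y - x))
    have hsq := Real.sq_sqrt (h.nonneg x (y - x))
    have hr1 : D2 g x (y - x) (y - x) ≤ 1 := by nlinarith
    rw [min_eq_left hr1] at hb
    have hr3 : √(D2 g x (y - x) (y - x)) ≤ 3 * min 1 (√(breg g y x)) := by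
      rw [mul_min_of_nonneg _ _ (by norm_num : (0 : ℝ) ≤ 3)]
      refine le_min (by linarith) ?_
      rw [Real.sqrt_le_left (by positivity), mul_pow, Real.sq_sqrt hb0]
      linarith
    have hp : 0 ≤ 32 * breg g y x * (L * ‖v‖ ^ 2) := by positivity
    refine ⟨?_, by linarith, by linarith⟩
    have : 81 * (8 * √(D2 g x (y - x) (y - x))) * D2 g x v v
        ≤ 2000 * min 1 (√(breg g y x)) * D2 g x v v := by
      refine mul_le_mul_of_nonneg_right ?_ hx.le
      linarith
    linarith
  · have hbig : 1 / 4 ≤ D2 g x (y - x) (y - x) := by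
      have hsq := Real.sq_sqrt (h.nonneg x (y - x))
      nlinarith
    have : 1 / 32 ≤ breg g y x := by
      refine le_trans ?_ hb
      rw [div_le_div_iff₀ (by norm_num) (by norm_num)]
      have : (1 : ℝ) / 4 ≤ min (D2 g x (y - x) (y - x)) 1 := le_min hbig (by norm_num)
      linarith
    have h32 : L * ‖v‖ ^ 2 ≤ 32 * breg g y x * (L * ‖v‖ ^ 2) :=
      le_mul_of_one_le_left hLv (by linarith)
    have hp : 0 ≤ 2000 * min 1 (√(breg g y x)) * D2 g x v v := by positivity
    refine ⟨?_, by linarith, by linarith⟩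
    rw [abs_le]
    constructor <;> linarith

/-- Comparison of the second derivatives at two points through the sum of the errors of the first
order expansion at a third point. -/
theorem StrictSC.abs_quad_sub_le_of_breg (h : StrictSC g) (hc : ConvexOn ℝ Set.univ g) {L : ℝ}
    (hL : ∀ x v, D2 g x v v ≤ L * ‖v‖ ^ 2) (y₁ y₂ x v : E) :
    |D2 g y₁ v v - D2 g y₂ v v| ≤
      400000 * (min 1 (√(breg g y₁ x + breg g y₂ x)) * D2 g y₂ v v
        + (breg g y₁ x + breg g y₂ x) * (L * ‖v‖ ^ 2)) := by
  obtain ⟨a1, -, -⟩ := h.abs_quad_sub_le hc hL y₁ x v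
  obtain ⟨b1, b2, -⟩ := h.abs_quad_sub_le hc hL y₂ x v
  have n1 := h.breg_nonneg y₁ x
  have n2 := h.breg_nonneg y₂ x
  have hy := h.nonneg y₂ v
  have hx := h.nonneg x v
  have hLv : 0 ≤ L * ‖v‖ ^ 2 := hx.trans (hL x v)
  set m := min 1 (√(breg g y₁ x + breg g y₂ x)) with hm
  have m1 : min 1 (√(breg g y₁ x)) ≤ m :=
    min_le_min le_rfl (Real.sqrt_le_sqrt (by linarith))
  have m2 : min 1 (√(breg g y₂ x)) ≤ m :=
    min_le_min le_rfl (Real.sqrt_le_sqrt (by linarith))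
  have hm1 : m ≤ 1 := min_le_left _ _
  have hm0 : 0 ≤ m := le_min zero_le_one (Real.sqrt_nonneg _)
  have t1 := mul_le_mul_of_nonneg_right m1 hx
  have t2 := mul_le_mul_of_nonneg_right m2 hx
  -- The form at the intermediate point x is traded for the one at y₂. The price is 4000·81 on the
  -- relative term and, since m ≤ 1, 4000·32 on the term linear in the Bregman error, both within
  -- 400000.
  have t3 := mul_le_mul_of_nonneg_left b2 hm0
  have t4 : m * (32 * breg g y₂ x * (L * ‖v‖ ^ 2)) ≤ 32 * (breg g y₂ x * (L * ‖v‖ ^ 2)) := by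
    have : 0 ≤ 32 * (breg g y₂ x * (L * ‖v‖ ^ 2)) := by positivity
    nlinarith
  have t5 : 0 ≤ breg g y₁ x * (L * ‖v‖ ^ 2) := by positivity
  have t6 : 0 ≤ breg g y₂ x * (L * ‖v‖ ^ 2) := by positivity
  have t7 : 0 ≤ m * D2 g y₂ v v := by positivity
  have := abs_sub_le (D2 g y₁ v v) (D2 g x v v) (D2 g y₂ v v)
  rw [abs_sub_comm (D2 g x v v)] at this
  linarith

end Calculus

/-! ### Hessian bounds and minimizers from strong convexity and Lipschitz gradients -/

section StrongConvexity

variable {E : Type*} [NormedAddCommGroup E] [InnerProductSpace ℝ E] {g : E → ℝ} {μ L : ℝ}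

/-- Restricted to a line, g minus (μ/2)‖·‖² is convex, so its derivative is monotone and its second
derivative is nonnegative. -/
theorem le_D2_of_strongConvexOn (hg : Differentiable ℝ g) (hg' : Differentiable ℝ (fderiv ℝ g))
    (hs : StrongConvexOn Set.univ μ g) (x v : E) : μ * ‖v‖ ^ 2 ≤ D2 g x v v := by
  rw [strongConvexOn_iff_convex] at hs
  set k : ℝ → ℝ := fun t => g (x + t • v) - μ / 2 * ‖x + t • v‖ ^ 2 with hk
  have hl : ∀ t : ℝ, HasDerivAt (fun t : ℝ => x + t • v) v t := fun t => by
    simpa using ((hasDerivAt_id t).smul_const v).const_add x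
  have hconv : ConvexOn ℝ Set.univ k := by
    refine ⟨convex_univ, fun s _ t _ a b ha hb hab => ?_⟩
    have := hs.2 (Set.mem_univ (x + s • v)) (Set.mem_univ (x + t • v)) ha hb hab
    have e : a • (x + s • v) + b • (x + t • v) = x + (a • s + b • t) • v := by
      have : x = (a + b) • x := by rw [hab, one_smul]
      conv_rhs => rw [this]
      simp only [smul_add, add_smul, smul_smul, smul_eq_mul]
      abel
    rw [e] at this
    exact this
  have hd1 : ∀ t, HasDerivAt k (fderiv ℝ g (x + t • v) v - μ * inner ℝ (x + t • v) v) t := by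
    intro t
    have h1 := hasDerivAt_line hg x v t
    have h2 := ((hl t).norm_sq).const_mul (μ / 2)
    exact (h1.sub h2).congr_deriv (by ring)
  have hderiv : deriv k = fun t => fderiv ℝ g (x + t • v) v - μ * inner ℝ (x + t • v) v :=
    funext fun t => (hd1 t).deriv
  have hmono : Monotone (deriv k) := by
    rw [← monotoneOn_univ]
    exact hconv.monotoneOn_deriv fun t _ => (hd1 t).differentiableAt
  have hd2 : HasDerivAt (deriv k) (D2 g x v v - μ * ‖v‖ ^ 2) 0 := by
    rw [hderiv]
    have h1 := hasDerivAt_fderiv_line hg' x v v 0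
    have h2 := (((hl 0).inner ℝ (hasDerivAt_const 0 v))).const_mul μ
    refine (h1.sub h2).congr_deriv ?_
    simp
  have : 0 ≤ D2 g x v v - μ * ‖v‖ ^ 2 := by
    rw [← hd2.deriv]
    exact hmono.deriv_nonneg
  linarith

theorem norm_D2_le_of_lipschitz [CompleteSpace E] (hL : LipschitzWith L.toNNReal (gradient g))
    (hL0 : 0 ≤ L) (x : E) : ‖D2 g x‖ ≤ L := by
  have : LipschitzWith L.toNNReal (fderiv ℝ g) := by
    have e : fderiv ℝ g = fun x => InnerProductSpace.toDual ℝ E (gradient g x) := by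
      funext y; simp [gradient]
    rw [e]
    have := (InnerProductSpace.toDual ℝ E).isometry.lipschitz.comp hL
    simpa using this
  have := norm_fderiv_le_of_lipschitz ℝ (x₀ := x) this
  rwa [Real.coe_toNNReal L hL0] at this

theorem quadratic_lower_bound (hg : Differentiable ℝ g) (hg' : Differentiable ℝ (fderiv ℝ g))
    (hD : ∀ x v, μ * ‖v‖ ^ 2 ≤ D2 g x v v) (x y : E) :
    g x + fderiv ℝ g x (y - x) + μ / 2 * ‖y - x‖ ^ 2 ≤ g y := by
  have := add_half_le_of_le_second_deriv (fun t => hasDerivAt_line hg x (y - x) t)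
    (fun t => hasDerivAt_fderiv_line hg' x (y - x) (y - x) t) (fun t _ => hD _ (y - x))
  simp only [zero_smul, add_zero, one_smul, add_sub_cancel] at this
  linarith

theorem exists_minimizer [FiniteDimensional ℝ E] (hμ : 0 < μ) (hg : Differentiable ℝ g)
    (hg' : Differentiable ℝ (fderiv ℝ g)) (hD : ∀ x v, μ * ‖v‖ ^ 2 ≤ D2 g x v v) :
    ∃ x, ∀ y, g x ≤ g y := by
  refine hg.continuous.exists_forall_le' 0 ?_
  have hev : ∀ᶠ y : E in Filter.cocompact E, 2 * ‖fderiv ℝ g 0‖ / μ ≤ ‖y‖ :=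
    (tendsto_norm_cocompact_atTop (E := E)).eventually_ge_atTop _
  filter_upwards [hev] with y hy
  have h := quadratic_lower_bound hg hg' hD 0 y
  simp only [sub_zero] at h
  have h1 : -(‖fderiv ℝ g 0‖ * ‖y‖) ≤ fderiv ℝ g 0 y :=
    neg_le_of_abs_le ((fderiv ℝ g 0).le_opNorm y)
  rw [div_le_iff₀ hμ] at hy
  nlinarith [norm_nonneg y]

theorem add_sq_le_of_minimizer (hg : Differentiable ℝ g) (hg' : Differentiable ℝ (fderiv ℝ g))
    (hD : ∀ x v, μ * ‖v‖ ^ 2 ≤ D2 g x v v) {x : E} (hx : ∀ y, g x ≤ g y) (y : E) :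
    g x + μ / 2 * ‖y - x‖ ^ 2 ≤ g y := by
  have h0 : fderiv ℝ g x = 0 := IsLocalMin.fderiv_eq_zero (Filter.Eventually.of_forall hx)
  have := quadratic_lower_bound hg hg' hD x y
  simpa [h0] using this

end StrongConvexity

/-- Derivatives as limits of sequences of difference quotients: this is how measurability in the
sample passes from the loss to its first two derivatives. -/
theorem tendsto_slope_seq {E F : Type*} [NormedAddCommGroup E] [NormedSpace ℝ E]
    [NormedAddCommGroup F] [NormedSpace ℝ F] {g : E → F} {w : E}
    (hg : DifferentiableAt ℝ g w) (v : E) :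
    Filter.Tendsto (fun k : ℕ => ((k : ℝ) + 1) • (g (w + ((k : ℝ) + 1)⁻¹ • v) - g w))
      Filter.atTop (nhds (fderiv ℝ g w v)) :=
  (hg.hasFDerivAt.lim_real v).comp
    (Filter.tendsto_atTop_add_const_right _ _ tendsto_natCast_atTop_atTop)

/-- A minimizer that depends measurably on parameters, as it is separated from every closed set
that does not contain it. -/
theorem measurable_minimizer {E Ω : Type*} [NormedAddCommGroup E] [SecondCountableTopology E]
    [MeasurableSpace E] [BorelSpace E] [MeasurableSpace Ω] {μ : ℝ} (hμ : 0 < μ) {G : E → Ω → ℝ}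
    (hm : ∀ w, Measurable (G w)) (hc : ∀ ω, Continuous fun w => G w ω) {x : Ω → E}
    (hx : ∀ ω w, G (x ω) ω + μ / 2 * ‖w - x ω‖ ^ 2 ≤ G w ω) : Measurable x := by
  refine measurable_of_isOpen fun U hU => ?_
  obtain ⟨Q, hQc, hQd⟩ := TopologicalSpace.exists_countable_dense E
  obtain ⟨Q', hQ's, hQ'c, hQ'd⟩ :=
    (TopologicalSpace.IsSeparable.of_separableSpace Uᶜ).exists_countable_dense_subset
  -- By quadratic growth, the minimizer lies in U exactly when some point of a countable dense set
  -- beats all of a countable dense subset of the complement by a margin 1/(k+1). Only countably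
  -- many evaluations are involved.
  have key : x ⁻¹' U = ⋃ q ∈ Q, ⋃ k : ℕ, ⋂ q' ∈ Q',
      {ω | G q ω + 1 / ((k : ℝ) + 1) ≤ G q' ω} := by
    ext ω
    simp only [Set.mem_preimage, Set.mem_iUnion, Set.mem_iInter, Set.mem_ofPred_eq, exists_prop]
    constructor
    · intro hω
      obtain ⟨ε, hε, hball⟩ := Metric.isOpen_iff.1 hU _ hω
      have hpos : 0 < μ / 4 * ε ^ 2 := by positivity
      have hnear : ∃ q ∈ Q, G q ω < G (x ω) ω + μ / 4 * ε ^ 2 :=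
        hQd.exists_mem_open (isOpen_lt (hc ω) continuous_const) ⟨x ω, by simpa using hpos⟩
          |>.imp fun q hq => ⟨hq.1, hq.2⟩
      obtain ⟨q, hqQ, hq⟩ := hnear
      obtain ⟨k, hk⟩ := exists_nat_one_div_lt hpos
      refine ⟨q, hqQ, k, fun q' hq' => ?_⟩
      have h1 := hx ω q'
      have h2 : ε ≤ ‖q' - x ω‖ := by
        by_contra hlt
        push Not at hlt
        exact hQ's hq' (hball (by simpa [dist_eq_norm] using hlt))
      have h3 : ε ^ 2 ≤ ‖q' - x ω‖ ^ 2 := by gcongr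
      nlinarith
    · rintro ⟨q, -, k, hk⟩
      by_contra hω
      have hcl : x ω ∈ closure Q' := hQ'd hω
      have hclosed : IsClosed {w | G q ω + 1 / ((k : ℝ) + 1) ≤ G w ω} :=
        isClosed_le continuous_const (hc ω)
      have h1 : G q ω + 1 / ((k : ℝ) + 1) ≤ G (x ω) ω :=
        closure_minimal (fun q' hq' => hk q' hq') hclosed hcl
      have h2 := hx ω q
      have h3 : 0 < 1 / ((k : ℝ) + 1) := by positivity
      have h4 : 0 ≤ μ / 2 * ‖q - x ω‖ ^ 2 := by positivity
      linarith
  rw [key]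
  exact MeasurableSet.biUnion hQc fun q _ => MeasurableSet.iUnion fun k =>
    MeasurableSet.biInter hQ'c fun q' _ => measurableSet_le ((hm q).add_const _) (hm q')

/-! ### Hessian matrices, argmin, and derivatives of the empirical risk -/

section Hessian

variable {d : ℕ} {g : EuclideanSpace ℝ (Fin d) → ℝ}

theorem hess_apply (g : EuclideanSpace ℝ (Fin d) → ℝ) (w : EuclideanSpace ℝ (Fin d))
    (i j : Fin d) : hess g w i j =
      D2 g w (EuclideanSpace.single i 1) (EuclideanSpace.single j 1) := by
  simp [hess, iteratedFDeriv_two_apply]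

theorem hess_quad (g : EuclideanSpace ℝ (Fin d) → ℝ) (w v : EuclideanSpace ℝ (Fin d)) :
    dotProduct v.ofLp ((hess g w).mulVec v.ofLp) = D2 g w v v := by
  have hv : v = ∑ i, v i • EuclideanSpace.single i (1 : ℝ) := by
    ext j; simp [Pi.single_apply]
  conv_rhs => rw [hv]
  simp only [dotProduct, Matrix.mulVec, hess_apply, map_sum, map_smul,
    sum_apply, smul_apply, smul_eq_mul, Finset.mul_sum]
  rw [Finset.sum_comm]
  refine Finset.sum_congr rfl fun i _ => Finset.sum_congr rfl fun j _ => by ring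

theorem hess_isSymm (hg : ContDiff ℝ 3 g) (w : EuclideanSpace ℝ (Fin d)) :
    (hess g w).transpose = hess g w := by
  ext i j
  rw [Matrix.transpose_apply, hess_apply, hess_apply, D2_comm hg]

theorem argMin_le (h : ∃ x, ∀ y, g x ≤ g y) (y : EuclideanSpace ℝ (Fin d)) :
    g (argMin g) ≤ g y := Classical.epsilon_spec h y

end Hessian

section EmpiricalRisk

variable {d n : ℕ} {Z : Type*} {f : EuclideanSpace ℝ (Fin d) → Z → ℝ}

theorem hasFDerivAt_empRisk (h : ∀ z, Differentiable ℝ fun w => f w z) (S : Fin n → Z)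
    (w : EuclideanSpace ℝ (Fin d)) :
    HasFDerivAt (empRisk f S) ((1 / (n : ℝ)) • ∑ i, fderiv ℝ (fun w => f w (S i)) w) w :=
  (HasFDerivAt.fun_sum fun i _ => (h (S i) w).hasFDerivAt).const_mul _

theorem fderiv_empRisk (h : ∀ z, Differentiable ℝ fun w => f w z) (S : Fin n → Z) :
    fderiv ℝ (empRisk f S) =
      fun w => (1 / (n : ℝ)) • ∑ i, fderiv ℝ (fun w => f w (S i)) w :=
  funext fun w => (hasFDerivAt_empRisk h S w).fderiv

theorem hasFDerivAt_fderiv_empRisk (h : ∀ z, Differentiable ℝ fun w => f w z)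
    (h' : ∀ z, Differentiable ℝ (fderiv ℝ fun w => f w z)) (S : Fin n → Z)
    (w : EuclideanSpace ℝ (Fin d)) :
    HasFDerivAt (fderiv ℝ (empRisk f S)) ((1 / (n : ℝ)) • ∑ i, D2 (fun w => f w (S i)) w) w := by
  rw [fderiv_empRisk h]
  exact (HasFDerivAt.fun_sum fun i _ => (h' (S i) w).hasFDerivAt).const_smul (1 / (n : ℝ))

theorem hess_empRisk (h : ∀ z, Differentiable ℝ fun w => f w z)
    (h' : ∀ z, Differentiable ℝ (fderiv ℝ fun w => f w z)) (S : Fin n → Z)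
    (w : EuclideanSpace ℝ (Fin d)) :
    hess (empRisk f S) w = (1 / (n : ℝ)) • ∑ i, hess (fun w => f w (S i)) w := by
  ext i j
  rw [hess_apply, D2, (hasFDerivAt_fderiv_empRisk h h' S w).fderiv]
  simp [Matrix.sum_apply, hess_apply, sum_apply]

end EmpiricalRisk

/-! ### Consequences of the standing assumptions for losses and the empirical risk -/

section Loss

variable {d : ℕ} {Z : Type*} [MeasurableSpace Z] {P : Measure Z}
  {f : EuclideanSpace ℝ (Fin d) → Z → ℝ} {μ L : ℝ}

namespace LossAssumptions

theorem contDiff (h : LossAssumptions P f μ L) (z : Z) : ContDiff ℝ 3 fun w => f w z :=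
  (h.selfConcordant z).2.1

theorem le_D2 (h : LossAssumptions P f μ L) (z : Z) (x v : EuclideanSpace ℝ (Fin d)) :
    μ * ‖v‖ ^ 2 ≤ D2 (fun w => f w z) x v v :=
  le_D2_of_strongConvexOn (contDiff_differentiable (h.contDiff z)).1
    (contDiff_differentiable (h.contDiff z)).2.1 (h.strongConvex z) x v

theorem norm_D2_le (h : LossAssumptions P f μ L) (hL : 0 ≤ L) (z : Z)
    (x : EuclideanSpace ℝ (Fin d)) : ‖D2 (fun w => f w z) x‖ ≤ L :=
  norm_D2_le_of_lipschitz (h.gradLipschitz z) hL x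

theorem D2_le (h : LossAssumptions P f μ L) (hL : 0 ≤ L) (z : Z)
    (x v : EuclideanSpace ℝ (Fin d)) : D2 (fun w => f w z) x v v ≤ L * ‖v‖ ^ 2 := by
  have h1 := (D2 (fun w => f w z) x).le_opNorm₂ v v
  have h2 := h.norm_D2_le hL z x
  have h3 := le_of_abs_le h1
  nlinarith [mul_nonneg (norm_nonneg v) (norm_nonneg v)]

theorem strictSC (h : LossAssumptions P f μ L) (hμ : 0 < μ) (z : Z) :
    StrictSC fun w => f w z where
  contDiff := h.contDiff z
  pos x u hu := lt_of_lt_of_le (by positivity) (h.le_D2 z x u)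
  bound x u := by
    have := (h.selfConcordant z).2.2 x u
    rwa [iteratedFDeriv_two_diag, iteratedFDeriv_three_diag] at this

end LossAssumptions

variable {n : ℕ}

namespace LossAssumptions

theorem differentiable (h : LossAssumptions P f μ L) (z : Z) : Differentiable ℝ fun w => f w z :=
  (contDiff_differentiable (h.contDiff z)).1

theorem differentiable_fderiv (h : LossAssumptions P f μ L) (z : Z) :
    Differentiable ℝ (fderiv ℝ fun w => f w z) :=
  (contDiff_differentiable (h.contDiff z)).2.1

theorem empRisk_minimizer (h : LossAssumptions P f μ L) (hμ : 0 < μ) (hn : 0 < n)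
    (S : Fin n → Z) (y : EuclideanSpace ℝ (Fin d)) :
    empRisk f S (argMin (empRisk f S)) + μ / 2 * ‖y - argMin (empRisk f S)‖ ^ 2
      ≤ empRisk f S y := by
  have h1 : Differentiable ℝ (empRisk f S) := fun w =>
    (hasFDerivAt_empRisk h.differentiable S w).differentiableAt
  have h2 : Differentiable ℝ (fderiv ℝ (empRisk f S)) := fun w =>
    (hasFDerivAt_fderiv_empRisk h.differentiable h.differentiable_fderiv S w).differentiableAt
  have hn' : (0 : ℝ) < n := by exact_mod_cast hn
  have hD : ∀ x v, μ * ‖v‖ ^ 2 ≤ D2 (empRisk f S) x v v := by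
    intro x v
    rw [D2, (hasFDerivAt_fderiv_empRisk h.differentiable h.differentiable_fderiv S x).fderiv]
    simp only [smul_apply, sum_apply, smul_eq_mul]
    have : ∑ _i : Fin n, μ * ‖v‖ ^ 2 ≤ ∑ i, D2 (fun w => f w (S i)) x v v :=
      Finset.sum_le_sum fun i _ => h.le_D2 (S i) x v
    rw [Finset.sum_const, Finset.card_univ, Fintype.card_fin, nsmul_eq_mul] at this
    rw [one_div, ← div_eq_inv_mul, le_div_iff₀ hn']
    linarith
  exact add_sq_le_of_minimizer h1 h2 hD (argMin_le (exists_minimizer hμ h1 h2 hD)) y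

theorem measurable_argMin_empRisk (h : LossAssumptions P f μ L) (hμ : 0 < μ) (hn : 0 < n) :
    Measurable fun S : Fin n → Z => argMin (empRisk f S) := by
  refine measurable_minimizer hμ (G := fun w S => empRisk f S w) (fun w => ?_) (fun S => ?_)
    (fun S w => h.empRisk_minimizer hμ hn S w)
  · exact (Finset.measurable_sum _ fun i _ =>
      (h.measurable w).comp (measurable_pi_apply i)).const_mul _
  · exact Differentiable.continuous (𝕜 := ℝ) fun w =>
      (hasFDerivAt_empRisk h.differentiable S w).differentiableAt

/-- The first order errors at the minimizer of the empirical risk average to the optimality gap. -/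
theorem average_breg (h : LossAssumptions P f μ L) (hμ : 0 < μ) (hn : 0 < n)
    (S : Fin n → Z) (w : EuclideanSpace ℝ (Fin d)) :
    (1 / (n : ℝ)) * ∑ i, breg (fun w => f w (S i)) w (argMin (empRisk f S)) =
      empRisk f S w - empRisk f S (argMin (empRisk f S)) := by
  -- The linear terms of the Bregman errors sum to the gradient of the empirical risk, which
  -- vanishes at its minimizer.
  have h0 : fderiv ℝ (empRisk f S) (argMin (empRisk f S)) = 0 :=
    IsLocalMin.fderiv_eq_zero (Filter.Eventually.of_forall fun y =>
      (le_add_of_nonneg_right (by positivity)).trans (h.empRisk_minimizer hμ hn S y))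
  rw [fderiv_empRisk h.differentiable] at h0
  have h1 := congrArg (fun l => l (w - argMin (empRisk f S))) h0
  simp only [smul_apply, sum_apply, smul_eq_mul, zero_apply] at h1
  simp only [breg, Finset.sum_sub_distrib, mul_sub, h1, empRisk]
  ring

end LossAssumptions

section Measurability

theorem measurable_fderiv_apply (hm : ∀ w, Measurable (f w))
    (h : ∀ z, Differentiable ℝ fun w => f w z) (w v : EuclideanSpace ℝ (Fin d)) :
    Measurable fun z => fderiv ℝ (fun w => f w z) w v := by
  refine measurable_of_tendsto_metrizable (f := fun (k : ℕ) z =>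
    ((k : ℝ) + 1) • (f (w + ((k : ℝ) + 1)⁻¹ • v) z - f w z)) (fun k => ?_) ?_
  · exact ((hm _).sub (hm _)).const_smul ((k : ℝ) + 1)
  · exact tendsto_pi_nhds.2 fun z => tendsto_slope_seq (h z w) v

theorem measurable_D2_apply (hm : ∀ w, Measurable (f w))
    (h : ∀ z, Differentiable ℝ fun w => f w z)
    (h' : ∀ z, Differentiable ℝ (fderiv ℝ fun w => f w z)) (w u v : EuclideanSpace ℝ (Fin d)) :
    Measurable fun z => D2 (fun w => f w z) w u v := by
  refine measurable_of_tendsto_metrizable (f := fun (k : ℕ) z =>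
    ((k : ℝ) + 1) • (fderiv ℝ (fun w => f w z) (w + ((k : ℝ) + 1)⁻¹ • u) v
      - fderiv ℝ (fun w => f w z) w v)) (fun k => ?_) ?_
  · exact ((measurable_fderiv_apply hm h _ _).sub (measurable_fderiv_apply hm h _ _)).const_smul ((k : ℝ) + 1)
  · refine tendsto_pi_nhds.2 fun z => ?_
    have := ((ContinuousLinearMap.apply ℝ ℝ v).continuous.tendsto _).comp
      (tendsto_slope_seq (h' z w) u)
    simpa [Function.comp_def] using this

namespace LossAssumptions

theorem measurable_hess_apply (h : LossAssumptions P f μ L) (w : EuclideanSpace ℝ (Fin d))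
    (i j : Fin d) : Measurable fun z => hess (fun w => f w z) w i j := by
  simp only [hess_apply]
  exact measurable_D2_apply h.measurable h.differentiable h.differentiable_fderiv _ _ _

/-- A Carathéodory function, continuous in the point and measurable in the sample. Joint
measurability allows evaluation at sample-dependent points. -/
theorem measurable_uncurry_hess_apply (h : LossAssumptions P f μ L) (i j : Fin d) :
    Measurable fun p : EuclideanSpace ℝ (Fin d) × Z => hess (fun w => f w p.2) p.1 i j := by
  refine measurable_uncurry_of_continuous_of_measurable
    (u := fun w z => hess (fun w => f w z) w i j) (fun z => ?_)
    (fun w => h.measurable_hess_apply w i j)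
  have := (contDiff_differentiable (h.contDiff z)).2.2.continuous
  simp only [hess_apply]
  exact (this.clm_apply continuous_const).clm_apply continuous_const

theorem measurable_uncurry (h : LossAssumptions P f μ L) :
    Measurable fun p : EuclideanSpace ℝ (Fin d) × Z => f p.1 p.2 :=
  measurable_uncurry_of_continuous_of_measurable (fun z => (h.differentiable z).continuous)
    h.measurable

end LossAssumptions

end Measurability

end Loss

/-! ### Frobenius norm and quadratic forms of symmetric matrices -/

section Matrices

open Matrix

variable {d : ℕ} {M A B : Matrix (Fin d) (Fin d) ℝ}

/-- The spectral theorem for real symmetric matrices, with the functional calculus. -/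
theorem exists_diagonalization (hM : Mᵀ = M) :
    ∃ (U : Matrix (Fin d) (Fin d) ℝ) (l : Fin d → ℝ), Uᵀ * U = 1 ∧ U * Uᵀ = 1 ∧
      M = U * diagonal l * Uᵀ ∧ ∀ g : ℝ → ℝ, cfc g M = U * diagonal (fun i => g (l i)) * Uᵀ := by
  have hH : M.IsHermitian := by
    rw [IsHermitian, conjTranspose_eq_transpose_of_trivial, hM]
  refine ⟨hH.eigenvectorUnitary, hH.eigenvalues, ?_, ?_, ?_, fun g => ?_⟩
  · have := Unitary.coe_star_mul_self hH.eigenvectorUnitary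
    rwa [star_eq_conjTranspose, conjTranspose_eq_transpose_of_trivial] at this
  · have := Unitary.coe_mul_star_self hH.eigenvectorUnitary
    rwa [Unitary.coe_star, star_eq_conjTranspose, conjTranspose_eq_transpose_of_trivial] at this
  · have := hH.spectral_theorem
    rw [Unitary.conjStarAlgAut_apply, star_eq_conjTranspose,
      conjTranspose_eq_transpose_of_trivial] at this
    exact this
  · rw [hH.cfc_eq, IsHermitian.cfc, Unitary.conjStarAlgAut_apply, star_eq_conjTranspose,
      conjTranspose_eq_transpose_of_trivial]
    rfl

/-- The entries of a matrix as a vector of a Euclidean space. -/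
def frobVec : Matrix (Fin d) (Fin d) ℝ →ₗ[ℝ] EuclideanSpace ℝ (Fin d × Fin d) where
  toFun M := WithLp.toLp 2 fun p => M p.1 p.2
  map_add' _ _ := rfl
  map_smul' _ _ := rfl

theorem frobVec_apply (M : Matrix (Fin d) (Fin d) ℝ) (p : Fin d × Fin d) :
    frobVec M p = M p.1 p.2 := rfl

theorem frobNorm_eq (M : Matrix (Fin d) (Fin d) ℝ) : frobNorm M = ‖frobVec M‖ := by
  rw [EuclideanSpace.norm_eq, frobNorm, Fintype.sum_prod_type]
  simp [frobVec_apply]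

theorem frobNorm_nonneg (M : Matrix (Fin d) (Fin d) ℝ) : 0 ≤ frobNorm M := Real.sqrt_nonneg _

theorem frobNorm_sq (M : Matrix (Fin d) (Fin d) ℝ) : frobNorm M ^ 2 = ∑ i, ∑ j, M i j ^ 2 :=
  Real.sq_sqrt (Finset.sum_nonneg fun _ _ => Finset.sum_nonneg fun _ _ => sq_nonneg _)

theorem frobNorm_sq_eq_trace (M : Matrix (Fin d) (Fin d) ℝ) :
    frobNorm M ^ 2 = trace (Mᵀ * M) := by
  rw [frobNorm_sq, trace, Finset.sum_comm]
  simp [Matrix.mul_apply, sq]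

theorem frobNorm_add_le (M A : Matrix (Fin d) (Fin d) ℝ) :
    frobNorm (M + A) ≤ frobNorm M + frobNorm A := by
  simp only [frobNorm_eq, map_add]; exact norm_add_le _ _

theorem frobNorm_smul (c : ℝ) (M : Matrix (Fin d) (Fin d) ℝ) :
    frobNorm (c • M) = |c| * frobNorm M := by
  simp only [frobNorm_eq, map_smul, norm_smul, Real.norm_eq_abs]

theorem frobNorm_neg (M : Matrix (Fin d) (Fin d) ℝ) : frobNorm (-M) = frobNorm M := by
  simp only [frobNorm_eq, map_neg, norm_neg]

theorem frobNorm_sum_le {ι : Type*} (s : Finset ι) (M : ι → Matrix (Fin d) (Fin d) ℝ) :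
    frobNorm (∑ i ∈ s, M i) ≤ ∑ i ∈ s, frobNorm (M i) := by
  simp only [frobNorm_eq, map_sum]; exact norm_sum_le _ _

theorem frobNorm_transpose (M : Matrix (Fin d) (Fin d) ℝ) : frobNorm Mᵀ = frobNorm M := by
  rw [frobNorm, frobNorm, Finset.sum_comm]; rfl

theorem frobNorm_one : frobNorm (1 : Matrix (Fin d) (Fin d) ℝ) = √d := by
  rw [← Real.sqrt_sq (frobNorm_nonneg _), frobNorm_sq_eq_trace]
  simp

/-- The squared Frobenius norm is the sum of the squared lengths of the columns, and A acts on each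
column separately. -/
theorem frobNorm_mul_le {q : ℝ} (hq : 0 ≤ q)
    (hA : ∀ v : Fin d → ℝ, (A *ᵥ v) ⬝ᵥ (A *ᵥ v) ≤ q ^ 2 * (v ⬝ᵥ v))
    (M : Matrix (Fin d) (Fin d) ℝ) : frobNorm (A * M) ≤ q * frobNorm M := by
  rw [← abs_of_nonneg (frobNorm_nonneg (A * M)), ← abs_of_nonneg
    (mul_nonneg hq (frobNorm_nonneg M)), ← sq_le_sq, mul_pow, frobNorm_sq, frobNorm_sq,
    Finset.sum_comm, Finset.sum_comm (f := fun i j => M i j ^ 2), Finset.mul_sum]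
  refine Finset.sum_le_sum fun j _ => ?_
  have := hA fun i => M i j
  simpa [dotProduct, mulVec, Matrix.mul_apply, sq] using this

theorem frobNorm_mul_le' {q : ℝ} (hq : 0 ≤ q) (hAs : Aᵀ = A)
    (hA : ∀ v : Fin d → ℝ, (A *ᵥ v) ⬝ᵥ (A *ᵥ v) ≤ q ^ 2 * (v ⬝ᵥ v))
    (M : Matrix (Fin d) (Fin d) ℝ) : frobNorm (M * A) ≤ q * frobNorm M := by
  rw [← frobNorm_transpose, transpose_mul, hAs, ← frobNorm_transpose M]
  exact frobNorm_mul_le hq hA _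

theorem frobNorm_conj {U : Matrix (Fin d) (Fin d) ℝ} (hU : U * Uᵀ = 1)
    (M : Matrix (Fin d) (Fin d) ℝ) : frobNorm (Uᵀ * M * U) = frobNorm M := by
  rw [← Real.sqrt_sq (frobNorm_nonneg _), ← Real.sqrt_sq (frobNorm_nonneg M),
    frobNorm_sq_eq_trace, frobNorm_sq_eq_trace]
  congr 1
  have : (Uᵀ * M * U)ᵀ * (Uᵀ * M * U) = Uᵀ * (Mᵀ * M * U) := by
    simp only [transpose_mul, transpose_transpose]
    calc Uᵀ * (Mᵀ * U) * (Uᵀ * M * U) = Uᵀ * Mᵀ * (U * Uᵀ) * M * U := by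
          simp only [Matrix.mul_assoc]
      _ = _ := by rw [hU]; simp only [Matrix.mul_one, Matrix.mul_assoc]
  rw [this, trace_mul_comm, Matrix.mul_assoc, hU, Matrix.mul_one]

theorem quad_conj (Q M : Matrix (Fin d) (Fin d) ℝ) (v : Fin d → ℝ) :
    v ⬝ᵥ ((Qᵀ * M * Q) *ᵥ v) = (Q *ᵥ v) ⬝ᵥ (M *ᵥ (Q *ᵥ v)) := by
  rw [← mulVec_mulVec, ← mulVec_mulVec, dotProduct_mulVec, vecMul_transpose]

theorem quad_single (M : Matrix (Fin d) (Fin d) ℝ) (i : Fin d) :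
    Pi.single i 1 ⬝ᵥ (M *ᵥ Pi.single i 1) = M i i := by
  simp

/-- The Frobenius norm is monotone for two-sided bounds in the Loewner order. -/
theorem frobNorm_le_of_abs_quad_le (hM : Mᵀ = M)
    (h : ∀ v : Fin d → ℝ, |v ⬝ᵥ (M *ᵥ v)| ≤ v ⬝ᵥ (A *ᵥ v)) : frobNorm M ≤ frobNorm A := by
  obtain ⟨U, l, hU1, hU2, hl, -⟩ := exists_diagonalization hM
  rw [← frobNorm_conj hU2 M, ← frobNorm_conj hU2 A]
  have hD : Uᵀ * M * U = diagonal l := by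
    rw [hl]
    calc Uᵀ * (U * diagonal l * Uᵀ) * U = (Uᵀ * U) * diagonal l * (Uᵀ * U) := by
          simp only [Matrix.mul_assoc]
      _ = _ := by rw [hU1]; simp
  -- In an eigenbasis of M only the diagonal of M survives, and it is dominated by the diagonal of
  -- A. The off-diagonal entries of A only help, so no symmetry of A is needed.
  refine Real.sqrt_le_sqrt (Finset.sum_le_sum fun i _ => ?_)
  have h1 : ∑ j, (Uᵀ * M * U) i j ^ 2 = (Uᵀ * M * U) i i ^ 2 := by
    rw [hD, Finset.sum_eq_single i (fun j _ hj => by simp [diagonal_apply_ne' _ hj]) (by simp)]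
  rw [h1]
  refine le_trans ?_ (Finset.single_le_sum (f := fun j => (Uᵀ * A * U) i j ^ 2)
    (fun j _ => sq_nonneg _) (Finset.mem_univ i))
  have := h (U *ᵥ Pi.single i 1)
  rw [← quad_conj, ← quad_conj, quad_single, quad_single] at this
  exact sq_le_sq' (by linarith [neg_abs_le ((Uᵀ * M * U) i i)]) ((le_abs_self _).trans this)

theorem dotProduct_self_nonneg (v : Fin d → ℝ) : 0 ≤ v ⬝ᵥ v :=
  Finset.sum_nonneg fun i _ => mul_self_nonneg (v i)

/-- A symmetric matrix with quadratic form bounded by `L` has spectral norm at most `L`. -/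
theorem sq_mulVec_le_of_abs_quad_le {L : ℝ} (hM : Mᵀ = M)
    (h : ∀ v : Fin d → ℝ, |v ⬝ᵥ (M *ᵥ v)| ≤ L * (v ⬝ᵥ v)) (v : Fin d → ℝ) :
    (M *ᵥ v) ⬝ᵥ (M *ᵥ v) ≤ L ^ 2 * (v ⬝ᵥ v) := by
  obtain ⟨U, l, hU1, hU2, hl, -⟩ := exists_diagonalization hM
  have hD : Uᵀ * M * U = diagonal l := by
    rw [hl]
    calc Uᵀ * (U * diagonal l * Uᵀ) * U = (Uᵀ * U) * diagonal l * (Uᵀ * U) := by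
          simp only [Matrix.mul_assoc]
      _ = _ := by rw [hU1]; simp
  have hli : ∀ i, l i ^ 2 ≤ L ^ 2 := by
    intro i
    have := h (U *ᵥ Pi.single i 1)
    rw [← quad_conj, quad_single, hD, diagonal_apply_eq, dotProduct_mulVec,
      ← Matrix.mulVec_transpose, mulVec_mulVec, hU1, one_mulVec] at this
    simp only [single_one_dotProduct, Pi.single_eq_same, mul_one] at this
    exact sq_le_sq' (by linarith [neg_abs_le (l i)]) ((le_abs_self _).trans this)
  have e1 : (M *ᵥ v) ⬝ᵥ (M *ᵥ v) = ∑ i, l i ^ 2 * (Uᵀ *ᵥ v) i ^ 2 := by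
    have : M *ᵥ v = U *ᵥ (diagonal l *ᵥ (Uᵀ *ᵥ v)) := by
      rw [mulVec_mulVec, mulVec_mulVec, ← hl]
    rw [this, dotProduct_mulVec, ← Matrix.mulVec_transpose, mulVec_mulVec, hU1, one_mulVec]
    simp only [dotProduct, mulVec_diagonal]
    exact Finset.sum_congr rfl fun i _ => by ring
  have e2 : v ⬝ᵥ v = ∑ i, (Uᵀ *ᵥ v) i ^ 2 := by
    have : v = U *ᵥ (Uᵀ *ᵥ v) := by rw [mulVec_mulVec, hU2, one_mulVec]
    conv_lhs => rw [this]
    rw [dotProduct_mulVec, ← Matrix.mulVec_transpose, mulVec_mulVec, hU1, one_mulVec]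
    simp only [dotProduct, sq]
  rw [e1, e2, Finset.mul_sum]
  exact Finset.sum_le_sum fun i _ => mul_le_mul_of_nonneg_right (hli i) (sq_nonneg _)

end Matrices

/-! ### The Frobenius norm relative to a positive definite matrix -/

section RelativeNorm

open Matrix

variable {d : ℕ} {M A B : Matrix (Fin d) (Fin d) ℝ} {μ : ℝ}

theorem invSqrt_transpose (hB : Bᵀ = B) : (invSqrt B)ᵀ = invSqrt B := by
  obtain ⟨U, l, -, -, -, h⟩ := exists_diagonalization hB
  rw [invSqrt, h]
  simp [Matrix.mul_assoc]

theorem eigenvalue_pos (hμ : 0 < μ) (hpd : ∀ v : Fin d → ℝ, μ * (v ⬝ᵥ v) ≤ v ⬝ᵥ (B *ᵥ v))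
    {U : Matrix (Fin d) (Fin d) ℝ} {l : Fin d → ℝ} (hU : Uᵀ * U = 1)
    (hl : B = U * diagonal l * Uᵀ) (i : Fin d) : 0 < l i := by
  have hD : Uᵀ * B * U = diagonal l := by
    rw [hl]
    calc Uᵀ * (U * diagonal l * Uᵀ) * U = (Uᵀ * U) * diagonal l * (Uᵀ * U) := by
          simp only [Matrix.mul_assoc]
      _ = _ := by rw [hU]; simp
  have := hpd (U *ᵥ Pi.single i 1)
  rw [← quad_conj, quad_single, hD, diagonal_apply_eq, dotProduct_mulVec,
    ← Matrix.mulVec_transpose, mulVec_mulVec, hU, one_mulVec] at this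
  simp only [single_one_dotProduct, Pi.single_eq_same, mul_one] at this
  linarith

theorem invSqrt_mul_mul (hμ : 0 < μ) (hB : Bᵀ = B)
    (hpd : ∀ v : Fin d → ℝ, μ * (v ⬝ᵥ v) ≤ v ⬝ᵥ (B *ᵥ v)) :
    invSqrt B * B * invSqrt B = 1 := by
  obtain ⟨U, l, hU1, hU2, hl, h⟩ := exists_diagonalization hB
  have hpos := eigenvalue_pos hμ hpd hU1 hl
  rw [invSqrt, h]
  conv_lhs => rw [hl]
  have e : ∀ i, (√(l i))⁻¹ * l i * (√(l i))⁻¹ = 1 := fun i => by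
    have h0 := Real.sqrt_pos.2 (hpos i)
    field_simp
    exact (Real.sq_sqrt (hpos i).le).symm
  calc U * diagonal (fun i => (√(l i))⁻¹) * Uᵀ * (U * diagonal l * Uᵀ) *
        (U * diagonal (fun i => (√(l i))⁻¹) * Uᵀ)
      = U * diagonal (fun i => (√(l i))⁻¹) * (Uᵀ * U) * diagonal l * (Uᵀ * U) *
        diagonal (fun i => (√(l i))⁻¹) * Uᵀ := by simp only [Matrix.mul_assoc]
    _ = U * (diagonal (fun i => (√(l i))⁻¹) * diagonal l * diagonal (fun i => (√(l i))⁻¹))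
        * Uᵀ := by rw [hU1]; simp only [Matrix.mul_one, Matrix.mul_assoc]
    _ = 1 := by
        rw [diagonal_mul_diagonal, diagonal_mul_diagonal]
        simp only [e]
        rw [diagonal_one, Matrix.mul_one, hU2]

theorem invSqrt_mul_self (hμ : 0 < μ) (hB : Bᵀ = B)
    (hpd : ∀ v : Fin d → ℝ, μ * (v ⬝ᵥ v) ≤ v ⬝ᵥ (B *ᵥ v)) :
    invSqrt B * invSqrt B = B⁻¹ := by
  have h := invSqrt_mul_mul hμ hB hpd
  rw [Matrix.mul_assoc, mul_eq_one_comm, Matrix.mul_assoc] at h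
  exact (inv_eq_right_inv h).symm

/-- Substitute B^(-1/2) v into the lower bound for the quadratic form of B, which then collapses to
the Euclidean square of v. -/
theorem sq_invSqrt_mulVec_le (hμ : 0 < μ) (hB : Bᵀ = B)
    (hpd : ∀ v : Fin d → ℝ, μ * (v ⬝ᵥ v) ≤ v ⬝ᵥ (B *ᵥ v)) (v : Fin d → ℝ) :
    (invSqrt B *ᵥ v) ⬝ᵥ (invSqrt B *ᵥ v) ≤ ((√μ)⁻¹) ^ 2 * (v ⬝ᵥ v) := by
  have h1 := hpd (invSqrt B *ᵥ v)
  rw [← quad_conj, invSqrt_transpose hB, invSqrt_mul_mul hμ hB hpd, one_mulVec] at h1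
  rw [inv_pow, Real.sq_sqrt hμ.le, ← div_eq_inv_mul, le_div_iff₀ hμ]
  linarith

/-- The Frobenius norm of `M` relative to the positive definite matrix `B`. -/
def relNorm (B M : Matrix (Fin d) (Fin d) ℝ) : ℝ := frobNorm (invSqrt B * M * invSqrt B)

theorem relFrobError_eq (A B : Matrix (Fin d) (Fin d) ℝ) :
    relFrobError A B = relNorm B (A - B) := rfl

theorem relNorm_nonneg (B M : Matrix (Fin d) (Fin d) ℝ) : 0 ≤ relNorm B M := frobNorm_nonneg _

theorem relNorm_add_le (B M A : Matrix (Fin d) (Fin d) ℝ) :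
    relNorm B (M + A) ≤ relNorm B M + relNorm B A := by
  simp only [relNorm, Matrix.mul_add, Matrix.add_mul]; exact frobNorm_add_le _ _

theorem relNorm_smul (B : Matrix (Fin d) (Fin d) ℝ) (c : ℝ) (M : Matrix (Fin d) (Fin d) ℝ) :
    relNorm B (c • M) = |c| * relNorm B M := by
  simp only [relNorm, Matrix.mul_smul, Matrix.smul_mul, frobNorm_smul]

theorem relNorm_neg (B M : Matrix (Fin d) (Fin d) ℝ) : relNorm B (-M) = relNorm B M := by
  simp only [relNorm, Matrix.mul_neg, Matrix.neg_mul, frobNorm_neg]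

theorem relNorm_le (hμ : 0 < μ) (hB : Bᵀ = B)
    (hpd : ∀ v : Fin d → ℝ, μ * (v ⬝ᵥ v) ≤ v ⬝ᵥ (B *ᵥ v)) (M : Matrix (Fin d) (Fin d) ℝ) :
    relNorm B M ≤ frobNorm M / μ := by
  have hq : 0 ≤ (√μ)⁻¹ := by positivity
  have h1 := frobNorm_mul_le' hq (invSqrt_transpose hB) (sq_invSqrt_mulVec_le hμ hB hpd)
    (invSqrt B * M)
  have h2 := frobNorm_mul_le hq (sq_invSqrt_mulVec_le hμ hB hpd) M
  have h3 := mul_le_mul_of_nonneg_left h2 hq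
  refine (h1.trans h3).trans_eq ?_
  have : μ = √μ * √μ := (Real.mul_self_sqrt hμ.le).symm
  conv_rhs => rw [this]
  have := Real.sqrt_pos.2 hμ
  field_simp

theorem relNorm_self (hμ : 0 < μ) (hB : Bᵀ = B)
    (hpd : ∀ v : Fin d → ℝ, μ * (v ⬝ᵥ v) ≤ v ⬝ᵥ (B *ᵥ v)) : relNorm B B = √d := by
  rw [relNorm, invSqrt_mul_mul hμ hB hpd, frobNorm_one]

/-- Congruence by B^(-1/2) preserves inequalities between quadratic forms. This converts the
Loewner-type Hessian comparisons into norm bounds. -/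
theorem relNorm_mono (hB : Bᵀ = B) (hM : Mᵀ = M)
    (h : ∀ v : Fin d → ℝ, |v ⬝ᵥ (M *ᵥ v)| ≤ v ⬝ᵥ (A *ᵥ v)) : relNorm B M ≤ relNorm B A := by
  have hQ := invSqrt_transpose hB
  refine frobNorm_le_of_abs_quad_le ?_ fun v => ?_
  · simp only [transpose_mul, hQ, hM, Matrix.mul_assoc]
  · have := h (invSqrt B *ᵥ v)
    rwa [← quad_conj, ← quad_conj, hQ] at this

/-- Cyclicity of the trace merges the square roots into B⁻¹, whose entries are rational in those of
B; the measurability of the relative error rests on this form. -/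
theorem relNorm_eq_sqrt_trace (hμ : 0 < μ) (hB : Bᵀ = B)
    (hpd : ∀ v : Fin d → ℝ, μ * (v ⬝ᵥ v) ≤ v ⬝ᵥ (B *ᵥ v)) (hM : Mᵀ = M) :
    relNorm B M = √(trace (B⁻¹ * M * B⁻¹ * M)) := by
  have hQ := invSqrt_transpose hB
  rw [relNorm, ← Real.sqrt_sq (frobNorm_nonneg _), frobNorm_sq_eq_trace,
    ← invSqrt_mul_self hμ hB hpd]
  congr 1
  simp only [transpose_mul, hQ, hM]
  calc trace (invSqrt B * (M * invSqrt B) * (invSqrt B * M * invSqrt B))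
      = trace ((invSqrt B * M * invSqrt B * invSqrt B * M) * invSqrt B) := by
        simp only [Matrix.mul_assoc]
    _ = trace (invSqrt B * (invSqrt B * M * invSqrt B * invSqrt B * M)) := trace_mul_comm _ _
    _ = _ := by simp only [Matrix.mul_assoc]

end RelativeNorm

/-! ### Spectral norm and trace inequalities for even powers -/

section SpectralNorm

open Matrix

variable {d : ℕ} {M A B : Matrix (Fin d) (Fin d) ℝ}

theorem specNorm_nonneg (M : Matrix (Fin d) (Fin d) ℝ) : 0 ≤ specNorm M := norm_nonneg _

theorem sq_mulVec_le_specNorm (M : Matrix (Fin d) (Fin d) ℝ) (v : Fin d → ℝ) :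
    (M *ᵥ v) ⬝ᵥ (M *ᵥ v) ≤ specNorm M ^ 2 * (v ⬝ᵥ v) := by
  have h := (toEuclideanCLM (n := Fin d) (𝕜 := ℝ) M).le_opNorm (WithLp.toLp 2 v)
  have h2 := pow_le_pow_left₀ (norm_nonneg _) h 2
  rw [toEuclideanCLM_toLp, mul_pow, EuclideanSpace.real_norm_sq_eq,
    EuclideanSpace.real_norm_sq_eq] at h2
  simpa [dotProduct, sq, specNorm] using h2

theorem specNorm_le {q : ℝ} (hq : 0 ≤ q)
    (h : ∀ v : Fin d → ℝ, (M *ᵥ v) ⬝ᵥ (M *ᵥ v) ≤ q ^ 2 * (v ⬝ᵥ v)) : specNorm M ≤ q := by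
  refine ContinuousLinearMap.opNorm_le_bound _ hq fun x => ?_
  rw [← abs_of_nonneg (norm_nonneg _), ← abs_of_nonneg (mul_nonneg hq (norm_nonneg x)),
    ← sq_le_sq, mul_pow, EuclideanSpace.real_norm_sq_eq, EuclideanSpace.real_norm_sq_eq]
  simpa [dotProduct, sq] using h x.ofLp

theorem frobNorm_le_sqrt_mul_specNorm (M : Matrix (Fin d) (Fin d) ℝ) :
    frobNorm M ≤ √d * specNorm M := by
  have := frobNorm_mul_le (specNorm_nonneg M) (sq_mulVec_le_specNorm M) 1
  rw [Matrix.mul_one, frobNorm_one] at this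
  linarith

theorem specNorm_le_frobNorm (M : Matrix (Fin d) (Fin d) ℝ) : specNorm M ≤ frobNorm M := by
  refine specNorm_le (frobNorm_nonneg M) fun v => ?_
  rw [frobNorm_sq, Finset.sum_mul]
  refine Finset.sum_le_sum fun i _ => ?_
  have := Finset.sum_mul_sq_le_sq_mul_sq Finset.univ (fun j => M i j) v
  simpa [dotProduct, mulVec, sq] using this

theorem continuous_specNorm : Continuous (specNorm (d := d)) := by
  have : Continuous (toEuclideanCLM (n := Fin d) (𝕜 := ℝ)).toAlgEquiv.toLinearMap :=
    LinearMap.continuous_of_finiteDimensional _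
  exact this.norm

theorem pow_diag {U : Matrix (Fin d) (Fin d) ℝ} {l : Fin d → ℝ} (hU1 : Uᵀ * U = 1)
    (hU2 : U * Uᵀ = 1) (hl : M = U * diagonal l * Uᵀ) (k : ℕ) :
    M ^ k = U * diagonal (fun i => l i ^ k) * Uᵀ := by
  induction k with
  | zero => simp [hU2]
  | succ k ih =>
    rw [pow_succ, ih]
    conv_lhs => rw [hl]
    calc U * diagonal (fun i => l i ^ k) * Uᵀ * (U * diagonal l * Uᵀ)
        = U * diagonal (fun i => l i ^ k) * (Uᵀ * U) * diagonal l * Uᵀ := by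
          simp only [Matrix.mul_assoc]
      _ = U * (diagonal (fun i => l i ^ k) * diagonal l) * Uᵀ := by
          rw [hU1]; simp only [Matrix.mul_one, Matrix.mul_assoc]
      _ = _ := by rw [diagonal_mul_diagonal]; simp only [pow_succ]

theorem trace_pow_eq {U : Matrix (Fin d) (Fin d) ℝ} {l : Fin d → ℝ} (hU1 : Uᵀ * U = 1)
    (hU2 : U * Uᵀ = 1) (hl : M = U * diagonal l * Uᵀ) (k : ℕ) :
    trace (M ^ k) = ∑ i, l i ^ k := by
  rw [pow_diag hU1 hU2 hl, trace_mul_comm, ← Matrix.mul_assoc, hU1, Matrix.one_mul,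
    trace_diagonal]

theorem trace_even_pow_nonneg (hM : Mᵀ = M) (p : ℕ) : 0 ≤ trace (M ^ (2 * p)) := by
  obtain ⟨U, l, hU1, hU2, hl, -⟩ := exists_diagonalization hM
  rw [trace_pow_eq hU1 hU2 hl]
  exact Finset.sum_nonneg fun i _ => by rw [pow_mul]; positivity

/-- The spectral norm through traces of even powers. -/
theorem specNorm_le_of_trace (hM : Mᵀ = M) {τ : ℝ} (hτ : 0 < τ) {p : ℕ} (hp : 0 < p) :
    specNorm M ≤ τ + τ * (trace (M ^ (2 * p)) / τ ^ (2 * p)) := by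
  obtain ⟨U, l, hU1, hU2, hl, -⟩ := exists_diagonalization hM
  rw [trace_pow_eq hU1 hU2 hl]
  have hbound : ∀ i, |l i| ≤ τ + τ * ((∑ i, l i ^ (2 * p)) / τ ^ (2 * p)) := by
    intro i
    have h1 : l i ^ (2 * p) ≤ ∑ i, l i ^ (2 * p) :=
      Finset.single_le_sum (f := fun i => l i ^ (2 * p))
        (fun j _ => by rw [pow_mul]; positivity) (Finset.mem_univ i)
    -- From t ≤ 1 + t^(2p) with t = |l i| / τ. The resulting bound is linear in the trace, so it can
    -- be integrated without taking a 2p-th root.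
    have h2 : |l i| / τ ≤ 1 + (|l i| / τ) ^ (2 * p) := by
      rcases le_total (|l i| / τ) 1 with h | h
      · exact h.trans (le_add_of_nonneg_right (by positivity))
      · have := le_self_pow₀ h (n := 2 * p) (by omega)
        linarith
    rw [div_pow, pow_mul |l i|, sq_abs, ← pow_mul, div_le_iff₀ hτ] at h2
    have h3 : l i ^ (2 * p) / τ ^ (2 * p) ≤ (∑ i, l i ^ (2 * p)) / τ ^ (2 * p) := by gcongr
    nlinarith
  set q := τ + τ * ((∑ i, l i ^ (2 * p)) / τ ^ (2 * p))
  have hq : 0 ≤ q := by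
    have : 0 ≤ ∑ i, l i ^ (2 * p) := Finset.sum_nonneg fun i _ => by rw [pow_mul]; positivity
    positivity
  refine specNorm_le hq (sq_mulVec_le_of_abs_quad_le hM fun v => ?_)
  have e1 : v ⬝ᵥ (M *ᵥ v) = ∑ i, l i * (Uᵀ *ᵥ v) i ^ 2 := by
    have := quad_conj Uᵀ (diagonal l) v
    rw [transpose_transpose, ← hl] at this
    rw [this]
    simp only [dotProduct, mulVec_diagonal]
    exact Finset.sum_congr rfl fun i _ => by ring
  have e2 : v ⬝ᵥ v = ∑ i, (Uᵀ *ᵥ v) i ^ 2 := by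
    have := quad_conj Uᵀ 1 v
    rw [transpose_transpose, Matrix.mul_one, hU2, one_mulVec, one_mulVec] at this
    rw [this]
    simp only [dotProduct, sq]
  rw [e1, e2, Finset.mul_sum]
  refine (Finset.abs_sum_le_sum_abs _ _).trans (Finset.sum_le_sum fun i _ => ?_)
  rw [abs_mul, abs_of_nonneg (sq_nonneg ((Uᵀ *ᵥ v) i))]
  exact mul_le_mul_of_nonneg_right (hbound i) (sq_nonneg _)

/-- Factor the difference of powers as (a - b) Σ a^q b^(2p-q) and pair q with 2p - q. Each pair is
at most a^(2p) + b^(2p), because |a|^q - |b|^q and |a|^(2p-q) - |b|^(2p-q) have the same sign.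
Pairing is what yields the factor 1/2. -/
theorem sub_mul_pow_sub_le (a b : ℝ) (p : ℕ) :
    (a - b) * (a ^ (2 * p + 1) - b ^ (2 * p + 1)) ≤
      (2 * p + 1) / 2 * ((a - b) ^ 2 * (a ^ (2 * p) + b ^ (2 * p))) := by
  have hsum := geom_sum₂_mul a b (2 * p + 1)
  have hrefl := Finset.sum_range_reflect (fun q => a ^ q * b ^ (2 * p - q)) (2 * p + 1)
  simp only [add_tsub_cancel_right] at hsum hrefl
  have hpair : 2 * ∑ q ∈ Finset.range (2 * p + 1), a ^ q * b ^ (2 * p - q) ≤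
      (2 * p + 1) * (a ^ (2 * p) + b ^ (2 * p)) := by
    have : 2 * ∑ q ∈ Finset.range (2 * p + 1), a ^ q * b ^ (2 * p - q) =
        ∑ q ∈ Finset.range (2 * p + 1), (a ^ q * b ^ (2 * p - q)
          + a ^ (2 * p - q) * b ^ (2 * p - (2 * p - q))) := by
      rw [Finset.sum_add_distrib, hrefl]; ring
    rw [this]
    refine (Finset.sum_le_card_nsmul _ _ (a ^ (2 * p) + b ^ (2 * p)) fun q hq => ?_).trans_eq ?_
    · have hq' : q ≤ 2 * p := by simpa [Nat.lt_succ_iff] using hq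
      obtain ⟨r, hr⟩ := Nat.exists_eq_add_of_le hq'
      have e : 2 * p - q = r := by omega
      rw [e, show 2 * p - r = q by omega]
      have ha : a ^ (2 * p) = |a| ^ q * |a| ^ r := by
        rw [← pow_add, ← hr, pow_mul, pow_mul, sq_abs]
      have hb : b ^ (2 * p) = |b| ^ q * |b| ^ r := by
        rw [← pow_add, ← hr, pow_mul, pow_mul, sq_abs]
      have h1 : a ^ q * b ^ r ≤ |a| ^ q * |b| ^ r := by
        rw [← abs_pow, ← abs_pow, ← abs_mul]; exact le_abs_self _
      have h2 : a ^ r * b ^ q ≤ |a| ^ r * |b| ^ q := by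
        rw [← abs_pow, ← abs_pow, ← abs_mul]; exact le_abs_self _
      have h3 : 0 ≤ (|a| ^ q - |b| ^ q) * (|a| ^ r - |b| ^ r) := by
        rcases le_total |a| |b| with h | h
        · exact mul_nonneg_of_nonpos_of_nonpos
            (sub_nonpos.2 (pow_le_pow_left₀ (abs_nonneg _) h _))
            (sub_nonpos.2 (pow_le_pow_left₀ (abs_nonneg _) h _))
        · exact mul_nonneg (sub_nonneg.2 (pow_le_pow_left₀ (abs_nonneg _) h _))
            (sub_nonneg.2 (pow_le_pow_left₀ (abs_nonneg _) h _))
      rw [ha, hb]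
      linarith
    · simp; ring
  rw [← hsum]
  nlinarith [mul_le_mul_of_nonneg_right hpair (sq_nonneg (a - b))]

/-- The weights are the squared overlaps of the two eigenbases, hence nonnegative and independent of
the exponents. Scalar inequalities in pairs of eigenvalues thereby pass to traces of matrices that
need not commute. -/
theorem trace_pow_mul_pow {W Y U V : Matrix (Fin d) (Fin d) ℝ} {w y : Fin d → ℝ}
    (hU1 : Uᵀ * U = 1) (hU2 : U * Uᵀ = 1) (hV1 : Vᵀ * V = 1) (hV2 : V * Vᵀ = 1)
    (hW : W = U * diagonal w * Uᵀ) (hY : Y = V * diagonal y * Vᵀ) (a b : ℕ) :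
    trace (W ^ a * Y ^ b) = ∑ j, ∑ k, w j ^ a * y k ^ b * (Uᵀ * V) j k ^ 2 := by
  rw [pow_diag hU1 hU2 hW, pow_diag hV1 hV2 hY]
  have : trace (U * diagonal (fun i => w i ^ a) * Uᵀ * (V * diagonal (fun i => y i ^ b) * Vᵀ))
      = trace ((diagonal (fun i => w i ^ a) * (Uᵀ * V)) *
        (diagonal (fun i => y i ^ b) * (Uᵀ * V)ᵀ)) := by
    rw [transpose_mul, transpose_transpose]
    calc _ = trace (U * (diagonal (fun i => w i ^ a) * Uᵀ *
          (V * diagonal (fun i => y i ^ b) * Vᵀ))) := by simp only [Matrix.mul_assoc]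
      _ = _ := by rw [trace_mul_comm]; simp only [Matrix.mul_assoc]
  rw [this, trace]
  refine Finset.sum_congr rfl fun j _ => ?_
  rw [diag_apply, Matrix.mul_apply]
  refine Finset.sum_congr rfl fun k _ => ?_
  rw [diagonal_mul, diagonal_mul, transpose_apply]
  ring

/-- The trace inequality behind the matrix moment recursion. -/
theorem trace_sub_mul_pow_sub_le {W Y : Matrix (Fin d) (Fin d) ℝ} (hW : Wᵀ = W) (hY : Yᵀ = Y)
    {L : ℝ} (hL : 0 ≤ L)
    (h : ∀ v : Fin d → ℝ, |v ⬝ᵥ ((W - Y) *ᵥ v)| ≤ L * (v ⬝ᵥ v)) (p : ℕ) :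
    trace ((W - Y) * (W ^ (2 * p + 1) - Y ^ (2 * p + 1))) ≤
      (2 * p + 1) / 2 * L ^ 2 * (trace (W ^ (2 * p)) + trace (Y ^ (2 * p))) := by
  obtain ⟨U, w, hU1, hU2, hw, -⟩ := exists_diagonalization hW
  obtain ⟨V, y, hV1, hV2, hy, -⟩ := exists_diagonalization hY
  have T := trace_pow_mul_pow hU1 hU2 hV1 hV2 hw hy
  have hHs : (W - Y)ᵀ = W - Y := by rw [transpose_sub, hW, hY]
  -- The left side is the squared Frobenius norm of (W - Y) X^p, and W - Y stretches vectors by at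
  -- most L.
  have key : ∀ X : Matrix (Fin d) (Fin d) ℝ, Xᵀ = X →
      trace ((W - Y) * (W - Y) * X ^ (2 * p)) ≤ L ^ 2 * trace (X ^ (2 * p)) := by
    intro X hX
    have e : ∀ G : Matrix (Fin d) (Fin d) ℝ,
        frobNorm (G * X ^ p) ^ 2 = trace (Gᵀ * G * X ^ (2 * p)) := fun G => by
      rw [frobNorm_sq_eq_trace, transpose_mul, transpose_pow, hX, two_mul, pow_add,
        Matrix.mul_assoc, trace_mul_comm]
      simp only [Matrix.mul_assoc]
    have h1 := frobNorm_mul_le hL (sq_mulVec_le_of_abs_quad_le hHs h) (X ^ p)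
    have h2 := pow_le_pow_left₀ (frobNorm_nonneg _) h1 2
    rw [mul_pow, e, hHs] at h2
    have h3 := e 1
    rw [Matrix.one_mul, transpose_one, Matrix.one_mul, Matrix.one_mul] at h3
    rwa [h3] at h2
  have e1 : trace ((W - Y) * (W ^ (2 * p + 1) - Y ^ (2 * p + 1))) =
      ∑ j, ∑ k, (w j - y k) * (w j ^ (2 * p + 1) - y k ^ (2 * p + 1)) * (Uᵀ * V) j k ^ 2 := by
    have : trace ((W - Y) * (W ^ (2 * p + 1) - Y ^ (2 * p + 1))) =
        trace (W ^ (2 * p + 2) * Y ^ 0) - trace (W ^ 1 * Y ^ (2 * p + 1))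
          - trace (W ^ (2 * p + 1) * Y ^ 1) + trace (W ^ 0 * Y ^ (2 * p + 2)) := by
      rw [trace_mul_comm (W ^ (2 * p + 1)) (Y ^ 1)]
      simp only [Matrix.sub_mul, Matrix.mul_sub, trace_sub, pow_zero, Matrix.mul_one,
        Matrix.one_mul, pow_one]
      rw [show 2 * p + 2 = 2 * p + 1 + 1 by ring, pow_succ' W (2 * p + 1),
        pow_succ' Y (2 * p + 1)]
      ring
    rw [this, T, T, T, T, ← Finset.sum_sub_distrib, ← Finset.sum_sub_distrib,
      ← Finset.sum_add_distrib]
    refine Finset.sum_congr rfl fun j _ => ?_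
    rw [← Finset.sum_sub_distrib, ← Finset.sum_sub_distrib, ← Finset.sum_add_distrib]
    exact Finset.sum_congr rfl fun k _ => by ring
  have e2 : trace ((W - Y) * (W - Y) * W ^ (2 * p)) + trace ((W - Y) * (W - Y) * Y ^ (2 * p)) =
      ∑ j, ∑ k, (w j - y k) ^ 2 * (w j ^ (2 * p) + y k ^ (2 * p)) * (Uᵀ * V) j k ^ 2 := by
    have h1 : trace ((W - Y) * (W - Y) * W ^ (2 * p)) =
        trace (W ^ (2 * p + 2) * Y ^ 0) - trace (W ^ (2 * p + 1) * Y ^ 1)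
          - trace (W ^ (2 * p + 1) * Y ^ 1) + trace (W ^ (2 * p) * Y ^ 2) := by
      have t1 : trace (W * Y * W ^ (2 * p)) = trace (W ^ (2 * p + 1) * Y ^ 1) := by
        rw [trace_mul_comm, ← Matrix.mul_assoc, ← pow_succ, pow_one]
      have t2 : trace (Y * W * W ^ (2 * p)) = trace (W ^ (2 * p + 1) * Y ^ 1) := by
        rw [Matrix.mul_assoc, trace_mul_comm, ← pow_succ', pow_one]
      have t3 : trace (Y * Y * W ^ (2 * p)) = trace (W ^ (2 * p) * Y ^ 2) := by
        rw [trace_mul_comm, sq]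
      have t4 : trace (W * W * W ^ (2 * p)) = trace (W ^ (2 * p + 2) * Y ^ 0) := by
        rw [pow_zero, Matrix.mul_one, pow_add, sq, trace_mul_comm]
      simp only [Matrix.sub_mul, Matrix.mul_sub, trace_sub, t1, t2, t3, t4]
      ring
    have h2 : trace ((W - Y) * (W - Y) * Y ^ (2 * p)) =
        trace (W ^ 2 * Y ^ (2 * p)) - trace (W ^ 1 * Y ^ (2 * p + 1))
          - trace (W ^ 1 * Y ^ (2 * p + 1)) + trace (W ^ 0 * Y ^ (2 * p + 2)) := by
      have t1 : trace (W * Y * Y ^ (2 * p)) = trace (W ^ 1 * Y ^ (2 * p + 1)) := by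
        rw [Matrix.mul_assoc, ← pow_succ', pow_one]
      have t2 : trace (Y * W * Y ^ (2 * p)) = trace (W ^ 1 * Y ^ (2 * p + 1)) := by
        rw [Matrix.mul_assoc, trace_mul_comm, Matrix.mul_assoc, ← pow_succ, pow_one]
      have t3 : trace (W * W * Y ^ (2 * p)) = trace (W ^ 2 * Y ^ (2 * p)) := by rw [sq]
      have t4 : trace (Y * Y * Y ^ (2 * p)) = trace (W ^ 0 * Y ^ (2 * p + 2)) := by
        rw [pow_zero, Matrix.one_mul, pow_add, sq, trace_mul_comm]
      simp only [Matrix.sub_mul, Matrix.mul_sub, trace_sub, t1, t2, t3, t4]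
      ring
    rw [h1, h2, T, T, T, T, T, T]
    simp only [← Finset.sum_sub_distrib, ← Finset.sum_add_distrib]
    exact Finset.sum_congr rfl fun j _ => Finset.sum_congr rfl fun k _ => by ring
  have e3 : trace ((W - Y) * (W ^ (2 * p + 1) - Y ^ (2 * p + 1))) ≤ (2 * p + 1) / 2 *
      (trace ((W - Y) * (W - Y) * W ^ (2 * p)) + trace ((W - Y) * (W - Y) * Y ^ (2 * p))) := by
    rw [e1, e2, Finset.mul_sum]
    refine Finset.sum_le_sum fun j _ => ?_
    rw [Finset.mul_sum]
    refine Finset.sum_le_sum fun k _ => ?_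
    have := mul_le_mul_of_nonneg_right (sub_mul_pow_sub_le (w j) (y k) p)
      (sq_nonneg ((Uᵀ * V) j k))
    linarith
  have := add_le_add (key W hW) (key Y hY)
  have hp : (0 : ℝ) ≤ (2 * p + 1) / 2 := by positivity
  have := mul_le_mul_of_nonneg_left this hp
  linarith

end SpectralNorm

/-! ### Differentiation of the expected risk under the integral sign -/

section ExpectedRisk

set_option maxSynthPendingDepth 3

variable {d : ℕ} {Z : Type*} [MeasurableSpace Z] {P : Measure Z}
  {f : EuclideanSpace ℝ (Fin d) → Z → ℝ} {μ L : ℝ}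

/-- Expansion in the standard basis: measurability and integrability of operator-valued maps reduce
to those of their values on basis vectors. -/
theorem clm_eq_sum_smulRight {F : Type*} [NormedAddCommGroup F] [NormedSpace ℝ F]
    (l : EuclideanSpace ℝ (Fin d) →L[ℝ] F) :
    l = ∑ i, ContinuousLinearMap.smulRightL ℝ (EuclideanSpace ℝ (Fin d)) F
      (EuclideanSpace.proj i) (l (EuclideanSpace.single i 1)) := by
  ext v
  have hv : v = ∑ i, v i • EuclideanSpace.single i (1 : ℝ) := by
    ext j; simp [Pi.single_apply]
  conv_lhs => rw [hv]
  simp [map_sum, sum_apply]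

theorem aestronglyMeasurable_clm {F : Type*} [NormedAddCommGroup F] [NormedSpace ℝ F]
    {φ : Z → EuclideanSpace ℝ (Fin d) →L[ℝ] F}
    (h : ∀ i, AEStronglyMeasurable (fun z => φ z (EuclideanSpace.single i 1)) P) :
    AEStronglyMeasurable φ P := by
  have e : φ = fun z => ∑ i, ContinuousLinearMap.smulRightL ℝ (EuclideanSpace ℝ (Fin d)) F
      (EuclideanSpace.proj i) (φ z (EuclideanSpace.single i 1)) :=
    funext fun z => clm_eq_sum_smulRight (φ z)
  rw [e]
  exact Finset.aestronglyMeasurable_fun_sum _ fun i _ =>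
    (ContinuousLinearMap.continuous _).comp_aestronglyMeasurable (h i)

theorem integrable_clm {F : Type*} [NormedAddCommGroup F] [NormedSpace ℝ F]
    {φ : Z → EuclideanSpace ℝ (Fin d) →L[ℝ] F}
    (h : ∀ i, Integrable (fun z => φ z (EuclideanSpace.single i 1)) P) :
    Integrable φ P := by
  have e : φ = fun z => ∑ i, ContinuousLinearMap.smulRightL ℝ (EuclideanSpace ℝ (Fin d)) F
      (EuclideanSpace.proj i) (φ z (EuclideanSpace.single i 1)) :=
    funext fun z => clm_eq_sum_smulRight (φ z)
  rw [e]
  exact integrable_finsetSum _ fun i _ => ContinuousLinearMap.integrable_comp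
    (ContinuousLinearMap.smulRightL ℝ (EuclideanSpace ℝ (Fin d)) F (EuclideanSpace.proj i)) (h i)

namespace LossAssumptions

/-- By convexity the directional derivative lies between f(w) - f(w - v) and f(w + v) - f(w), so
integrability of the loss at three points suffices. -/
theorem integrable_fderiv_apply (h : LossAssumptions P f μ L) (hμ : 0 < μ)
    (w v : EuclideanSpace ℝ (Fin d)) :
    Integrable (fun z => fderiv ℝ (fun w => f w z) w v) P := by
  refine Integrable.mono' (((h.integrable (w + v)).abs.add (h.integrable (w - v)).abs).add
    (h.integrable w).abs) (measurable_fderiv_apply h.measurable h.differentiable w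
      v).aestronglyMeasurable (Filter.Eventually.of_forall fun z => ?_)
  have h1 := quadratic_lower_bound (h.differentiable z) (h.differentiable_fderiv z) (h.le_D2 z)
    w (w + v)
  have h2 := quadratic_lower_bound (h.differentiable z) (h.differentiable_fderiv z) (h.le_D2 z)
    w (w - v)
  have p : 0 ≤ μ / 2 * ‖v‖ ^ 2 := by positivity
  rw [add_sub_cancel_left] at h1
  rw [show w - v - w = -v by abel, map_neg, norm_neg] at h2
  simp only [Pi.add_apply]
  rw [Real.norm_eq_abs, abs_le]
  constructor <;> linarith [le_abs_self (f (w + v) z), le_abs_self (f (w - v) z),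
    neg_abs_le (f w z), abs_nonneg (f (w + v) z), abs_nonneg (f (w - v) z)]

theorem integrable_fderiv (h : LossAssumptions P f μ L) (hμ : 0 < μ)
    (w : EuclideanSpace ℝ (Fin d)) : Integrable (fun z => fderiv ℝ (fun w => f w z) w) P :=
  integrable_clm fun _ => h.integrable_fderiv_apply hμ w _

theorem norm_fderiv_sub_le (h : LossAssumptions P f μ L) (hL : 0 ≤ L) (z : Z)
    (w w' : EuclideanSpace ℝ (Fin d)) :
    ‖fderiv ℝ (fun w => f w z) w - fderiv ℝ (fun w => f w z) w'‖ ≤ L * ‖w - w'‖ :=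
  Convex.norm_image_sub_le_of_norm_fderiv_le (𝕜 := ℝ)
    (fun x _ => h.differentiable_fderiv z x) (fun x _ => h.norm_D2_le hL z x) convex_univ
    (Set.mem_univ w') (Set.mem_univ w)

/-- On the unit ball around w the gradient is dominated by its norm at w plus L, an integrable
function of the sample. -/
theorem hasFDerivAt_expRisk (h : LossAssumptions P f μ L) (hμ : 0 < μ) (hL : 0 ≤ L)
    [IsProbabilityMeasure P] (w : EuclideanSpace ℝ (Fin d)) :
    HasFDerivAt (expRisk P f) (∫ z, fderiv ℝ (fun w => f w z) w ∂P) w := by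
  refine (hasFDerivAt_integral_of_dominated_loc_of_lip (F := f)
    (bound := fun z => ‖fderiv ℝ (fun w => f w z) w‖ + L) (Metric.ball_mem_nhds w one_pos)
    (Filter.Eventually.of_forall fun x => (h.measurable x).aestronglyMeasurable)
    (h.integrable w) (h.integrable_fderiv hμ w).aestronglyMeasurable
    (Filter.Eventually.of_forall fun z => ?_)
    ((h.integrable_fderiv hμ w).norm.add (integrable_const L))
    (Filter.Eventually.of_forall fun z => (h.differentiable z w).hasFDerivAt)).2
  refine Convex.lipschitzOnWith_of_nnnorm_fderiv_le (𝕜 := ℝ) (fun x _ => h.differentiable z x)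
    (fun x hx => ?_) (convex_ball w 1)
  rw [← NNReal.coe_le_coe, coe_nnnorm, Real.coe_nnabs]
  refine le_trans ?_ (le_abs_self _)
  have h1 := h.norm_fderiv_sub_le hL z x w
  have h2 : ‖x - w‖ ≤ 1 := by
    rw [← dist_eq_norm]; exact (Metric.mem_ball.1 hx).le
  have h3 := norm_le_norm_add_norm_sub' (fderiv ℝ (fun w => f w z) x)
    (fderiv ℝ (fun w => f w z) w)
  nlinarith

theorem hasFDerivAt_fderiv_expRisk (h : LossAssumptions P f μ L) (hμ : 0 < μ) (hL : 0 ≤ L)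
    [IsProbabilityMeasure P] (w : EuclideanSpace ℝ (Fin d)) :
    Integrable (fun z => D2 (fun w => f w z) w) P ∧
      HasFDerivAt (fderiv ℝ (expRisk P f)) (∫ z, D2 (fun w => f w z) w ∂P) w := by
  have e : fderiv ℝ (expRisk P f) = fun w => ∫ z, fderiv ℝ (fun w => f w z) w ∂P :=
    funext fun w => (h.hasFDerivAt_expRisk hμ hL w).fderiv
  rw [e]
  refine hasFDerivAt_integral_of_dominated_loc_of_lip
    (F := fun w z => fderiv ℝ (fun w => f w z) w) (bound := fun _ => L)
    (Metric.ball_mem_nhds w one_pos)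
    (Filter.Eventually.of_forall fun x => (h.integrable_fderiv hμ x).aestronglyMeasurable)
    (h.integrable_fderiv hμ w) ?_
    (Filter.Eventually.of_forall fun z => ?_) (integrable_const L)
    (Filter.Eventually.of_forall fun z => (h.differentiable_fderiv z w).hasFDerivAt)
  · exact aestronglyMeasurable_clm fun i => aestronglyMeasurable_clm fun j =>
      (measurable_D2_apply h.measurable h.differentiable h.differentiable_fderiv w _
        _).aestronglyMeasurable
  · refine LipschitzOnWith.of_dist_le_mul fun x _ y _ => ?_
    rw [dist_eq_norm, dist_eq_norm, Real.coe_nnabs, abs_of_nonneg hL]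
    exact h.norm_fderiv_sub_le hL z x y

theorem integrable_hess_apply (h : LossAssumptions P f μ L) (hμ : 0 < μ) (hL : 0 ≤ L)
    [IsProbabilityMeasure P] (w : EuclideanSpace ℝ (Fin d)) (i j : Fin d) :
    Integrable (fun z => hess (fun w => f w z) w i j) P := by
  simp only [hess_apply]
  exact ((h.hasFDerivAt_fderiv_expRisk hμ hL w).1.apply_continuousLinearMap
    _).apply_continuousLinearMap _

/-- Differentiation under the integral sign for the Hessian of the expected risk. -/
theorem hess_expRisk_apply (h : LossAssumptions P f μ L) (hμ : 0 < μ) (hL : 0 ≤ L)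
    [IsProbabilityMeasure P] (w : EuclideanSpace ℝ (Fin d)) (i j : Fin d) :
    hess (expRisk P f) w i j = ∫ z, hess (fun w => f w z) w i j ∂P := by
  have := h.hasFDerivAt_fderiv_expRisk hμ hL w
  simp only [hess_apply]
  rw [D2, this.2.fderiv, ContinuousLinearMap.integral_apply this.1,
    ContinuousLinearMap.integral_apply (this.1.apply_continuousLinearMap _)]

theorem abs_hess_apply_le (h : LossAssumptions P f μ L) (hL : 0 ≤ L) (z : Z)
    (w : EuclideanSpace ℝ (Fin d)) (i j : Fin d) : |hess (fun w => f w z) w i j| ≤ L := by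
  rw [hess_apply, ← Real.norm_eq_abs]
  refine ((D2 (fun w => f w z) w).le_opNorm₂ _ _).trans ?_
  simpa using h.norm_D2_le hL z w

theorem hess_expRisk_transpose (h : LossAssumptions P f μ L) (hμ : 0 < μ) (hL : 0 ≤ L)
    [IsProbabilityMeasure P] (w : EuclideanSpace ℝ (Fin d)) :
    (hess (expRisk P f) w).transpose = hess (expRisk P f) w := by
  ext i j
  rw [Matrix.transpose_apply, h.hess_expRisk_apply hμ hL, h.hess_expRisk_apply hμ hL]
  congr 1
  funext z
  exact congrFun (congrFun (hess_isSymm (h.contDiff z) w) i) j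

theorem quad_hess_le (h : LossAssumptions P f μ L) (hL : 0 ≤ L) (z : Z)
    (w : EuclideanSpace ℝ (Fin d)) (v : Fin d → ℝ) :
    dotProduct v ((hess (fun w => f w z) w).mulVec v) ≤ L * dotProduct v v := by
  have := h.D2_le hL z w (WithLp.toLp 2 v)
  rw [← hess_quad, EuclideanSpace.real_norm_sq_eq] at this
  simpa [dotProduct, sq] using this

theorem le_quad_hess (h : LossAssumptions P f μ L) (z : Z)
    (w : EuclideanSpace ℝ (Fin d)) (v : Fin d → ℝ) :
    μ * dotProduct v v ≤ dotProduct v ((hess (fun w => f w z) w).mulVec v) := by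
  have := h.le_D2 z w (WithLp.toLp 2 v)
  rw [← hess_quad, EuclideanSpace.real_norm_sq_eq] at this
  simpa [dotProduct, sq] using this

theorem quad_hess_expRisk (h : LossAssumptions P f μ L) (hμ : 0 < μ) (hL : 0 ≤ L)
    [IsProbabilityMeasure P] (w : EuclideanSpace ℝ (Fin d)) (v : Fin d → ℝ) :
    Integrable (fun z => dotProduct v ((hess (fun w => f w z) w).mulVec v)) P ∧
    dotProduct v ((hess (expRisk P f) w).mulVec v) =
      ∫ z, dotProduct v ((hess (fun w => f w z) w).mulVec v) ∂P := by
  have hi : ∀ i j, Integrable (fun z => v i * (hess (fun w => f w z) w i j * v j)) P :=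
    fun i j => ((h.integrable_hess_apply hμ hL w i j).mul_const _).const_mul _
  simp only [dotProduct, Matrix.mulVec, Finset.mul_sum]
  refine ⟨integrable_finsetSum _ fun i _ => integrable_finsetSum _ fun j _ => hi i j, ?_⟩
  rw [integral_finsetSum _ fun i _ => integrable_finsetSum _ fun j _ => hi i j]
  refine Finset.sum_congr rfl fun i _ => ?_
  rw [integral_finsetSum _ fun j _ => hi i j]
  refine Finset.sum_congr rfl fun j _ => ?_
  rw [integral_const_mul, integral_mul_const, h.hess_expRisk_apply hμ hL]

theorem quad_hess_expRisk_le (h : LossAssumptions P f μ L) (hμ : 0 < μ) (hL : 0 ≤ L)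
    [IsProbabilityMeasure P] (w : EuclideanSpace ℝ (Fin d)) (v : Fin d → ℝ) :
    dotProduct v ((hess (expRisk P f) w).mulVec v) ≤ L * dotProduct v v := by
  obtain ⟨hi, he⟩ := h.quad_hess_expRisk hμ hL w v
  rw [he]
  refine (integral_mono hi (integrable_const _) fun z => h.quad_hess_le hL z w v).trans ?_
  simp

theorem le_quad_hess_expRisk (h : LossAssumptions P f μ L) (hμ : 0 < μ) (hL : 0 ≤ L)
    [IsProbabilityMeasure P] (w : EuclideanSpace ℝ (Fin d)) (v : Fin d → ℝ) :
    μ * dotProduct v v ≤ dotProduct v ((hess (expRisk P f) w).mulVec v) := by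
  obtain ⟨hi, he⟩ := h.quad_hess_expRisk hμ hL w v
  rw [he]
  refine le_trans ?_ (integral_mono (integrable_const _) hi fun z => h.le_quad_hess z w v)
  simp

end LossAssumptions

end ExpectedRisk

/-! ### Integration over independent samples -/

section Product

variable {Z : Type*} [MeasurableSpace Z] (P : Measure Z) [IsProbabilityMeasure P]

instance (n : ℕ) : IsProbabilityMeasure (sampleLaw P n) := by
  unfold sampleLaw; infer_instance

/-- Integration over a sample by first integrating over its `i`-th member. -/
theorem integral_sampleLaw_succ {n : ℕ} (i : Fin (n + 1)) {g : Z × (Fin n → Z) → ℝ}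
    (hg : Integrable g (P.prod (sampleLaw P n))) :
    ∫ S, g (S i, fun j => S (i.succAbove j)) ∂(sampleLaw P (n + 1)) =
      ∫ r, ∫ z, g (z, r) ∂P ∂(sampleLaw P n) := by
  rw [← integral_prod_symm _ hg]
  exact (measurePreserving_piFinSuccAbove (fun _ : Fin (n + 1) => P) i).integral_comp' g

theorem measurable_sample {V : Type*} [MeasurableSpace V] {X : Z → V} (hX : Measurable X) (n : ℕ) :
    Measurable fun (S : Fin n → Z) (i : Fin n) => X (S i) :=
  measurable_pi_lambda _ fun i => hX.comp (measurable_pi_apply i)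

/-- The Hessians are bounded by L, so the random matrices below stay in a compact set. Every
continuous expression in them is then integrable. -/
theorem integrable_comp_of_compact {Ω V : Type*} [MeasurableSpace Ω] {Q : Measure Ω}
    [IsFiniteMeasure Q] [TopologicalSpace V] [MeasurableSpace V] [OpensMeasurableSpace V]
    {X : Ω → V} (hX : Measurable X) {K : Set V} (hK : IsCompact K) (hXK : ∀ ω, X ω ∈ K)
    {φ : V → ℝ} (hφ : Continuous φ) : Integrable (fun ω => φ (X ω)) Q := by
  obtain ⟨C, hC⟩ := hK.exists_bound_of_continuousOn hφ.continuousOn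
  exact Integrable.of_bound (hφ.measurable.comp hX).aestronglyMeasurable C
    (Filter.Eventually.of_forall fun ω => hC _ (hXK ω))

end Product

/-! ### Second and fourth moments of sums of independent centered vectors -/

section FourthMoment

/-- Expand the square of ‖y‖² + 2⟨y,v⟩ + ‖v‖². The term linear in v is kept exact because it
averages to zero for centered v; the others are bounded by Cauchy-Schwarz and 2‖y‖‖v‖³ ≤ ‖y‖²‖v‖² +
‖v‖⁴. -/
theorem norm_add_pow_four_le {V : Type*} [NormedAddCommGroup V] [InnerProductSpace ℝ V] (y v : V) :
    ‖y + v‖ ^ 4 ≤ ‖y‖ ^ 4 + 4 * ‖y‖ ^ 2 * inner ℝ y v + 8 * ‖y‖ ^ 2 * ‖v‖ ^ 2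
      + 3 * ‖v‖ ^ 4 := by
  have e := norm_add_sq_real y v
  have h := abs_real_inner_le_norm y v
  have e4 : ‖y + v‖ ^ 4 = (‖y‖ ^ 2 + 2 * inner ℝ y v + ‖v‖ ^ 2) ^ 2 := by rw [← e]; ring
  rw [e4]
  set c := inner ℝ y v
  have h1 : c ^ 2 ≤ (‖y‖ * ‖v‖) ^ 2 := sq_le_sq' (by linarith [neg_abs_le c])
    ((le_abs_self c).trans h)
  have h2 : c * ‖v‖ ^ 2 ≤ ‖y‖ * ‖v‖ * ‖v‖ ^ 2 :=
    mul_le_mul_of_nonneg_right ((le_abs_self c).trans h) (sq_nonneg _)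
  nlinarith [sq_nonneg (‖y‖ * ‖v‖ - ‖v‖ ^ 2)]

variable {Z : Type*} [MeasurableSpace Z] {P : Measure Z} [IsProbabilityMeasure P]
  {V : Type*} [NormedAddCommGroup V] [InnerProductSpace ℝ V] [FiniteDimensional ℝ V]
  [MeasurableSpace V] [BorelSpace V] {u : Z → V} {b : ℝ}

theorem integrable_comp_of_bounded (hu : Measurable u) (hb : ∀ z, ‖u z‖ ≤ b) {φ : V → ℝ}
    (hφ : Continuous φ) : Integrable (fun z => φ (u z)) P :=
  integrable_comp_of_compact hu (isCompact_closedBall 0 b) (fun z => by simpa using hb z) hφ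

theorem integrable_comp_sample (hu : Measurable u) (hb : ∀ z, ‖u z‖ ≤ b) (n : ℕ)
    {φ : (Fin n → V) → ℝ} (hφ : Continuous φ) :
    Integrable (fun S : Fin n → Z => φ fun i => u (S i)) (sampleLaw P n) :=
  integrable_comp_of_compact (measurable_sample hu n)
    (isCompact_univ_pi fun _ => isCompact_closedBall 0 b) (fun S i _ => by simpa using hb (S i)) hφ

theorem integrable_comp_prod_sample (hu : Measurable u) (hb : ∀ z, ‖u z‖ ≤ b) (n : ℕ)
    {φ : V × (Fin n → V) → ℝ} (hφ : Continuous φ) :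
    Integrable (fun q : Z × (Fin n → Z) => φ (u q.1, fun i => u (q.2 i)))
      (P.prod (sampleLaw P n)) :=
  integrable_comp_of_compact
    ((hu.comp measurable_fst).prodMk ((measurable_sample hu n).comp measurable_snd))
    ((isCompact_closedBall 0 b).prod (isCompact_univ_pi fun _ => isCompact_closedBall 0 b))
    (fun q => ⟨by simpa using hb q.1, fun i _ => by simpa using hb (q.2 i)⟩) hφ

theorem integral_norm_add_sq (hu : Measurable u) (hb : ∀ z, ‖u z‖ ≤ b)
    (h0 : ∀ y, ∫ z, inner ℝ y (u z) ∂P = 0) (y : V) :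
    ∫ z, ‖y + u z‖ ^ 2 ∂P = ‖y‖ ^ 2 + ∫ z, ‖u z‖ ^ 2 ∂P := by
  have i1 : Integrable (fun z => inner ℝ y (u z)) P :=
    integrable_comp_of_bounded hu hb (φ := fun v => inner ℝ y v) (by fun_prop)
  have i2 : Integrable (fun z => ‖u z‖ ^ 2) P :=
    integrable_comp_of_bounded hu hb (φ := fun v => ‖v‖ ^ 2) (by fun_prop)
  have e : ∀ z, ‖y + u z‖ ^ 2 = (‖y‖ ^ 2 + 2 * inner ℝ y (u z)) + ‖u z‖ ^ 2 :=
    fun z => norm_add_sq_real y (u z)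
  simp only [e]
  have j : Integrable (fun z => ‖y‖ ^ 2 + 2 * inner ℝ y (u z)) P :=
    (integrable_const _).add (i1.const_mul 2)
  rw [integral_add j i2,
    integral_add (integrable_const _) (i1.const_mul 2), integral_const_mul, h0]
  simp

theorem integral_norm_add_pow_four_le (hu : Measurable u) (hb : ∀ z, ‖u z‖ ≤ b)
    (h0 : ∀ y, ∫ z, inner ℝ y (u z) ∂P = 0) (y : V) :
    ∫ z, ‖y + u z‖ ^ 4 ∂P ≤ ‖y‖ ^ 4 + 8 * ‖y‖ ^ 2 * ∫ z, ‖u z‖ ^ 2 ∂P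
      + 3 * b ^ 2 * ∫ z, ‖u z‖ ^ 2 ∂P := by
  have i1 : Integrable (fun z => inner ℝ y (u z)) P :=
    integrable_comp_of_bounded hu hb (φ := fun v => inner ℝ y v) (by fun_prop)
  have i2 : Integrable (fun z => ‖u z‖ ^ 2) P :=
    integrable_comp_of_bounded hu hb (φ := fun v => ‖v‖ ^ 2) (by fun_prop)
  have i4 : Integrable (fun z => ‖y + u z‖ ^ 4) P :=
    integrable_comp_of_bounded hu hb (φ := fun v => ‖y + v‖ ^ 4) (by fun_prop)
  have hle : ∀ z, ‖y + u z‖ ^ 4 ≤ (‖y‖ ^ 4 + 4 * ‖y‖ ^ 2 * inner ℝ y (u z))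
      + (8 * ‖y‖ ^ 2 + 3 * b ^ 2) * ‖u z‖ ^ 2 := by
    intro z
    refine (norm_add_pow_four_le y (u z)).trans ?_
    have : ‖u z‖ ^ 2 ≤ b ^ 2 := pow_le_pow_left₀ (norm_nonneg _) (hb z) 2
    nlinarith [sq_nonneg ‖u z‖]
  have j1 : Integrable (fun z => ‖y‖ ^ 4 + 4 * ‖y‖ ^ 2 * inner ℝ y (u z)) P :=
    (integrable_const _).add (i1.const_mul _)
  refine (integral_mono i4 (j1.add (i2.const_mul _)) hle).trans_eq ?_
  simp only [Pi.add_apply]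
  rw [integral_add j1 (i2.const_mul _), integral_add (integrable_const _) (i1.const_mul _),
    integral_const_mul, integral_const_mul, h0]
  simp only [integral_const, probReal_univ, smul_eq_mul]
  ring

/-- The second moment of a sum of independent centered vectors. -/
theorem integral_norm_sum_sq (hu : Measurable u) (hb : ∀ z, ‖u z‖ ≤ b)
    (h0 : ∀ y, ∫ z, inner ℝ y (u z) ∂P = 0) (n : ℕ) :
    ∫ S, ‖∑ i, u (S i)‖ ^ 2 ∂(sampleLaw P n) = n * ∫ z, ‖u z‖ ^ 2 ∂P := by
  induction n with
  | zero => simp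
  | succ n ih =>
    have key := integral_sampleLaw_succ P (0 : Fin (n + 1))
      (integrable_comp_prod_sample (P := P) hu hb n
        (φ := fun q => ‖(∑ i, q.2 i) + q.1‖ ^ 2) (by fun_prop))
    have i2 : Integrable (fun S : Fin n → Z => ‖∑ i, u (S i)‖ ^ 2) (sampleLaw P n) :=
      integrable_comp_sample hu hb n (φ := fun v => ‖∑ i, v i‖ ^ 2) (by fun_prop)
    simp only [integral_norm_add_sq hu hb h0] at key
    rw [integral_add i2 (integrable_const _), ih] at key
    simp only [Fin.sum_univ_succAbove _ (0 : Fin (n + 1)), add_comm (u _)]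
    rw [key]
    simp only [integral_const, probReal_univ, smul_eq_mul]
    push_cast
    ring

/-- Adding one summand costs 8‖y‖² times its variance, and the partial sum y has second moment n
times that variance. The increment 4(n+1)² - 4n² ≥ 8n pays for it. -/
theorem integral_norm_sum_pow_four_le (hu : Measurable u) (hb : ∀ z, ‖u z‖ ≤ b)
    (h0 : ∀ y, ∫ z, inner ℝ y (u z) ∂P = 0) (n : ℕ) :
    ∫ S, ‖∑ i, u (S i)‖ ^ 4 ∂(sampleLaw P n) ≤ 4 * n ^ 2 * (∫ z, ‖u z‖ ^ 2 ∂P) ^ 2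
      + 3 * n * b ^ 2 * ∫ z, ‖u z‖ ^ 2 ∂P := by
  induction n with
  | zero => simp
  | succ n ih =>
    have jp := integrable_comp_prod_sample (P := P) hu hb n
        (φ := fun q => ‖(∑ i, q.2 i) + q.1‖ ^ 4) (by fun_prop)
    have key := integral_sampleLaw_succ P (0 : Fin (n + 1)) jp
    have i2 : Integrable (fun S : Fin n → Z => ‖∑ i, u (S i)‖ ^ 2) (sampleLaw P n) :=
      integrable_comp_sample hu hb n (φ := fun v => ‖∑ i, v i‖ ^ 2) (by fun_prop)
    have i4 : Integrable (fun S : Fin n → Z => ‖∑ i, u (S i)‖ ^ 4) (sampleLaw P n) :=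
      integrable_comp_sample hu hb n (φ := fun v => ‖∑ i, v i‖ ^ 4) (by fun_prop)
    have j1 : Integrable (fun S : Fin n → Z => ‖∑ i, u (S i)‖ ^ 4
        + 8 * ‖∑ i, u (S i)‖ ^ 2 * ∫ z, ‖u z‖ ^ 2 ∂P) (sampleLaw P n) :=
      i4.add ((i2.const_mul 8).mul_const _)
    have hle := integral_mono jp.integral_prod_right (j1.add (integrable_const _))
      (fun r => integral_norm_add_pow_four_le hu hb h0 (∑ i, u (r i)))
    simp only [Pi.add_apply] at hle
    rw [integral_add j1 (integrable_const _), integral_add i4 ((i2.const_mul 8).mul_const _),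
      integral_mul_const, integral_const_mul, integral_norm_sum_sq hu hb h0 n] at hle
    simp only [Fin.sum_univ_succAbove _ (0 : Fin (n + 1)), add_comm (u _)]
    rw [key]
    refine hle.trans ?_
    simp only [integral_const, probReal_univ, smul_eq_mul]
    push_cast
    nlinarith [sq_nonneg (∫ z, ‖u z‖ ^ 2 ∂P)]

/-- The first moment of the norm of a long sum of independent centered bounded vectors is
comparable to the square root of its second moment. -/
theorem le_sq_integral_norm_sum (hu : Measurable u) (hb : ∀ z, ‖u z‖ ≤ b)
    (h0 : ∀ y, ∫ z, inner ℝ y (u z) ∂P = 0) {n : ℕ} (hn : 0 < n)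
    (hbn : b ^ 2 ≤ n * ∫ z, ‖u z‖ ^ 2 ∂P) :
    n * (∫ z, ‖u z‖ ^ 2 ∂P) / 56 ≤ (∫ S, ‖∑ i, u (S i)‖ ∂(sampleLaw P n)) ^ 2 := by
  have h2 := integral_norm_sum_sq hu hb h0 n
  have h4 := integral_norm_sum_pow_four_le hu hb h0 n
  have i1 : Integrable (fun S : Fin n → Z => ‖∑ i, u (S i)‖) (sampleLaw P n) :=
    integrable_comp_sample hu hb n (φ := fun v => ‖∑ i, v i‖) (by fun_prop)
  have i2 : Integrable (fun S : Fin n → Z => ‖∑ i, u (S i)‖ ^ 2) (sampleLaw P n) :=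
    integrable_comp_sample hu hb n (φ := fun v => ‖∑ i, v i‖ ^ 2) (by fun_prop)
  have i4 : Integrable (fun S : Fin n → Z => ‖∑ i, u (S i)‖ ^ 4) (sampleLaw P n) :=
    integrable_comp_sample hu hb n (φ := fun v => ‖∑ i, v i‖ ^ 4) (by fun_prop)
  have hσ0 : 0 ≤ ∫ z, ‖u z‖ ^ 2 ∂P := integral_nonneg fun z => by positivity
  have hE0 : 0 ≤ ∫ S, ‖∑ i, u (S i)‖ ∂(sampleLaw P n) := integral_nonneg fun z => norm_nonneg _
  set σ2 := ∫ z, ‖u z‖ ^ 2 ∂P with hσ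
  set E := ∫ S, ‖∑ i, u (S i)‖ ∂(sampleLaw P n)
  rcases hσ0.eq_or_lt with hz | hpos
  · rw [← hz]; simp; positivity
  have hn' : (0 : ℝ) < n := by exact_mod_cast hn
  have hN : 0 < n * σ2 := by positivity
  -- The level for the truncation x² ≤ λx + x⁴/λ². As the fourth moment is at most 7(nσ²)², taking
  -- λ² = 14nσ² makes the last term at most half the second moment. Squaring nσ²/2 ≤ λE then yields
  -- the constant 56.
  have hlam : 0 < √(14 * (n * σ2)) := Real.sqrt_pos.2 (by positivity)
  have hlam2 := Real.sq_sqrt (by positivity : 0 ≤ 14 * (n * σ2))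
  set lam := √(14 * (n * σ2))
  have hpt : ∀ S : Fin n → Z, ‖∑ i, u (S i)‖ ^ 2 ≤
      lam * ‖∑ i, u (S i)‖ + (lam ^ 2)⁻¹ * ‖∑ i, u (S i)‖ ^ 4 := by
    intro S
    have hx := norm_nonneg (∑ i, u (S i))
    set x := ‖∑ i, u (S i)‖
    rcases le_total x lam with h | h
    · have : 0 ≤ (lam ^ 2)⁻¹ * x ^ 4 := by positivity
      nlinarith
    · have : x ^ 2 ≤ (lam ^ 2)⁻¹ * x ^ 4 := by
        rw [← div_eq_inv_mul, le_div_iff₀ (by positivity)]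
        have : lam ^ 2 ≤ x ^ 2 := pow_le_pow_left₀ hlam.le h 2
        nlinarith [sq_nonneg x]
      have : 0 ≤ lam * x := by positivity
      linarith
  have hint := integral_mono i2 ((i1.const_mul lam).add (i4.const_mul _)) hpt
  simp only [Pi.add_apply] at hint
  rw [integral_add (i1.const_mul lam) (i4.const_mul _), integral_const_mul,
    integral_const_mul, h2] at hint
  have h47 : ∫ S, ‖∑ i, u (S i)‖ ^ 4 ∂(sampleLaw P n) ≤ 7 * (n * σ2) ^ 2 := by
    refine h4.trans ?_
    have := mul_le_mul_of_nonneg_right hbn hN.le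
    nlinarith
  have h3 : (lam ^ 2)⁻¹ * ∫ S, ‖∑ i, u (S i)‖ ^ 4 ∂(sampleLaw P n) ≤ n * σ2 / 2 := by
    rw [← div_eq_inv_mul, div_le_iff₀ (by positivity), hlam2]
    nlinarith
  have h5 : n * σ2 / 2 ≤ lam * E := by linarith
  have h6 := pow_le_pow_left₀ (by positivity) h5 2
  rw [mul_pow, hlam2] at h6
  have h7 : n * σ2 * (n * σ2 / 56) ≤ n * σ2 * E ^ 2 := by nlinarith
  exact le_of_mul_le_mul_left h7 hN

end FourthMoment

instance (d : ℕ) : MeasurableSpace (Matrix (Fin d) (Fin d) ℝ) :=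
  inferInstanceAs (MeasurableSpace (Fin d → Fin d → ℝ))

instance (d : ℕ) : BorelSpace (Matrix (Fin d) (Fin d) ℝ) :=
  inferInstanceAs (BorelSpace (Fin d → Fin d → ℝ))

instance (d : ℕ) : SecondCountableTopology (Matrix (Fin d) (Fin d) ℝ) :=
  inferInstanceAs (SecondCountableTopology (Fin d → Fin d → ℝ))

theorem measurable_matrix_iff {d : ℕ} {Ω : Type*} [MeasurableSpace Ω]
    {X : Ω → Matrix (Fin d) (Fin d) ℝ} :
    Measurable X ↔ ∀ i j, Measurable fun ω => X ω i j := by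
  refine ⟨fun h i j => ?_, fun h => ?_⟩
  · have : Measurable fun M : Matrix (Fin d) (Fin d) ℝ => M i j :=
      (continuous_id.matrix_elem i j).measurable
    exact this.comp h
  · exact measurable_pi_lambda _ fun i => measurable_pi_lambda _ fun j => h i j

/-! ### Trace moments and the mean spectral norm of sums of independent matrices -/

section MatrixMoments

open Matrix

theorem transpose_sum_eq {d n : ℕ} {Z : Type*} {X : Z → Matrix (Fin d) (Fin d) ℝ} (hs : ∀ z, (X z)ᵀ = X z) (S : Fin n → Z) :
    (∑ i, X (S i))ᵀ = ∑ i, X (S i) := by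
  rw [transpose_sum]; exact Finset.sum_congr rfl fun i _ => hs _

theorem integral_trace_mul {d : ℕ} {Z : Type*} [MeasurableSpace Z] {P : Measure Z}
    {C : Z → Matrix (Fin d) (Fin d) ℝ}
    (hC : ∀ i j, Integrable (fun z => C z i j) P) (M : Matrix (Fin d) (Fin d) ℝ) :
    ∫ z, trace (M * C z) ∂P = trace (M * Matrix.of fun i j => ∫ z, C z i j ∂P) := by
  have e : ∀ A : Matrix (Fin d) (Fin d) ℝ, trace (M * A) = ∑ i, ∑ j, M i j * A j i :=
    fun A => Finset.sum_congr rfl fun i _ => by rw [diag_apply, Matrix.mul_apply]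
  rw [e]
  simp only [e]
  refine (integral_finsetSum _ fun i _ =>
    integrable_finsetSum _ fun j _ => (hC j i).const_mul (M i j)).trans ?_
  refine Finset.sum_congr rfl fun i _ => ?_
  refine (integral_finsetSum _ fun j _ => (hC j i).const_mul (M i j)).trans ?_
  exact Finset.sum_congr rfl fun j _ => integral_const_mul _ _

variable {d : ℕ} {Z : Type*} [MeasurableSpace Z] {P : Measure Z} [IsProbabilityMeasure P]
  {X : Z → Matrix (Fin d) (Fin d) ℝ} {b L : ℝ}

theorem isCompact_entries_le (d : ℕ) (b : ℝ) :
    IsCompact {M : Matrix (Fin d) (Fin d) ℝ | ∀ i j, |M i j| ≤ b} := by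
  have h : IsCompact (Set.pi Set.univ fun _ : Fin d => Set.pi Set.univ fun _ : Fin d =>
      Set.Icc (-b) b) := isCompact_univ_pi fun _ => isCompact_univ_pi fun _ => isCompact_Icc
  have e : {M : Matrix (Fin d) (Fin d) ℝ | ∀ i j, |M i j| ≤ b} =
      Set.pi Set.univ fun _ : Fin d => Set.pi Set.univ fun _ : Fin d => Set.Icc (-b) b :=
    Set.ext fun M => ⟨fun hM i _ j _ => abs_le.1 (hM i j),
      fun hM i j => abs_le.2 (hM i trivial j trivial)⟩
  rw [e]
  exact h

theorem integrable_comp_matrix {Q : Measure Z} [IsFiniteMeasure Q] (hX : Measurable X)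
    (hb : ∀ z i j, |X z i j| ≤ b) {φ : Matrix (Fin d) (Fin d) ℝ → ℝ} (hφ : Continuous φ) :
    Integrable (fun z => φ (X z)) Q :=
  integrable_comp_of_compact hX (isCompact_entries_le d b) hb hφ

theorem integrable_comp_matrix_sample (hX : Measurable X) (hb : ∀ z i j, |X z i j| ≤ b) (n : ℕ)
    {φ : (Fin n → Matrix (Fin d) (Fin d) ℝ) → ℝ} (hφ : Continuous φ) :
    Integrable (fun S : Fin n → Z => φ fun i => X (S i)) (sampleLaw P n) :=
  integrable_comp_of_compact (measurable_sample hX n)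
    (isCompact_univ_pi fun _ => isCompact_entries_le d b) (fun S i _ => hb (S i)) hφ

theorem integrable_comp_matrix_prod_sample (hX : Measurable X) (hb : ∀ z i j, |X z i j| ≤ b)
    (n : ℕ) {φ : Matrix (Fin d) (Fin d) ℝ × (Fin n → Matrix (Fin d) (Fin d) ℝ) → ℝ}
    (hφ : Continuous φ) :
    Integrable (fun q : Z × (Fin n → Z) => φ (X q.1, fun i => X (q.2 i)))
      (P.prod (sampleLaw P n)) :=
  integrable_comp_of_compact
    ((hX.comp measurable_fst).prodMk ((measurable_sample hX n).comp measurable_snd))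
    ((isCompact_entries_le d b).prod (isCompact_univ_pi fun _ => isCompact_entries_le d b))
    (fun q => ⟨hb q.1, fun i _ => hb (q.2 i)⟩) hφ

/-- One step of the matrix moment recursion: exchange with an independent copy. -/
theorem integral_trace_mul_pow_le (hX : Measurable X) (hb : ∀ z i j, |X z i j| ≤ b)
    (hs : ∀ z, (X z)ᵀ = X z) (h0 : ∀ i j, ∫ z, X z i j ∂P = 0) (hL : 0 ≤ L)
    (hd : ∀ z z' (v : Fin d → ℝ), |v ⬝ᵥ ((X z - X z') *ᵥ v)| ≤ L * (v ⬝ᵥ v))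
    {T : Matrix (Fin d) (Fin d) ℝ} (hT : Tᵀ = T) (p : ℕ) :
    ∫ z, trace (X z * (X z + T) ^ (2 * p + 1)) ∂P ≤
      (2 * p + 1) / 2 * L ^ 2 * ∫ z, trace ((X z + T) ^ (2 * p)) ∂P := by
  set c : ℝ := (2 * p + 1) / 2 * L ^ 2 with hc
  have hXi : ∀ i j, Integrable (fun z => X z i j) P := fun i j =>
    integrable_comp_matrix hX hb (φ := fun M => M i j) (by fun_prop)
  have hCi : ∀ i j, Integrable (fun z => ((X z + T) ^ (2 * p + 1)) i j) P := fun i j =>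
    integrable_comp_matrix hX hb (φ := fun M => ((M + T) ^ (2 * p + 1)) i j) (by fun_prop)
  have hg : Integrable (fun z => trace (X z * (X z + T) ^ (2 * p + 1))) P :=
    integrable_comp_matrix hX hb (φ := fun M => trace (M * (M + T) ^ (2 * p + 1))) (by fun_prop)
  have hh : Integrable (fun z => trace ((X z + T) ^ (2 * p))) P :=
    integrable_comp_matrix hX hb (φ := fun M => trace ((M + T) ^ (2 * p))) (by fun_prop)
  have ha1 : ∀ z', Integrable (fun z => trace (X z * (X z' + T) ^ (2 * p + 1))) P := fun z' =>
    integrable_comp_matrix hX hb (φ := fun M => trace (M * (X z' + T) ^ (2 * p + 1)))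
      (by fun_prop)
  have ha2 : ∀ z', Integrable (fun z => trace (X z' * (X z + T) ^ (2 * p + 1))) P := fun z' =>
    integrable_comp_matrix hX hb (φ := fun M => trace (X z' * (M + T) ^ (2 * p + 1)))
      (by fun_prop)
  have hzero : ∀ C : Matrix (Fin d) (Fin d) ℝ, ∫ z, trace (X z * C) ∂P = 0 := by
    intro C
    simp only [trace_mul_comm _ C]
    rw [integral_trace_mul hXi]
    have : (Matrix.of fun i j => ∫ z, X z i j ∂P) = 0 := by
      ext i j; simp [h0]
    rw [this]; simp
  set C₀ : Matrix (Fin d) (Fin d) ℝ :=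
    Matrix.of fun i j => ∫ z, ((X z + T) ^ (2 * p + 1)) i j ∂P
  -- The trace inequality for X z + T and X z' + T, whose difference does not contain T. Integration
  -- over z and then z' makes both mixed terms vanish, each being linear in a centered copy, and
  -- leaves twice the desired inequality.
  have hpt : ∀ z z', trace (X z * (X z + T) ^ (2 * p + 1))
      + trace (X z' * (X z' + T) ^ (2 * p + 1)) - trace (X z * (X z' + T) ^ (2 * p + 1))
      - trace (X z' * (X z + T) ^ (2 * p + 1)) ≤
      c * trace ((X z + T) ^ (2 * p)) + c * trace ((X z' + T) ^ (2 * p)) := by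
    intro z z'
    have hW : (X z + T)ᵀ = X z + T := by rw [transpose_add, hs, hT]
    have hY : (X z' + T)ᵀ = X z' + T := by rw [transpose_add, hs, hT]
    have e : X z + T - (X z' + T) = X z - X z' := by abel
    have := trace_sub_mul_pow_sub_le hW hY hL (by rw [e]; exact hd z z') p
    rw [e] at this
    simp only [Matrix.sub_mul, Matrix.mul_sub, trace_sub] at this
    rw [hc]
    linarith
  have step1 : ∀ z', (∫ z, trace (X z * (X z + T) ^ (2 * p + 1)) ∂P)
      + trace (X z' * (X z' + T) ^ (2 * p + 1)) - trace (X z' * C₀) ≤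
      c * (∫ z, trace ((X z + T) ^ (2 * p)) ∂P) + c * trace ((X z' + T) ^ (2 * p)) := by
    intro z'
    have j1 : Integrable (fun z => trace (X z * (X z + T) ^ (2 * p + 1))
      + trace (X z' * (X z' + T) ^ (2 * p + 1))) P := hg.add (integrable_const _)
    have j2 : Integrable (fun z => trace (X z * (X z + T) ^ (2 * p + 1))
      + trace (X z' * (X z' + T) ^ (2 * p + 1)) - trace (X z * (X z' + T) ^ (2 * p + 1))) P :=
      j1.sub (ha1 z')
    have := integral_mono (j2.sub (ha2 z')) ((hh.const_mul c).add (integrable_const _))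
      (fun z => hpt z z')
    simp only [Pi.add_apply, Pi.sub_apply] at this
    rw [integral_sub j2 (ha2 z'), integral_sub j1 (ha1 z'),
      integral_add hg (integrable_const _), integral_add (hh.const_mul c) (integrable_const _),
      hzero, integral_trace_mul hCi, integral_const_mul] at this
    simpa using this
  have hC0 : Integrable (fun z => trace (X z * C₀)) P :=
    integrable_comp_matrix hX hb (φ := fun M => trace (M * C₀)) (by fun_prop)
  have j1 : Integrable (fun z' => (∫ z, trace (X z * (X z + T) ^ (2 * p + 1)) ∂P)
      + trace (X z' * (X z' + T) ^ (2 * p + 1))) P := (integrable_const _).add hg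
  have := integral_mono (j1.sub hC0) ((integrable_const _).add (hh.const_mul c)) step1
  simp only [Pi.add_apply, Pi.sub_apply] at this
  rw [integral_sub j1 hC0, integral_add (integrable_const _) hg,
    integral_add (integrable_const _) (hh.const_mul c), hzero] at this
  simp only [integral_const_mul, integral_const, probReal_univ, smul_eq_mul, one_mul, sub_zero] at this
  linarith

/-- The matrix moment recursion. -/
theorem integral_trace_pow_succ_le (hX : Measurable X) (hb : ∀ z i j, |X z i j| ≤ b)
    (hs : ∀ z, (X z)ᵀ = X z) (h0 : ∀ i j, ∫ z, X z i j ∂P = 0) (hL : 0 ≤ L)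
    (hd : ∀ z z' (v : Fin d → ℝ), |v ⬝ᵥ ((X z - X z') *ᵥ v)| ≤ L * (v ⬝ᵥ v)) (n p : ℕ) :
    ∫ S, trace ((∑ i, X (S i)) ^ (2 * (p + 1))) ∂(sampleLaw P n) ≤
      n * ((2 * p + 1) / 2 * L ^ 2) * ∫ S, trace ((∑ i, X (S i)) ^ (2 * p)) ∂(sampleLaw P n) := by
  cases n with
  | zero => simp
  | succ n =>
    -- With the other members of the sample fixed, their sum plays the role of T in the one-step
    -- inequality.
    have hterm : ∀ i : Fin (n + 1),
        ∫ S, trace (X (S i) * (∑ j, X (S j)) ^ (2 * p + 1)) ∂(sampleLaw P (n + 1)) ≤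
        (2 * p + 1) / 2 * L ^ 2 *
          ∫ S, trace ((∑ j, X (S j)) ^ (2 * p)) ∂(sampleLaw P (n + 1)) := by
      intro i
      have j1 := integrable_comp_matrix_prod_sample (P := P) hX hb n
        (φ := fun q => trace (q.1 * (q.1 + ∑ j, q.2 j) ^ (2 * p + 1))) (by fun_prop)
      have j2 := integrable_comp_matrix_prod_sample (P := P) hX hb n
        (φ := fun q => trace ((q.1 + ∑ j, q.2 j) ^ (2 * p))) (by fun_prop)
      simp only [Fin.sum_univ_succAbove _ i]
      rw [integral_sampleLaw_succ P i j1, integral_sampleLaw_succ P i j2, ← integral_const_mul]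
      exact integral_mono j1.integral_prod_right (j2.integral_prod_right.const_mul _) fun r =>
        integral_trace_mul_pow_le hX hb hs h0 hL hd (transpose_sum_eq hs r) p
    have hsplit : ∀ S : Fin (n + 1) → Z, trace ((∑ i, X (S i)) ^ (2 * (p + 1))) =
        ∑ i, trace (X (S i) * (∑ j, X (S j)) ^ (2 * p + 1)) := by
      intro S
      rw [show 2 * (p + 1) = 2 * p + 1 + 1 by ring, pow_succ', Finset.sum_mul, trace_sum]
    simp only [hsplit]
    rw [integral_finsetSum _ fun i _ => integrable_comp_matrix_sample (P := P) hX hb (n + 1)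
        (φ := fun q => trace (q i * (∑ j, q j) ^ (2 * p + 1))) (by fun_prop)]
    refine (Finset.sum_le_card_nsmul _ _ _ fun i _ => hterm i).trans_eq ?_
    simp
    ring

/-- The recursion is iterated from the trace of the identity, which is d; below level k each factor
(2p + 1)/2 is at most k. -/
theorem integral_trace_pow_le (hX : Measurable X) (hb : ∀ z i j, |X z i j| ≤ b)
    (hs : ∀ z, (X z)ᵀ = X z) (h0 : ∀ i j, ∫ z, X z i j ∂P = 0) (hL : 0 ≤ L)
    (hd : ∀ z z' (v : Fin d → ℝ), |v ⬝ᵥ ((X z - X z') *ᵥ v)| ≤ L * (v ⬝ᵥ v)) (n k : ℕ) :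
    ∫ S, trace ((∑ i, X (S i)) ^ (2 * k)) ∂(sampleLaw P n) ≤ (n * k * L ^ 2) ^ k * d := by
  have : ∀ p ≤ k,
      ∫ S, trace ((∑ i, X (S i)) ^ (2 * p)) ∂(sampleLaw P n) ≤ (n * k * L ^ 2) ^ p * d := by
    intro p
    induction p with
    | zero => intro _; simp
    | succ p ih =>
      intro hp
      refine (integral_trace_pow_succ_le hX hb hs h0 hL hd n p).trans ?_
      have h1 := ih (by omega)
      have h2 : (0 : ℝ) ≤ ∫ S, trace ((∑ i, X (S i)) ^ (2 * p)) ∂(sampleLaw P n) :=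
        integral_nonneg fun S => trace_even_pow_nonneg (transpose_sum_eq hs S) p
      have h3 : (2 * (p : ℝ) + 1) / 2 ≤ k := by
        have : (p : ℝ) + 1 ≤ k := by exact_mod_cast hp
        linarith
      have h4 : n * ((2 * p + 1) / 2 * L ^ 2) ≤ n * k * L ^ 2 := by
        rw [mul_assoc]; gcongr
      calc _ ≤ (n * k * L ^ 2) * ((n * k * L ^ 2) ^ p * d) := by gcongr
        _ = _ := by ring
  exact this k le_rfl

/-- The expected spectral norm of a sum of independent centered symmetric matrices. -/
theorem integral_specNorm_sum_le (hX : Measurable X) (hb : ∀ z i j, |X z i j| ≤ b)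
    (hs : ∀ z, (X z)ᵀ = X z) (h0 : ∀ i j, ∫ z, X z i j ∂P = 0) (hL : 0 < L)
    (hd : ∀ z z' (v : Fin d → ℝ), |v ⬝ᵥ ((X z - X z') *ᵥ v)| ≤ L * (v ⬝ᵥ v)) (hd2 : 2 ≤ d)
    {n : ℕ} (hn : 0 < n) :
    (∫ S, specNorm (∑ i, X (S i)) ∂(sampleLaw P n)) ^ 2 ≤ 36 * n * L ^ 2 * Real.log d := by
  have hd' : (2 : ℝ) ≤ d := by exact_mod_cast hd2
  have hlog : 1 / 2 ≤ Real.log d := by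
    have := Real.log_le_log (by norm_num) hd'
    linarith [Real.log_two_gt_d9]
  -- With this k the dimension factor d is at most e^k, so τ² = e n k L² makes the trace term at
  -- most 1 and the mean at most 2τ. As log d ≥ 1/2, k ≤ 3 log d, and 4·e·k ≤ 36 log d.
  set k := ⌈Real.log d⌉₊ with hk
  have hkl : Real.log d ≤ k := Nat.le_ceil _
  have hku : (k : ℝ) ≤ 3 * Real.log d := by
    have := Nat.ceil_lt_add_one (by linarith : 0 ≤ Real.log d)
    linarith
  have hk0 : 0 < k := Nat.ceil_pos.2 (by linarith)
  have hn' : (0 : ℝ) < n := by exact_mod_cast hn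
  have hk' : (0 : ℝ) < k := by exact_mod_cast hk0
  have hq : 0 < n * k * L ^ 2 := by positivity
  have hτ : 0 < √(Real.exp 1 * (n * k * L ^ 2)) := Real.sqrt_pos.2 (by positivity)
  have hτ2 := Real.sq_sqrt (by positivity : 0 ≤ Real.exp 1 * (n * k * L ^ 2))
  set τ := √(Real.exp 1 * (n * k * L ^ 2))
  have hmom := integral_trace_pow_le hX hb hs h0 hL.le hd n k
  have j1 : Integrable (fun S : Fin n → Z => specNorm (∑ i, X (S i))) (sampleLaw P n) :=
    integrable_comp_matrix_sample hX hb n (φ := fun q => specNorm (∑ i, q i))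
      (continuous_specNorm.comp (by fun_prop))
  have j2 : Integrable (fun S : Fin n → Z => trace ((∑ i, X (S i)) ^ (2 * k)))
      (sampleLaw P n) :=
    integrable_comp_matrix_sample hX hb n (φ := fun q => trace ((∑ i, q i) ^ (2 * k)))
      (by fun_prop)
  have hle := integral_mono j1 ((integrable_const τ).add ((j2.div_const _).const_mul τ))
    (fun S => specNorm_le_of_trace (transpose_sum_eq hs S) hτ hk0)
  simp only [Pi.add_apply] at hle
  rw [integral_add (integrable_const τ) ((j2.div_const _).const_mul τ), integral_const_mul,
    integral_div] at hle
  simp only [integral_const, probReal_univ, smul_eq_mul, one_mul] at hle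
  have hratio : (∫ S, trace ((∑ i, X (S i)) ^ (2 * k)) ∂(sampleLaw P n)) / τ ^ (2 * k) ≤ 1 := by
    rw [div_le_one (by positivity), pow_mul, hτ2, mul_pow]
    refine hmom.trans ?_
    rw [mul_comm]
    refine mul_le_mul_of_nonneg_right ?_ (by positivity)
    rw [← Real.exp_nat_mul, mul_one, ← Real.log_le_iff_le_exp (by linarith)]
    exact hkl
  have hE : ∫ S, specNorm (∑ i, X (S i)) ∂(sampleLaw P n) ≤ 2 * τ := by nlinarith
  have hE0 : 0 ≤ ∫ S, specNorm (∑ i, X (S i)) ∂(sampleLaw P n) :=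
    integral_nonneg fun S => specNorm_nonneg _
  have h2 := pow_le_pow_left₀ hE0 hE 2
  rw [mul_pow, hτ2] at h2
  refine h2.trans ?_
  have he : Real.exp 1 ≤ 3 := by linarith [Real.exp_one_lt_d9]
  have h3 : Real.exp 1 * k ≤ 9 * Real.log d := by nlinarith
  have h4 : 0 ≤ n * L ^ 2 := by positivity
  nlinarith [mul_le_mul_of_nonneg_left h3 h4]

end MatrixMoments

/-! ### The variance of the Hessian and the parameter s -/

section Variance

open Matrix

variable {d : ℕ} {Z : Type*} [MeasurableSpace Z] {P : Measure Z}
  {f : EuclideanSpace ℝ (Fin d) → Z → ℝ} {μ L : ℝ}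

/-- The deviation of the Hessian of one loss from the Hessian of the expected risk. -/
def hessDev (P : Measure Z) (f : EuclideanSpace ℝ (Fin d) → Z → ℝ)
    (w : EuclideanSpace ℝ (Fin d)) (z : Z) : Matrix (Fin d) (Fin d) ℝ :=
  hess (fun w => f w z) w - hess (expRisk P f) w

/-- The total variance of the Hessian of the loss at `w`. -/
def hessVar (P : Measure Z) (f : EuclideanSpace ℝ (Fin d) → Z → ℝ)
    (w : EuclideanSpace ℝ (Fin d)) : ℝ := ∫ z, frobNorm (hessDev P f w z) ^ 2 ∂P

theorem hessVar_nonneg (w : EuclideanSpace ℝ (Fin d)) : 0 ≤ hessVar P f w :=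
  integral_nonneg fun _ => sq_nonneg _

namespace LossAssumptions

theorem measurable_hessDev (h : LossAssumptions P f μ L) (w : EuclideanSpace ℝ (Fin d)) :
    Measurable (hessDev P f w) :=
  measurable_matrix_iff.2 fun i j => (h.measurable_hess_apply w i j).sub_const _

theorem hess_empRisk_eq (h : LossAssumptions P f μ L) {n : ℕ} (S : Fin n → Z)
    (w : EuclideanSpace ℝ (Fin d)) :
    hess (empRisk f S) w = (1 / (n : ℝ)) • ∑ i, hess (fun w => f w (S i)) w :=
  hess_empRisk h.differentiable h.differentiable_fderiv S w

theorem hess_empRisk_sub (h : LossAssumptions P f μ L) {n : ℕ} (hn : 0 < n) (S : Fin n → Z)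
    (w : EuclideanSpace ℝ (Fin d)) :
    hess (empRisk f S) w - hess (expRisk P f) w = (1 / (n : ℝ)) • ∑ i, hessDev P f w (S i) := by
  have hn' : (n : ℝ) ≠ 0 := by exact_mod_cast hn.ne'
  simp only [hessDev, Finset.sum_sub_distrib, Finset.sum_const, Finset.card_univ,
    Fintype.card_fin, smul_sub, h.hess_empRisk_eq]
  rw [← Nat.cast_smul_eq_nsmul ℝ, smul_smul, one_div, inv_mul_cancel₀ hn', one_smul]

variable {n : ℕ}

/-- The mean Hessian cancels in the difference, and both remaining Hessians lie between 0 and L I.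
-/
theorem abs_quad_hessDev_sub_le (h : LossAssumptions P f μ L) (hμ : 0 < μ) (hL : 0 ≤ L)
    (w : EuclideanSpace ℝ (Fin d)) (z z' : Z) (v : Fin d → ℝ) :
    |v ⬝ᵥ ((hessDev P f w z - hessDev P f w z') *ᵥ v)| ≤ L * (v ⬝ᵥ v) := by
  have e : hessDev P f w z - hessDev P f w z' =
      hess (fun w => f w z) w - hess (fun w => f w z') w := by
    simp only [hessDev]; abel
  rw [e, sub_mulVec, dotProduct_sub]
  have h1 := h.quad_hess_le hL z w v
  have h2 := h.quad_hess_le hL z' w v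
  have h3 := h.le_quad_hess z w v
  have h4 := h.le_quad_hess z' w v
  have h5 : 0 ≤ μ * (v ⬝ᵥ v) := mul_nonneg hμ.le (dotProduct_self_nonneg v)
  rw [abs_le]
  constructor <;> linarith

theorem measurable_frobVec_hessDev (h : LossAssumptions P f μ L) (w : EuclideanSpace ℝ (Fin d)) :
    Measurable fun z => frobVec (hessDev P f w z) := by
  have : Continuous (frobVec (d := d)) := LinearMap.continuous_of_finiteDimensional _
  exact this.measurable.comp (h.measurable_hessDev w)

theorem specNorm_smul (c : ℝ) (M : Matrix (Fin d) (Fin d) ℝ) :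
    specNorm (c • M) = |c| * specNorm M := by
  rw [specNorm, map_smul, norm_smul, Real.norm_eq_abs]; rfl

theorem hessDevFrob_eq (h : LossAssumptions P f μ L) (hn : 0 < n)
    (w : EuclideanSpace ℝ (Fin d)) : hessDevFrob P f n w =
      (1 / (n : ℝ)) * ∫ S : Fin n → Z, frobNorm (∑ i, hessDev P f w (S i)) ∂(sampleLaw P n) := by
  simp only [hessDevFrob, h.hess_empRisk_sub hn, frobNorm_smul]
  rw [integral_const_mul, abs_of_nonneg (by positivity)]

theorem hessDevSpec_eq (h : LossAssumptions P f μ L) (hn : 0 < n)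
    (w : EuclideanSpace ℝ (Fin d)) : hessDevSpec P f n w =
      (1 / (n : ℝ)) * ∫ S : Fin n → Z, specNorm (∑ i, hessDev P f w (S i)) ∂(sampleLaw P n) := by
  simp only [hessDevSpec, h.hess_empRisk_sub hn, specNorm_smul]
  rw [integral_const_mul, abs_of_nonneg (by positivity)]

theorem hessDevSpec_nonneg (w : EuclideanSpace ℝ (Fin d)) : 0 ≤ hessDevSpec P f n w :=
  integral_nonneg fun _ => specNorm_nonneg _

variable [IsProbabilityMeasure P]

theorem abs_hessDev_apply_le (h : LossAssumptions P f μ L) (hμ : 0 < μ) (hL : 0 ≤ L)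
    (w : EuclideanSpace ℝ (Fin d)) (z : Z) (i j : Fin d) : |hessDev P f w z i j| ≤ 2 * L := by
  have h1 := h.abs_hess_apply_le hL z w i j
  have h2 : |hess (expRisk P f) w i j| ≤ L := by
    rw [h.hess_expRisk_apply hμ hL, ← Real.norm_eq_abs]
    simpa using norm_integral_le_of_norm_le_const (μ := P) (C := L)
      (f := fun z => hess (fun w => f w z) w i j) (Filter.Eventually.of_forall fun z => h.abs_hess_apply_le hL z w i j)
  rw [hessDev, Matrix.sub_apply]
  exact (abs_sub _ _).trans (by linarith)

theorem hessDev_transpose (h : LossAssumptions P f μ L) (hμ : 0 < μ) (hL : 0 ≤ L)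
    (w : EuclideanSpace ℝ (Fin d)) (z : Z) : (hessDev P f w z)ᵀ = hessDev P f w z := by
  rw [hessDev, transpose_sub, hess_isSymm (h.contDiff z), h.hess_expRisk_transpose hμ hL]

theorem integral_hessDev (h : LossAssumptions P f μ L) (hμ : 0 < μ) (hL : 0 ≤ L)
    (w : EuclideanSpace ℝ (Fin d)) (i j : Fin d) : ∫ z, hessDev P f w z i j ∂P = 0 := by
  simp only [hessDev, Matrix.sub_apply]
  rw [integral_sub (h.integrable_hess_apply hμ hL w i j) (integrable_const _),
    ← h.hess_expRisk_apply hμ hL]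
  simp

theorem norm_frobVec_hessDev_le (h : LossAssumptions P f μ L) (hμ : 0 < μ) (hL : 0 ≤ L)
    (w : EuclideanSpace ℝ (Fin d)) (z : Z) : ‖frobVec (hessDev P f w z)‖ ≤ d * (2 * L) := by
  rw [← frobNorm_eq, ← abs_of_nonneg (frobNorm_nonneg _), ← abs_of_nonneg
    (by positivity : 0 ≤ d * (2 * L)), ← sq_le_sq, frobNorm_sq]
  have : ∀ i j, hessDev P f w z i j ^ 2 ≤ (2 * L) ^ 2 := fun i j => by
    rw [← sq_abs]; exact pow_le_pow_left₀ (abs_nonneg _) (h.abs_hessDev_apply_le hμ hL w z i j) 2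
  calc _ ≤ ∑ _i : Fin d, ∑ _j : Fin d, (2 * L) ^ 2 :=
        Finset.sum_le_sum fun i _ => Finset.sum_le_sum fun j _ => this i j
    _ = _ := by simp; ring

theorem integral_inner_hessDev (h : LossAssumptions P f μ L) (hμ : 0 < μ) (hL : 0 ≤ L)
    (w : EuclideanSpace ℝ (Fin d)) (y : EuclideanSpace ℝ (Fin d × Fin d)) :
    ∫ z, inner ℝ y (frobVec (hessDev P f w z)) ∂P = 0 := by
  have e : ∀ z, inner ℝ y (frobVec (hessDev P f w z)) =
      ∑ p, hessDev P f w z p.1 p.2 * y p := fun z => by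
    rw [PiLp.inner_apply]; rfl
  simp only [e]
  have hi : ∀ i j, Integrable (fun z => hessDev P f w z i j) P := fun i j =>
    (h.integrable_hess_apply hμ hL w i j).sub (integrable_const _)
  rw [integral_finsetSum _ fun p _ => (hi p.1 p.2).mul_const _]
  refine Finset.sum_eq_zero fun p _ => ?_
  rw [integral_mul_const, h.integral_hessDev hμ hL, zero_mul]

theorem integrable_frobNorm_hessDev_sq (h : LossAssumptions P f μ L) (hμ : 0 < μ) (hL : 0 ≤ L)
    (w : EuclideanSpace ℝ (Fin d)) : Integrable (fun z => frobNorm (hessDev P f w z) ^ 2) P := by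
  simp only [frobNorm_eq]
  exact integrable_comp_of_bounded (h.measurable_frobVec_hessDev w)
    (h.norm_frobVec_hessDev_le hμ hL w) (φ := fun v => ‖v‖ ^ 2) (by fun_prop)

theorem integrable_frobNorm_sum (h : LossAssumptions P f μ L) (hμ : 0 < μ) (hL : 0 ≤ L)
    (w : EuclideanSpace ℝ (Fin d)) : Integrable
      (fun S : Fin n → Z => frobNorm (∑ i, hessDev P f w (S i))) (sampleLaw P n) := by
  simp only [frobNorm_eq, map_sum]
  exact integrable_comp_sample (h.measurable_frobVec_hessDev w)
    (h.norm_frobVec_hessDev_le hμ hL w) n (φ := fun v => ‖∑ i, v i‖) (by fun_prop)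

theorem integrable_specNorm_sum (h : LossAssumptions P f μ L) (hμ : 0 < μ) (hL : 0 ≤ L)
    (w : EuclideanSpace ℝ (Fin d)) : Integrable
      (fun S : Fin n → Z => specNorm (∑ i, hessDev P f w (S i))) (sampleLaw P n) :=
  integrable_comp_matrix_sample (h.measurable_hessDev w) (h.abs_hessDev_apply_le hμ hL w) n
    (φ := fun q => specNorm (∑ i, q i)) (continuous_specNorm.comp (by fun_prop))

theorem hessDev_comparison (h : LossAssumptions P f μ L) (hμ : 0 < μ) (hL : 0 ≤ L) (hn : 0 < n)
    (w : EuclideanSpace ℝ (Fin d)) : hessDevSpec P f n w ≤ hessDevFrob P f n w ∧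
      hessDevFrob P f n w ≤ √d * hessDevSpec P f n w := by
  have i1 := h.integrable_frobNorm_sum hμ hL w (n := n)
  have i2 := h.integrable_specNorm_sum hμ hL w (n := n)
  rw [h.hessDevFrob_eq hn, h.hessDevSpec_eq hn]
  constructor
  · exact mul_le_mul_of_nonneg_left (integral_mono i2 i1 fun S => specNorm_le_frobNorm _)
      (by positivity)
  · have := integral_mono i1 (i2.const_mul √d) fun S => frobNorm_le_sqrt_mul_specNorm _
    rw [integral_const_mul] at this
    rw [mul_left_comm]
    exact mul_le_mul_of_nonneg_left this (by positivity)

/-- The spectral and Frobenius norms differ by a factor at most √d. The upper bound makes the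
supremum defining s a genuine one. -/
theorem devRatioSq_mem (h : LossAssumptions P f μ L) (hμ : 0 < μ) (hL : 0 ≤ L) (hd : 0 < d)
    (hn : 0 < n) (w : EuclideanSpace ℝ (Fin d)) :
    1 ≤ devRatioSq P f n w ∧ devRatioSq P f n w ≤ d := by
  have hd' : (1 : ℝ) ≤ d := by exact_mod_cast hd
  obtain ⟨h1, h2⟩ := h.hessDev_comparison hμ hL hn w
  unfold devRatioSq
  split_ifs with hz
  · exact ⟨le_rfl, hd'⟩
  · have hpos : 0 < hessDevSpec P f n w :=
      lt_of_le_of_ne (hessDevSpec_nonneg w) (Ne.symm hz)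
    constructor
    · exact one_le_pow₀ ((one_le_div hpos).2 h1)
    · have h3 : hessDevFrob P f n w / hessDevSpec P f n w ≤ √d := (div_le_iff₀ hpos).2 h2
      have h4 : 0 ≤ hessDevFrob P f n w / hessDevSpec P f n w := div_nonneg (hpos.le.trans h1) hpos.le
      calc _ ≤ √d ^ 2 := pow_le_pow_left₀ h4 h3 2
        _ = d := Real.sq_sqrt (by positivity)

theorem devRatioSq_le_sParam (h : LossAssumptions P f μ L) (hμ : 0 < μ) (hL : 0 ≤ L) (hd : 0 < d)
    (hn : 0 < n) (w : EuclideanSpace ℝ (Fin d)) : devRatioSq P f n w ≤ sParam P f := by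
  refine le_csSup ⟨d, ?_⟩ ⟨w, n, hn, rfl⟩
  rintro r ⟨w, n, hn, rfl⟩
  exact (h.devRatioSq_mem hμ hL hd hn w).2

theorem one_le_sParam (h : LossAssumptions P f μ L) (hμ : 0 < μ) (hL : 0 ≤ L) (hd : 0 < d) :
    1 ≤ sParam P f :=
  (h.devRatioSq_mem hμ hL hd one_pos 0).1.trans (h.devRatioSq_le_sParam hμ hL hd one_pos 0)

/-- The definition of s without division: in the 0/0 case the Frobenius deviation vanishes together
with the spectral one. -/
theorem hessDevFrob_sq_le (h : LossAssumptions P f μ L) (hμ : 0 < μ) (hL : 0 ≤ L) (hd : 0 < d)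
    (hn : 0 < n) (w : EuclideanSpace ℝ (Fin d)) :
    hessDevFrob P f n w ^ 2 ≤ sParam P f * hessDevSpec P f n w ^ 2 := by
  obtain ⟨h1, h2⟩ := h.hessDev_comparison hμ hL hn w
  have h3 := h.devRatioSq_le_sParam hμ hL hd hn w
  unfold devRatioSq at h3
  split_ifs at h3 with hz
  · rw [hz] at h1 h2 ⊢
    have : hessDevFrob P f n w = 0 := by linarith
    rw [this]; simp
  · have hpos : 0 < hessDevSpec P f n w :=
      lt_of_le_of_ne (hessDevSpec_nonneg w) (Ne.symm hz)
    rwa [div_pow, div_le_iff₀ (by positivity)] at h3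

/-- The total variance of the Hessian is controlled by the parameter `s`. -/
theorem hessVar_le (h : LossAssumptions P f μ L) (hμ : 0 < μ) (hL : 0 < L) (hd : 2 ≤ d)
    (w : EuclideanSpace ℝ (Fin d)) :
    hessVar P f w ≤ 2016 * (sParam P f * L ^ 2 * Real.log d) := by
  have hs := h.one_le_sParam hμ hL.le (by omega)
  have hlog : 0 ≤ Real.log d := Real.log_nonneg (by exact_mod_cast (by omega : 1 ≤ d))
  rcases (hessVar_nonneg (P := P) (f := f) w).eq_or_lt with hz | hpos
  · rw [← hz]; positivity
  -- An auxiliary sample size, unrelated to m₀: so large that the fourth moment lower bound applies.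
  -- This uses that s is a supremum over all n. Afterwards n cancels, leaving 56·36 = 2016.
  obtain ⟨n, hn⟩ := exists_nat_ge (max 1 ((d * (2 * L)) ^ 2 / hessVar P f w))
  have hn1 : (1 : ℝ) ≤ n := (le_max_left _ _).trans hn
  have hn0 : 0 < n := by exact_mod_cast hn1
  have hbn : (d * (2 * L)) ^ 2 ≤ n * hessVar P f w :=
    (div_le_iff₀ hpos).1 ((le_max_right _ _).trans hn)
  have low := le_sq_integral_norm_sum (h.measurable_frobVec_hessDev w)
    (h.norm_frobVec_hessDev_le hμ hL.le w) (h.integral_inner_hessDev hμ hL.le w) hn0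
    (by simpa only [hessVar, frobNorm_eq] using hbn)
  simp only [← map_sum, ← frobNorm_eq] at low
  have up := integral_specNorm_sum_le (h.measurable_hessDev w) (h.abs_hessDev_apply_le hμ hL.le w)
    (h.hessDev_transpose hμ hL.le w) (h.integral_hessDev hμ hL.le w) hL
    (h.abs_quad_hessDev_sub_le hμ hL.le w) hd hn0
  have mid := h.hessDevFrob_sq_le hμ hL.le (by omega) hn0 w
  rw [h.hessDevFrob_eq hn0, h.hessDevSpec_eq hn0, mul_pow, mul_pow, mul_left_comm] at mid
  have hnp : (0 : ℝ) < (1 / (n : ℝ)) ^ 2 := by positivity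
  have mid' := le_of_mul_le_mul_left mid hnp
  have h1 : n * hessVar P f w / 56 ≤ sParam P f * (36 * n * L ^ 2 * Real.log d) :=
    low.trans (mid'.trans (mul_le_mul_of_nonneg_left up (by linarith)))
  have h2 : (n : ℝ) * hessVar P f w ≤ n * (2016 * (sParam P f * L ^ 2 * Real.log d)) := by
    linarith
  exact le_of_mul_le_mul_left h2 (by linarith)

/-- The mean square deviation of the empirical Hessian. -/
theorem integral_sq_frobNorm_hess_empRisk_sub (h : LossAssumptions P f μ L) (hμ : 0 < μ)
    (hL : 0 ≤ L) (hn : 0 < n) (w : EuclideanSpace ℝ (Fin d)) :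
    Integrable (fun S : Fin n → Z =>
      frobNorm (hess (empRisk f S) w - hess (expRisk P f) w) ^ 2) (sampleLaw P n) ∧
    ∫ S : Fin n → Z, frobNorm (hess (empRisk f S) w - hess (expRisk P f) w) ^ 2
      ∂(sampleLaw P n) = hessVar P f w / n := by
  have hn' : (0 : ℝ) < n := by exact_mod_cast hn
  simp only [h.hess_empRisk_sub hn, frobNorm_smul, mul_pow]
  simp only [frobNorm_eq, map_sum]
  refine ⟨(integrable_comp_sample (h.measurable_frobVec_hessDev w)
    (h.norm_frobVec_hessDev_le hμ hL w) n (φ := fun v => ‖∑ i, v i‖ ^ 2)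
    (by fun_prop)).const_mul _, ?_⟩
  rw [integral_const_mul, integral_norm_sum_sq (h.measurable_frobVec_hessDev w)
    (h.norm_frobVec_hessDev_le hμ hL w) (h.integral_inner_hessDev hμ hL w) n]
  simp only [hessVar, frobNorm_eq, sq_abs]
  field_simp

/-- The mean square deviation of the members of the sample. -/
theorem integral_average_sq_hessDev (h : LossAssumptions P f μ L) (hμ : 0 < μ)
    (hL : 0 ≤ L) (hn : 0 < n) (w : EuclideanSpace ℝ (Fin d)) :
    Integrable (fun S : Fin n → Z => (1 / (n : ℝ)) * ∑ i, frobNorm (hessDev P f w (S i)) ^ 2)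
      (sampleLaw P n) ∧
    ∫ S : Fin n → Z, (1 / (n : ℝ)) * ∑ i, frobNorm (hessDev P f w (S i)) ^ 2
      ∂(sampleLaw P n) = hessVar P f w := by
  have hn' : (n : ℝ) ≠ 0 := by exact_mod_cast hn.ne'
  have hmp : ∀ i : Fin n, MeasurePreserving (fun S : Fin n → Z => S i) (sampleLaw P n) P :=
    fun i => measurePreserving_eval (fun _ : Fin n => P) i
  have hi : ∀ i : Fin n, Integrable (fun S : Fin n → Z => frobNorm (hessDev P f w (S i)) ^ 2)
      (sampleLaw P n) := fun i =>
    (hmp i).integrable_comp_of_integrable (h.integrable_frobNorm_hessDev_sq hμ hL w)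
  refine ⟨(integrable_finsetSum _ fun i _ => hi i).const_mul _, ?_⟩
  rw [integral_const_mul, integral_finsetSum _ fun i _ => hi i]
  have : ∀ i : Fin n, ∫ S : Fin n → Z, frobNorm (hessDev P f w (S i)) ^ 2 ∂(sampleLaw P n)
      = hessVar P f w := fun i => by
    have hm := (h.integrable_frobNorm_hessDev_sq hμ hL w).aestronglyMeasurable
    rw [← (hmp i).map_eq] at hm
    have := integral_map (hmp i).measurable.aemeasurable hm
    rw [(hmp i).map_eq] at this
    exact this.symm
  simp only [this]
  simp
  field_simp

end LossAssumptions

end Variance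

/-! ### Moving the base point of the empirical Hessian -/

section AveragedComparison

open Matrix

variable {d : ℕ} {Z : Type*} [MeasurableSpace Z] {P : Measure Z}
  {f : EuclideanSpace ℝ (Fin d) → Z → ℝ} {μ L : ℝ} {n : ℕ}

theorem average_mul_le {n : ℕ} (hn : 0 < n) (a t : Fin n → ℝ) :
    (1 / (n : ℝ)) * ∑ i, a i * t i ≤
      √((1 / (n : ℝ)) * ∑ i, a i ^ 2) * √((1 / (n : ℝ)) * ∑ i, t i ^ 2) := by
  have hn' : (0 : ℝ) < n := by exact_mod_cast hn
  rw [← Real.sqrt_mul (by positivity)]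
  refine Real.le_sqrt_of_sq_le ?_
  have := Finset.sum_mul_sq_le_sq_mul_sq Finset.univ a t
  calc ((1 / (n : ℝ)) * ∑ i, a i * t i) ^ 2 = (1 / (n : ℝ)) ^ 2 * (∑ i, a i * t i) ^ 2 := by ring
    _ ≤ (1 / (n : ℝ)) ^ 2 * ((∑ i, a i ^ 2) * ∑ i, t i ^ 2) := by gcongr
    _ = _ := by ring

theorem sum_mulVec_quad {n : ℕ} (M : Fin n → Matrix (Fin d) (Fin d) ℝ) (v : Fin d → ℝ) :
    v ⬝ᵥ ((∑ i, M i) *ᵥ v) = ∑ i, v ⬝ᵥ (M i *ᵥ v) := by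
  rw [Matrix.sum_mulVec, dotProduct_sum]

/-- The mean square deviation of the Hessians of the members of a sample. -/
def sampleVar (P : Measure Z) (f : EuclideanSpace ℝ (Fin d) → Z → ℝ) {n : ℕ} (S : Fin n → Z)
    (w : EuclideanSpace ℝ (Fin d)) : ℝ :=
  (1 / (n : ℝ)) * ∑ i, frobNorm (hessDev P f w (S i)) ^ 2

theorem sampleVar_nonneg (S : Fin n → Z) (w : EuclideanSpace ℝ (Fin d)) :
    0 ≤ sampleVar P f S w := by
  unfold sampleVar; positivity

namespace LossAssumptions

theorem hess_empRisk_transpose (h : LossAssumptions P f μ L) (S : Fin n → Z)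
    (w : EuclideanSpace ℝ (Fin d)) : (hess (empRisk f S) w)ᵀ = hess (empRisk f S) w := by
  rw [h.hess_empRisk_eq, transpose_smul, transpose_sum]
  congr 1
  exact Finset.sum_congr rfl fun i _ => hess_isSymm (h.contDiff _) _

theorem le_quad_hess_empRisk (h : LossAssumptions P f μ L) (hn : 0 < n) (S : Fin n → Z)
    (w : EuclideanSpace ℝ (Fin d)) (v : Fin d → ℝ) :
    μ * (v ⬝ᵥ v) ≤ v ⬝ᵥ (hess (empRisk f S) w *ᵥ v) := by
  have hn' : (0 : ℝ) < n := by exact_mod_cast hn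
  rw [h.hess_empRisk_eq, smul_mulVec, dotProduct_smul, sum_mulVec_quad, smul_eq_mul, one_div,
    ← div_eq_inv_mul, le_div_iff₀ hn']
  calc μ * (v ⬝ᵥ v) * n = ∑ _i : Fin n, μ * (v ⬝ᵥ v) := by simp; ring
    _ ≤ _ := Finset.sum_le_sum fun i _ => h.le_quad_hess (S i) w v

/-- The effect of moving from `w` to `y` on the empirical Hessian, in the norm relative to `B`. -/
theorem relNorm_hess_empRisk_sub_le (h : LossAssumptions P f μ L) (hμ : 0 < μ) (hL : 0 ≤ L)
    (hn : 0 < n) (S : Fin n → Z) (y w x : EuclideanSpace ℝ (Fin d)) {b : ℝ}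
    (hb : b = (1 / (n : ℝ)) * ∑ i, (breg (fun w => f w (S i)) y x + breg (fun w => f w (S i)) w x))
    {B : Matrix (Fin d) (Fin d) ℝ} (hB : Bᵀ = B)
    (hpd : ∀ v : Fin d → ℝ, μ * (v ⬝ᵥ v) ≤ v ⬝ᵥ (B *ᵥ v)) :
    relNorm B (hess (empRisk f S) y - hess (empRisk f S) w) ≤
      400000 * (min 1 √b * relNorm B (hess (expRisk P f) w)
        + √b * √(sampleVar P f S w) / μ + b * (L / μ * √d)) := by
  have hn' : (0 : ℝ) < n := by exact_mod_cast hn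
  set β : Fin n → ℝ := fun i => breg (fun w => f w (S i)) y x + breg (fun w => f w (S i)) w x
    with hβ
  have hβ0 : ∀ i, 0 ≤ β i := fun i => add_nonneg ((h.strictSC hμ (S i)).breg_nonneg y x)
    ((h.strictSC hμ (S i)).breg_nonneg w x)
  have hb0 : 0 ≤ b := by
    rw [hb]; exact mul_nonneg (by positivity) (Finset.sum_nonneg fun i _ => hβ0 i)
  set a : Fin n → ℝ := fun i => min 1 √(β i) with ha
  have ha0 : ∀ i, 0 ≤ a i := fun i => le_min zero_le_one (Real.sqrt_nonneg _)
  have ha1 : ∀ i, a i ≤ 1 := fun i => min_le_left _ _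
  have hasq : (1 / (n : ℝ)) * ∑ i, a i ^ 2 ≤ b := by
    rw [hb]
    refine mul_le_mul_of_nonneg_left (Finset.sum_le_sum fun i _ => ?_) (by positivity)
    exact (pow_le_pow_left₀ (ha0 i) (min_le_right _ _) 2).trans_eq (Real.sq_sqrt (hβ0 i))
  have hmean : (1 / (n : ℝ)) * ∑ i, a i ≤ min 1 √b := by
    refine le_min ?_ ?_
    · rw [one_div, ← div_eq_inv_mul, div_le_one hn']
      calc ∑ i, a i ≤ ∑ _i : Fin n, (1 : ℝ) := Finset.sum_le_sum fun i _ => ha1 i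
        _ = n := by simp
    · have := average_mul_le hn a fun _ => 1
      simp only [mul_one, one_pow, Finset.sum_const, Finset.card_univ, Fintype.card_fin,
        nsmul_eq_mul] at this
      rw [one_div_mul_cancel hn'.ne', Real.sqrt_one, mul_one] at this
      exact this.trans (Real.sqrt_le_sqrt hasq)
  have hdev : (1 / (n : ℝ)) * ∑ i, a i * frobNorm (hessDev P f w (S i)) ≤
      √b * √(sampleVar P f S w) := by
    refine (average_mul_le hn a fun i => frobNorm (hessDev P f w (S i))).trans ?_
    exact mul_le_mul_of_nonneg_right (Real.sqrt_le_sqrt hasq) (Real.sqrt_nonneg _)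
  -- The average of the single-loss majorants, each Hessian at w being split into mean and
  -- deviation. The three pieces are then measured separately; Cauchy-Schwarz over the sample has
  -- already bounded the weighted deviations.
  set A : Matrix (Fin d) (Fin d) ℝ := (400000 : ℝ) •
    (((1 / (n : ℝ)) * ∑ i, a i) • hess (expRisk P f) w +
      (((1 / (n : ℝ)) • ∑ i, a i • hessDev P f w (S i)) + (b * L) • 1)) with hA
  have hquad : ∀ v : Fin d → ℝ,
      |v ⬝ᵥ ((hess (empRisk f S) y - hess (empRisk f S) w) *ᵥ v)| ≤ v ⬝ᵥ (A *ᵥ v) := by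
    intro v
    have hi : ∀ i, |v ⬝ᵥ (hess (fun w => f w (S i)) y *ᵥ v)
        - v ⬝ᵥ (hess (fun w => f w (S i)) w *ᵥ v)| ≤
        400000 * (a i * (v ⬝ᵥ (hess (fun w => f w (S i)) w *ᵥ v)) + β i * (L * (v ⬝ᵥ v))) := by
      intro i
      have := (h.strictSC hμ (S i)).abs_quad_sub_le_of_breg (h.selfConcordant (S i)).1
        (fun x v => h.D2_le hL (S i) x v) y w x (WithLp.toLp 2 v)
      rw [← hess_quad, ← hess_quad, EuclideanSpace.real_norm_sq_eq] at this
      simpa only [dotProduct, sq] using this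
    have e1 : v ⬝ᵥ ((hess (empRisk f S) y - hess (empRisk f S) w) *ᵥ v) =
        (1 / (n : ℝ)) * ∑ i, (v ⬝ᵥ (hess (fun w => f w (S i)) y *ᵥ v)
        - v ⬝ᵥ (hess (fun w => f w (S i)) w *ᵥ v)) := by
      rw [h.hess_empRisk_eq, h.hess_empRisk_eq, sub_mulVec, dotProduct_sub, smul_mulVec,
        smul_mulVec, dotProduct_smul, dotProduct_smul, sum_mulVec_quad, sum_mulVec_quad,
        Finset.sum_sub_distrib, smul_eq_mul, smul_eq_mul, mul_sub]
    have e2 : v ⬝ᵥ (A *ᵥ v) = (1 / (n : ℝ)) * ∑ i,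
        400000 * (a i * (v ⬝ᵥ (hess (fun w => f w (S i)) w *ᵥ v)) + β i * (L * (v ⬝ᵥ v))) := by
      have e3 : ∀ i, v ⬝ᵥ (hess (fun w => f w (S i)) w *ᵥ v) =
          v ⬝ᵥ (hess (expRisk P f) w *ᵥ v) + v ⬝ᵥ (hessDev P f w (S i) *ᵥ v) := fun i => by
        rw [← dotProduct_add, ← add_mulVec, hessDev, add_sub_cancel]
      simp only [hA, smul_mulVec, add_mulVec, dotProduct_smul, dotProduct_add, sum_mulVec_quad,
        smul_eq_mul, one_mulVec, e3, mul_add, Finset.sum_add_distrib, ← Finset.mul_sum,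
        ← Finset.sum_mul]
      rw [hb]
      ring
    rw [e1, e2, abs_mul, abs_of_nonneg (by positivity : (0 : ℝ) ≤ 1 / n)]
    refine mul_le_mul_of_nonneg_left ?_ (by positivity)
    exact (Finset.abs_sum_le_sum_abs _ _).trans (Finset.sum_le_sum fun i _ => hi i)
  have hMs : (hess (empRisk f S) y - hess (empRisk f S) w)ᵀ =
      hess (empRisk f S) y - hess (empRisk f S) w := by
    rw [transpose_sub, h.hess_empRisk_transpose, h.hess_empRisk_transpose]
  refine (relNorm_mono hB hMs hquad).trans ?_
  rw [hA, relNorm_smul, abs_of_pos (by norm_num : (0 : ℝ) < 400000)]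
  refine mul_le_mul_of_nonneg_left ?_ (by norm_num)
  refine (relNorm_add_le _ _ _).trans ?_
  rw [add_assoc]
  refine add_le_add ?_ ((relNorm_add_le _ _ _).trans (add_le_add ?_ ?_))
  · rw [relNorm_smul, abs_of_nonneg
      (mul_nonneg (by positivity) (Finset.sum_nonneg fun i _ => ha0 i))]
    exact mul_le_mul_of_nonneg_right hmean (relNorm_nonneg _ _)
  · refine (relNorm_le hμ hB hpd _).trans ?_
    refine div_le_div_of_nonneg_right (le_trans ?_ hdev) hμ.le
    rw [frobNorm_smul, abs_of_nonneg (by positivity : (0 : ℝ) ≤ 1 / n)]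
    refine mul_le_mul_of_nonneg_left ((frobNorm_sum_le _ _).trans_eq ?_) (by positivity)
    exact Finset.sum_congr rfl fun i _ => by rw [frobNorm_smul, abs_of_nonneg (ha0 i)]
  · refine (relNorm_le hμ hB hpd _).trans_eq ?_
    rw [frobNorm_smul, frobNorm_one, abs_of_nonneg (mul_nonneg hb0 hL)]
    ring

variable [IsProbabilityMeasure P]

theorem relNorm_hess_expRisk_le (h : LossAssumptions P f μ L) (hμ : 0 < μ) (hL : 0 ≤ L)
    (w : EuclideanSpace ℝ (Fin d)) {B : Matrix (Fin d) (Fin d) ℝ} (hB : Bᵀ = B)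
    (hpd : ∀ v : Fin d → ℝ, μ * (v ⬝ᵥ v) ≤ v ⬝ᵥ (B *ᵥ v)) :
    relNorm B (hess (expRisk P f) w) ≤ L / μ * √d := by
  have h1 := relNorm_mono (A := L • (1 : Matrix (Fin d) (Fin d) ℝ)) hB
    (h.hess_expRisk_transpose hμ hL w) fun v => by
      have p : 0 ≤ μ * (v ⬝ᵥ v) := mul_nonneg hμ.le (dotProduct_self_nonneg v)
      rw [abs_of_nonneg (p.trans (h.le_quad_hess_expRisk hμ hL w v)), smul_mulVec, one_mulVec,
        dotProduct_smul, smul_eq_mul]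
      exact h.quad_hess_expRisk_le hμ hL w v
  refine h1.trans ((relNorm_le hμ hB hpd _).trans_eq ?_)
  rw [frobNorm_smul, frobNorm_one, abs_of_nonneg hL]
  ring

/-- The Hessian of the expected risk relative to the empirical Hessian at the empirical
minimizer. -/
theorem relNorm_hess_expRisk_le_of_gap (h : LossAssumptions P f μ L) (hμ : 0 < μ) (hL : 0 ≤ L)
    (hn : 0 < n) (S : Fin n → Z) (w : EuclideanSpace ℝ (Fin d)) {b : ℝ} (hb0 : 0 ≤ b)
    (hmove : ∀ B : Matrix (Fin d) (Fin d) ℝ, B = hess (empRisk f S) (argMin (empRisk f S)) →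
      relNorm B (B - hess (empRisk f S) w) ≤
      400000 * (min 1 √b * relNorm B (hess (expRisk P f) w)
        + √b * √(sampleVar P f S w) / μ + b * (L / μ * √d))) :
    relNorm (hess (empRisk f S) (argMin (empRisk f S))) (hess (expRisk P f) w) ≤
      2 * √d + 2 * (frobNorm (hess (empRisk f S) w - hess (expRisk P f) w) / μ)
        + 800000 * (√b * √(sampleVar P f S w) / μ) + 1000000000000 * (b * (L / μ * √d)) := by
  set B := hess (empRisk f S) (argMin (empRisk f S)) with hBdef
  have hB : Bᵀ = B := h.hess_empRisk_transpose _ _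
  have hpd := h.le_quad_hess_empRisk hn S (argMin (empRisk f S))
  have hm := hmove B rfl
  have hY0 := relNorm_nonneg B (hess (expRisk P f) w)
  have hYκ := h.relNorm_hess_expRisk_le hμ hL w hB hpd
  set Y := relNorm B (hess (expRisk P f) w)
  have t0 : 0 ≤ √b * √(sampleVar P f S w) / μ := by positivity
  have d0 : 0 ≤ frobNorm (hess (empRisk f S) w - hess (expRisk P f) w) / μ :=
    div_nonneg (frobNorm_nonneg _) hμ.le
  have k0 : 0 ≤ L / μ * √d := by positivity
  have bk0 : 0 ≤ b * (L / μ * √d) := by positivity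
  -- If b is small, the triangle inequality from B, whose relative norm is √d, bounds Y by itself
  -- with coefficient 400000/800000 = 1/2, which is absorbed. Otherwise b ≥ 800000⁻², and the crude
  -- bound Y ≤ κ√d is within 10¹² b κ√d.
  rcases le_or_gt (√b) (1 / 800000) with hs | hs
  · have e : hess (expRisk P f) w = B + (-(B - hess (empRisk f S) w) +
        -(hess (empRisk f S) w - hess (expRisk P f) w)) := by abel
    have h1 : Y ≤ √d + (relNorm B (B - hess (empRisk f S) w) +
        frobNorm (hess (empRisk f S) w - hess (expRisk P f) w) / μ) := by
      calc Y = relNorm B (B + (-(B - hess (empRisk f S) w) +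
            -(hess (empRisk f S) w - hess (expRisk P f) w))) := by rw [← e]
        _ ≤ relNorm B B + (relNorm B (-(B - hess (empRisk f S) w)) +
            relNorm B (-(hess (empRisk f S) w - hess (expRisk P f) w))) :=
          (relNorm_add_le _ _ _).trans (add_le_add le_rfl (relNorm_add_le _ _ _))
        _ ≤ _ := by
          rw [relNorm_self hμ hB hpd, relNorm_neg, relNorm_neg]
          gcongr
          exact relNorm_le hμ hB hpd _
    have h2 : min 1 √b * Y ≤ 1 / 800000 * Y :=
      mul_le_mul_of_nonneg_right ((min_le_right _ _).trans hs) hY0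
    linarith
  · have hb2 : 1 ≤ 640000000000 * b := by
      have := Real.sq_sqrt hb0
      nlinarith
    have := mul_le_mul_of_nonneg_right hb2 k0
    have := Real.sqrt_nonneg (d : ℝ)
    linarith

end LossAssumptions

end AveragedComparison

/-! ### The law of an initial segment of a sample -/

section FirstSamples

variable {Z : Type*} [MeasurableSpace Z] {P : Measure Z} [IsProbabilityMeasure P] {m n : ℕ}

theorem measurePreserving_firstSamples (h : m ≤ n) :
    MeasurePreserving (firstSamples h) (sampleLaw P n) (sampleLaw P m) := by
  obtain ⟨k, rfl⟩ := Nat.exists_eq_add_of_le h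
  have hmeas : Measurable (firstSamples (Z := Z) h) :=
    measurable_pi_lambda _ fun i => measurable_pi_apply _
  refine ⟨hmeas, (Measure.pi_eq fun s hs => ?_).symm⟩
  rw [Measure.map_apply hmeas (MeasurableSet.univ_pi hs)]
  -- The preimage of a box is the same box padded with full factors, each of mass 1.
  have e : firstSamples h ⁻¹' (Set.univ.pi s) =
      Set.univ.pi (Fin.addCases s fun _ : Fin k => (Set.univ : Set Z)) := by
    ext S
    simp only [Set.mem_preimage, Set.mem_univ_pi]
    constructor
    · intro hS j
      refine Fin.addCases (fun i => ?_) (fun i => ?_) j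
      · rw [Fin.addCases_left]; exact hS i
      · rw [Fin.addCases_right]; trivial
    · intro hS i
      have := hS (Fin.castAdd k i)
      rw [Fin.addCases_left] at this
      exact this
  rw [e, sampleLaw, Measure.pi_pi, Fin.prod_univ_add]
  simp

theorem integral_firstSamples (h : m ≤ n) {g : (Fin m → Z) → ℝ}
    (hg : Integrable g (sampleLaw P m)) :
    Integrable (fun S => g (firstSamples h S)) (sampleLaw P n) ∧
      ∫ S, g (firstSamples h S) ∂(sampleLaw P n) = ∫ S, g S ∂(sampleLaw P m) := by
  have hmp := measurePreserving_firstSamples (P := P) h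
  refine ⟨hmp.integrable_comp_of_integrable hg, ?_⟩
  have hg' := hg.aestronglyMeasurable
  rw [← hmp.map_eq] at hg'
  have := integral_map hmp.measurable.aemeasurable hg'
  rw [hmp.map_eq] at this
  exact this.symm

end FirstSamples

/-! ### Expected optimality gaps -/

section Gaps

variable {d : ℕ} {Z : Type*} [MeasurableSpace Z] {P : Measure Z}
  {f : EuclideanSpace ℝ (Fin d) → Z → ℝ} {μ L : ℝ} {n : ℕ}

/-- The optimality gap of `w` for the empirical risk. -/
def empGap (f : EuclideanSpace ℝ (Fin d) → Z → ℝ) (S : Fin n → Z)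
    (w : EuclideanSpace ℝ (Fin d)) : ℝ :=
  empRisk f S w - empRisk f S (argMin (empRisk f S))

namespace LossAssumptions

theorem empGap_nonneg (h : LossAssumptions P f μ L) (hμ : 0 < μ) (hn : 0 < n) (S : Fin n → Z)
    (w : EuclideanSpace ℝ (Fin d)) : 0 ≤ empGap f S w :=
  sub_nonneg.2 ((le_add_of_nonneg_right (by positivity)).trans (h.empRisk_minimizer hμ hn S w))

theorem measurable_empRisk_comp (h : LossAssumptions P f μ L)
    {y : (Fin n → Z) → EuclideanSpace ℝ (Fin d)} (hy : Measurable y) :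
    Measurable fun S => empRisk f S (y S) :=
  (Finset.measurable_sum _ fun i _ =>
    h.measurable_uncurry.comp (hy.prodMk (measurable_pi_apply i))).const_mul _

variable [IsProbabilityMeasure P]

theorem integral_empRisk (h : LossAssumptions P f μ L) (hn : 0 < n)
    (w : EuclideanSpace ℝ (Fin d)) :
    Integrable (fun S : Fin n → Z => empRisk f S w) (sampleLaw P n) ∧
      ∫ S : Fin n → Z, empRisk f S w ∂(sampleLaw P n) = expRisk P f w := by
  have hn' : (n : ℝ) ≠ 0 := by exact_mod_cast hn.ne'
  have hmp : ∀ i : Fin n, MeasurePreserving (fun S : Fin n → Z => S i) (sampleLaw P n) P :=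
    fun i => measurePreserving_eval (fun _ : Fin n => P) i
  have hi : ∀ i : Fin n, Integrable (fun S : Fin n → Z => f w (S i)) (sampleLaw P n) :=
    fun i => (hmp i).integrable_comp_of_integrable (h.integrable w)
  refine ⟨(integrable_finsetSum _ fun i _ => hi i).const_mul _, ?_⟩
  simp only [empRisk]
  rw [integral_const_mul, integral_finsetSum _ fun i _ => hi i]
  have : ∀ i : Fin n, ∫ S : Fin n → Z, f w (S i) ∂(sampleLaw P n) = expRisk P f w := fun i => by
    have hm := (h.integrable w).aestronglyMeasurable
    rw [← (hmp i).map_eq] at hm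
    have := integral_map (hmp i).measurable.aemeasurable hm
    rw [(hmp i).map_eq] at this
    exact this.symm
  simp only [this]
  simp
  field_simp

/-- The empirical optimality gap of the minimizer of the expected risk is within the statistical
accuracy. -/
theorem integral_empGap_le (h : LossAssumptions P f μ L) (hμ : 0 < μ) (hn : 0 < n) {V : ℕ → ℝ}
    (hV : IsStatAccuracy P f V) :
    Integrable (fun S : Fin n → Z => empGap f S (argMin (expRisk P f))) (sampleLaw P n) ∧
      ∫ S : Fin n → Z, empGap f S (argMin (expRisk P f)) ∂(sampleLaw P n) ≤ V n := by
  obtain ⟨hi, hle⟩ := hV n hn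
  obtain ⟨ji, je⟩ := h.integral_empRisk hn (argMin (expRisk P f))
  have hm : Measurable fun S : Fin n → Z => empRisk f S (argMin (empRisk f S)) :=
    h.measurable_empRisk_comp (h.measurable_argMin_empRisk hμ hn)
  have hi' : Integrable (fun S : Fin n → Z => empRisk f S (argMin (empRisk f S))
      - expRisk P f (argMin (expRisk P f))) (sampleLaw P n) :=
    (integrable_norm_iff (hm.sub_const _).aestronglyMeasurable).1 hi
  -- At the deterministic point w* the empirical risk is unbiased, so the first difference has mean
  -- zero; the second is what the statistical accuracy bounds.
  have e : ∀ S : Fin n → Z, empGap f S (argMin (expRisk P f)) =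
      empRisk f S (argMin (expRisk P f)) - expRisk P f (argMin (expRisk P f))
      - (empRisk f S (argMin (empRisk f S)) - expRisk P f (argMin (expRisk P f))) := fun S => by
    rw [empGap]; ring
  have j1 : Integrable (fun S : Fin n → Z => empRisk f S (argMin (expRisk P f))
      - expRisk P f (argMin (expRisk P f))) (sampleLaw P n) := ji.sub (integrable_const _)
  simp only [e]
  refine ⟨j1.sub hi', ?_⟩
  rw [integral_sub j1 hi', integral_sub ji (integrable_const _), je]
  have := neg_le_of_abs_le (abs_integral_le_integral_abs (f := fun S : Fin n → Z =>
    empRisk f S (argMin (empRisk f S)) - expRisk P f (argMin (expRisk P f)))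
    (μ := sampleLaw P n))
  simp only [integral_const, probReal_univ, smul_eq_mul, one_mul, sub_self, zero_sub]
  linarith

end LossAssumptions

end Gaps

/-! ### Measurability of the relative error -/

section Measurability

open Matrix

variable {d : ℕ} {Ω Z : Type*} [MeasurableSpace Ω] [MeasurableSpace Z] {P : Measure Z}
  {f : EuclideanSpace ℝ (Fin d) → Z → ℝ} {μ L : ℝ} {n : ℕ}

theorem measurable_matrix_inv {B : Ω → Matrix (Fin d) (Fin d) ℝ} (hB : Measurable B) :
    Measurable fun ω => (B ω)⁻¹ := by
  refine measurable_matrix_iff.2 fun i j => ?_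
  have e : ∀ ω, (B ω)⁻¹ i j = ((B ω).det)⁻¹ * (B ω).adjugate i j := fun ω => by
    rw [inv_def, Ring.inverse_eq_inv', Matrix.smul_apply, smul_eq_mul]
  simp only [e]
  have h1 : Continuous fun M : Matrix (Fin d) (Fin d) ℝ => M.det := continuous_id.matrix_det
  have h2 : Continuous fun M : Matrix (Fin d) (Fin d) ℝ => M.adjugate i j :=
    continuous_id.matrix_adjugate.matrix_elem i j
  exact (h1.measurable.comp hB).inv.mul (h2.measurable.comp hB)

theorem measurable_relFrobError (hμ : 0 < μ) {A B : Ω → Matrix (Fin d) (Fin d) ℝ}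
    (hA : Measurable A) (hB : Measurable B) (hAs : ∀ ω, (A ω)ᵀ = A ω) (hBs : ∀ ω, (B ω)ᵀ = B ω)
    (hpd : ∀ ω (v : Fin d → ℝ), μ * (v ⬝ᵥ v) ≤ v ⬝ᵥ (B ω *ᵥ v)) :
    Measurable fun ω => relFrobError (A ω) (B ω) := by
  have e : ∀ ω, relFrobError (A ω) (B ω) =
      √(trace ((B ω)⁻¹ * (A ω - B ω) * (B ω)⁻¹ * (A ω - B ω))) := fun ω =>
    relNorm_eq_sqrt_trace hμ (hBs ω) (hpd ω) (by rw [transpose_sub, hAs, hBs])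
  simp only [e]
  have hI := measurable_matrix_inv hB
  have hI' : ∀ i j, Measurable fun ω => (B ω)⁻¹ i j := fun i j => measurable_matrix_iff.1 hI i j
  have hA' : ∀ i j, Measurable fun ω => A ω i j := fun i j => measurable_matrix_iff.1 hA i j
  have hB' : ∀ i j, Measurable fun ω => B ω i j := fun i j => measurable_matrix_iff.1 hB i j
  refine Measurable.sqrt ?_
  simp only [trace, diag_apply, mul_apply, Matrix.sub_apply]
  fun_prop

theorem LossAssumptions.measurable_hess_empRisk_comp (h : LossAssumptions P f μ L)
    {T : Ω → Fin n → Z} (hT : Measurable T) {y : Ω → EuclideanSpace ℝ (Fin d)}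
    (hy : Measurable y) : Measurable fun ω => hess (empRisk f (T ω)) (y ω) := by
  refine measurable_matrix_iff.2 fun i j => ?_
  simp only [h.hess_empRisk_eq, Matrix.smul_apply, Matrix.sum_apply, smul_eq_mul]
  exact (Finset.measurable_sum _ fun k _ => (h.measurable_uncurry_hess_apply i j).comp
    (hy.prodMk ((measurable_pi_apply k).comp hT))).const_mul _

end Measurability

/-! ### The relative Hessian error, pointwise and in expectation -/

section Expectation

open Matrix

variable {d : ℕ} {Z : Type*} [MeasurableSpace Z] {P : Measure Z} [IsProbabilityMeasure P]
  {f : EuclideanSpace ℝ (Fin d) → Z → ℝ} {μ L : ℝ} {m n : ℕ}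

theorem mul_le_add_div_of_sq {x y ε : ℝ} (hε : 0 < ε) : x * y ≤ ε * x ^ 2 + y ^ 2 / ε := by
  rw [← sub_nonneg]
  have : ε * x ^ 2 + y ^ 2 / ε - x * y = ((ε * x - y / 2) ^ 2 + 3 / 4 * y ^ 2) / ε := by
    field_simp; ring
  rw [this]
  positivity

/-- The minimum is used twice: as √b against the main part of Y and as 1 against the error part.
This avoids products of gaps, whose expectations are not controlled. -/
theorem min_one_sqrt_mul_le {b q r Y : ℝ} (hr : 0 ≤ r) (hq : 0 ≤ q)
    (hY : Y ≤ 2 * q + r) : min 1 √b * Y ≤ 2 * (q * √b) + r := by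
  have h0 : 0 ≤ min 1 √b := le_min zero_le_one (Real.sqrt_nonneg _)
  have h1 : min 1 √b * q ≤ √b * q := mul_le_mul_of_nonneg_right (min_le_right _ _) hq
  have h2 : min 1 √b * r ≤ 1 * r := mul_le_mul_of_nonneg_right (min_le_left _ _) hr
  have h3 := mul_le_mul_of_nonneg_left hY h0
  linarith

namespace LossAssumptions

/-- The relative error of the Hessian at the approximate solution for the first samples, bounded
pointwise by the optimality gaps and by the deviations of the Hessians at a fixed point. -/
theorem relFrobError_le (h : LossAssumptions P f μ L) (hμ : 0 < μ) (hL : 0 ≤ L)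
    (hm : 0 < m) (hn : 0 < n) (T : Fin m → Z) (S : Fin n → Z)
    (y w : EuclideanSpace ℝ (Fin d)) {ε : ℝ} (hε : 0 < ε) :
    relFrobError (hess (empRisk f T) y) (hess (empRisk f S) (argMin (empRisk f S))) ≤
      10 ^ 18 * (4 * ε + (d / ε + ε * m + L / μ * √d) * (empGap f T y + empGap f T w + empGap f S w)
        + (frobNorm (hess (empRisk f T) w - hess (expRisk P f) w) ^ 2
          + frobNorm (hess (empRisk f S) w - hess (expRisk P f) w) ^ 2) / (μ ^ 2 * ε)
        + (sampleVar P f T w + sampleVar P f S w) / (μ ^ 2 * ε * m)) := by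
  have hm' : (0 : ℝ) < m := by exact_mod_cast hm
  have hB := h.hess_empRisk_transpose S (argMin (empRisk f S))
  have hpd := h.le_quad_hess_empRisk hn S (argMin (empRisk f S))
  have g1 := h.empGap_nonneg hμ hm T y
  have g2 := h.empGap_nonneg hμ hm T w
  have g3 := h.empGap_nonneg hμ hn S w
  have e1 : empGap f T y + empGap f T w = (1 / (m : ℝ)) * ∑ i,
      (breg (fun w => f w (T i)) y (argMin (empRisk f T))
        + breg (fun w => f w (T i)) w (argMin (empRisk f T))) := by
    rw [Finset.sum_add_distrib, mul_add, h.average_breg hμ hm, h.average_breg hμ hm]; rfl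
  have e2 : empGap f S w = (1 / (n : ℝ)) * ∑ i,
      (breg (fun w => f w (S i)) (argMin (empRisk f S)) (argMin (empRisk f S))
        + breg (fun w => f w (S i)) w (argMin (empRisk f S))) := by
    rw [Finset.sum_add_distrib, mul_add, h.average_breg hμ hn, h.average_breg hμ hn, sub_self,
      zero_add]; rfl
  have N1 := h.relNorm_hess_empRisk_sub_le hμ hL hm T y w (argMin (empRisk f T)) e1 hB hpd
  have N2 := h.relNorm_hess_empRisk_sub_le hμ hL hn S (argMin (empRisk f S)) w
    (argMin (empRisk f S)) e2 hB hpd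
  have hY := h.relNorm_hess_expRisk_le_of_gap hμ hL hn S w g3 fun B hBe => by rw [hBe]; exact N2
  have D1 := relNorm_le hμ hB hpd (hess (empRisk f T) w - hess (expRisk P f) w)
  have D2 := relNorm_le hμ hB hpd (hess (empRisk f S) w - hess (expRisk P f) w)
  have T1 := sampleVar_nonneg (P := P) (f := f) T w
  have T2 := sampleVar_nonneg (P := P) (f := f) S w
  have F1 := frobNorm_nonneg (hess (empRisk f T) w - hess (expRisk P f) w)
  have F2 := frobNorm_nonneg (hess (empRisk f S) w - hess (expRisk P f) w)
  rw [relFrobError_eq]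
  set B := hess (empRisk f S) (argMin (empRisk f S))
  have total : relNorm B (hess (empRisk f T) y - B) ≤
      relNorm B (hess (empRisk f T) y - hess (empRisk f T) w)
        + relNorm B (hess (empRisk f T) w - hess (expRisk P f) w)
        + relNorm B (hess (empRisk f S) w - hess (expRisk P f) w)
        + relNorm B (B - hess (empRisk f S) w) := by
    have e : hess (empRisk f T) y - B = hess (empRisk f T) y - hess (empRisk f T) w
        + (hess (empRisk f T) w - hess (expRisk P f) w)
        + -(hess (empRisk f S) w - hess (expRisk P f) w)
        + -(B - hess (empRisk f S) w) := by abel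
    rw [e]
    refine (relNorm_add_le _ _ _).trans ?_
    rw [relNorm_neg]
    gcongr
    refine (relNorm_add_le _ _ _).trans ?_
    rw [relNorm_neg]
    gcongr
    exact relNorm_add_le _ _ _
  set b₁ := empGap f T y + empGap f T w
  set b₂ := empGap f S w
  set t₁ := sampleVar P f T w
  set t₂ := sampleVar P f S w
  set φ₁ := frobNorm (hess (empRisk f T) w - hess (expRisk P f) w)
  set φ₂ := frobNorm (hess (empRisk f S) w - hess (expRisk P f) w)
  set Y := relNorm B (hess (expRisk P f) w)
  set k := L / μ * √d with hk
  have hk0 : 0 ≤ k := by positivity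
  have hb1 : 0 ≤ b₁ := add_nonneg g1 g2
  have hτ1 : 0 ≤ √b₁ * √t₁ / μ := by positivity
  have hτ2 : 0 ≤ √b₂ * √t₂ / μ := by positivity
  have hφ1 : 0 ≤ φ₁ / μ := by positivity
  have hφ2 : 0 ≤ φ₂ / μ := by positivity
  have hbk1 : 0 ≤ b₁ * k := by positivity
  have hbk2 : 0 ≤ b₂ * k := by positivity
  have hq := Real.sqrt_nonneg (d : ℝ)
  have hr : 0 ≤ 2 * (φ₂ / μ) + 800000 * (√b₂ * √t₂ / μ) + 1000000000000 * (b₂ * k) := by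
    positivity
  have hY' : Y ≤ 2 * √d + (2 * (φ₂ / μ) + 800000 * (√b₂ * √t₂ / μ)
      + 1000000000000 * (b₂ * k)) := by linarith
  have y1 := min_one_sqrt_mul_le (b := b₁) hr hq hY'
  have y2 := min_one_sqrt_mul_le (b := b₂) hr hq hY'
  have hs1 : 0 ≤ √d * √b₁ := by positivity
  have hs2 : 0 ≤ √d * √b₂ := by positivity
  -- The largest coefficient is that of b₂ k: 10¹² enters with the factor 400000 from each of the
  -- two moves, which gives about 8·10¹⁷.
  have big : relNorm B (hess (empRisk f T) y - B) ≤ 10 ^ 18 * (√d * √b₁ + √d * √b₂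
      + φ₁ / μ + φ₂ / μ + √b₁ * √t₁ / μ + √b₂ * √t₂ / μ + b₁ * k + b₂ * k) := by
    norm_num
    linarith
  refine big.trans (mul_le_mul_of_nonneg_left ?_ (by positivity))
  have hd0 : (0 : ℝ) ≤ d := Nat.cast_nonneg d
  have a1 : √d * √b₁ ≤ ε + d / ε * b₁ := by
    have := mul_le_add_div_of_sq (x := 1) (y := √d * √b₁) hε
    rw [mul_pow, Real.sq_sqrt hd0, Real.sq_sqrt hb1] at this
    calc _ ≤ _ := by simpa using this
      _ = _ := by ring
  have a2 : √d * √b₂ ≤ ε + d / ε * b₂ := by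
    have := mul_le_add_div_of_sq (x := 1) (y := √d * √b₂) hε
    rw [mul_pow, Real.sq_sqrt hd0, Real.sq_sqrt g3] at this
    calc _ ≤ _ := by simpa using this
      _ = _ := by ring
  have a3 : φ₁ / μ ≤ ε + φ₁ ^ 2 / (μ ^ 2 * ε) := by
    have := mul_le_add_div_of_sq (x := 1) (y := φ₁ / μ) hε
    rw [div_pow, div_div] at this
    simpa using this
  have a4 : φ₂ / μ ≤ ε + φ₂ ^ 2 / (μ ^ 2 * ε) := by
    have := mul_le_add_div_of_sq (x := 1) (y := φ₂ / μ) hε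
    rw [div_pow, div_div] at this
    simpa using this
  -- The weight ε m matches the scales: gaps are of order 1/m in expectation, while the sample
  -- variance, which does not decay, receives the factor 1/m.
  have a5 : √b₁ * √t₁ / μ ≤ ε * m * b₁ + t₁ / (μ ^ 2 * ε * m) := by
    have := mul_le_add_div_of_sq (x := √b₁) (y := √t₁ / μ) (ε := ε * m) (by positivity)
    rw [div_pow, Real.sq_sqrt hb1, Real.sq_sqrt T1, div_div, ← mul_div_assoc, ← mul_assoc] at this
    exact this
  have a6 : √b₂ * √t₂ / μ ≤ ε * m * b₂ + t₂ / (μ ^ 2 * ε * m) := by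
    have := mul_le_add_div_of_sq (x := √b₂) (y := √t₂ / μ) (ε := ε * m) (by positivity)
    rw [div_pow, Real.sq_sqrt g3, Real.sq_sqrt T2, div_div, ← mul_div_assoc, ← mul_assoc] at this
    exact this
  calc _ ≤ (ε + d / ε * b₁) + (ε + d / ε * b₂) + (ε + φ₁ ^ 2 / (μ ^ 2 * ε))
        + (ε + φ₂ ^ 2 / (μ ^ 2 * ε)) + (ε * m * b₁ + t₁ / (μ ^ 2 * ε * m))
        + (ε * m * b₂ + t₂ / (μ ^ 2 * ε * m)) + b₁ * k + b₂ * k := by gcongr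
    _ = _ := by ring

/-- The expected relative error of the Hessian at the approximate solution for the first
samples. -/
theorem integral_relFrobError_le (h : LossAssumptions P f μ L) (hμ : 0 < μ) (hL : 0 < L)
    (hm : 0 < m) (hmn : m ≤ n) {V : ℕ → ℝ} (hV : IsStatAccuracy P f V)
    {w₀ : (Fin m → Z) → EuclideanSpace ℝ (Fin d)} (hw : Measurable w₀)
    (hsol : SolvesWithin P f w₀ (V m)) {ε : ℝ} (hε : 0 < ε) :
    Integrable (fun S : Fin n → Z => relFrobError
        (hess (empRisk f (firstSamples hmn S)) (w₀ (firstSamples hmn S)))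
        (hess (empRisk f S) (argMin (empRisk f S)))) (sampleLaw P n) ∧
      ∫ S : Fin n → Z, relFrobError
        (hess (empRisk f (firstSamples hmn S)) (w₀ (firstSamples hmn S)))
        (hess (empRisk f S) (argMin (empRisk f S))) ∂(sampleLaw P n) ≤
      10 ^ 18 * (4 * ε + (d / ε + ε * m + L / μ * √d) * (2 * V m + V n)
        + 4 * hessVar P f (argMin (expRisk P f)) / (μ ^ 2 * ε * m)) := by
  have hn : 0 < n := hm.trans_le hmn
  have hm' : (0 : ℝ) < m := by exact_mod_cast hm
  have hn' : (m : ℝ) ≤ n := by exact_mod_cast hmn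
  set w := argMin (expRisk P f) with hwdef
  obtain ⟨i1, l1⟩ := hsol
  obtain ⟨i2, l2⟩ := h.integral_empGap_le hμ hm hV
  obtain ⟨i3, l3⟩ := h.integral_empGap_le hμ hn hV
  obtain ⟨i4, l4⟩ := h.integral_sq_frobNorm_hess_empRisk_sub hμ hL.le hm w
  obtain ⟨i5, l5⟩ := h.integral_sq_frobNorm_hess_empRisk_sub hμ hL.le hn w
  obtain ⟨i6, l6⟩ := h.integral_average_sq_hessDev hμ hL.le hm w
  obtain ⟨i7, l7⟩ := h.integral_average_sq_hessDev hμ hL.le hn w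
  obtain ⟨j1, k1⟩ := integral_firstSamples hmn i1
  obtain ⟨j2, k2⟩ := integral_firstSamples hmn i2
  obtain ⟨j4, k4⟩ := integral_firstSamples hmn i4
  obtain ⟨j6, k6⟩ := integral_firstSamples hmn i6
  set κ := d / ε + ε * m + L / μ * √d with hκ
  have hκ0 : 0 ≤ κ := by positivity
  have jb : Integrable (fun S : Fin n → Z => empGap f (firstSamples hmn S)
      (w₀ (firstSamples hmn S)) + empGap f (firstSamples hmn S) w + empGap f S w)
      (sampleLaw P n) := (j1.add j2).add i3
  have jφ : Integrable (fun S : Fin n → Z =>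
      frobNorm (hess (empRisk f (firstSamples hmn S)) w - hess (expRisk P f) w) ^ 2
        + frobNorm (hess (empRisk f S) w - hess (expRisk P f) w) ^ 2) (sampleLaw P n) := j4.add i5
  have jt : Integrable (fun S : Fin n → Z =>
      sampleVar P f (firstSamples hmn S) w + sampleVar P f S w) (sampleLaw P n) := j6.add i7
  have jA : Integrable (fun S : Fin n → Z => 4 * ε + κ * (empGap f (firstSamples hmn S)
      (w₀ (firstSamples hmn S)) + empGap f (firstSamples hmn S) w + empGap f S w))
      (sampleLaw P n) := (integrable_const _).add (jb.const_mul κ)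
  have jB : Integrable (fun S : Fin n → Z => 4 * ε + κ * (empGap f (firstSamples hmn S)
      (w₀ (firstSamples hmn S)) + empGap f (firstSamples hmn S) w + empGap f S w)
      + (frobNorm (hess (empRisk f (firstSamples hmn S)) w - hess (expRisk P f) w) ^ 2
        + frobNorm (hess (empRisk f S) w - hess (expRisk P f) w) ^ 2) / (μ ^ 2 * ε))
      (sampleLaw P n) := jA.add (jφ.div_const _)
  have jC : Integrable (fun S : Fin n → Z => 4 * ε + κ * (empGap f (firstSamples hmn S)
      (w₀ (firstSamples hmn S)) + empGap f (firstSamples hmn S) w + empGap f S w)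
      + (frobNorm (hess (empRisk f (firstSamples hmn S)) w - hess (expRisk P f) w) ^ 2
        + frobNorm (hess (empRisk f S) w - hess (expRisk P f) w) ^ 2) / (μ ^ 2 * ε)
      + (sampleVar P f (firstSamples hmn S) w + sampleVar P f S w) / (μ ^ 2 * ε * m))
      (sampleLaw P n) := jB.add (jt.div_const _)
  have hpt := fun S : Fin n → Z => h.relFrobError_le hμ hL.le hm hn (firstSamples hmn S) S
    (w₀ (firstSamples hmn S)) w hε
  have hfm := (measurePreserving_firstSamples (P := P) hmn).measurable
  have hmeas : Measurable fun S : Fin n → Z => relFrobError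
      (hess (empRisk f (firstSamples hmn S)) (w₀ (firstSamples hmn S)))
      (hess (empRisk f S) (argMin (empRisk f S))) :=
    measurable_relFrobError hμ (h.measurable_hess_empRisk_comp hfm (hw.comp hfm))
      (h.measurable_hess_empRisk_comp measurable_id (h.measurable_argMin_empRisk hμ hn))
      (fun S => h.hess_empRisk_transpose _ _) (fun S => h.hess_empRisk_transpose _ _)
      (fun S => h.le_quad_hess_empRisk hn S _)
  have hint : Integrable (fun S : Fin n → Z => relFrobError
      (hess (empRisk f (firstSamples hmn S)) (w₀ (firstSamples hmn S)))
      (hess (empRisk f S) (argMin (empRisk f S)))) (sampleLaw P n) := by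
    refine Integrable.mono' (jC.const_mul (10 ^ 18)) hmeas.aestronglyMeasurable
      (Filter.Eventually.of_forall fun S => ?_)
    rw [Real.norm_eq_abs, abs_of_nonneg (show 0 ≤ relFrobError _ _ from frobNorm_nonneg _)]
    exact hpt S
  refine ⟨hint, (integral_mono hint (jC.const_mul (10 ^ 18)) hpt).trans ?_⟩
  rw [integral_const_mul, integral_add jB (jt.div_const _), integral_add jA (jφ.div_const _),
    integral_add (integrable_const _) (jb.const_mul κ), integral_const_mul, integral_div,
    integral_div]
  have vb : ∫ S : Fin n → Z, empGap f (firstSamples hmn S) (w₀ (firstSamples hmn S))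
      + empGap f (firstSamples hmn S) w + empGap f S w ∂(sampleLaw P n) ≤ 2 * V m + V n := by
    have j12 : Integrable (fun S : Fin n → Z => empGap f (firstSamples hmn S)
      (w₀ (firstSamples hmn S)) + empGap f (firstSamples hmn S) w) (sampleLaw P n) := j1.add j2
    rw [integral_add j12 i3, integral_add (show Integrable (fun S : Fin n → Z =>
      empGap f (firstSamples hmn S) (w₀ (firstSamples hmn S))) (sampleLaw P n) from j1) j2, k2]
    have : ∫ S : Fin n → Z, empGap f (firstSamples hmn S) (w₀ (firstSamples hmn S))
      ∂(sampleLaw P n) ≤ V m := k1.trans_le l1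
    linarith
  have vφ : ∫ S : Fin n → Z,
      (frobNorm (hess (empRisk f (firstSamples hmn S)) w - hess (expRisk P f) w) ^ 2
        + frobNorm (hess (empRisk f S) w - hess (expRisk P f) w) ^ 2) ∂(sampleLaw P n) ≤
      2 * hessVar P f w / m := by
    rw [integral_add j4 i5, k4, l4, l5]
    have := div_le_div_of_nonneg_left (hessVar_nonneg (P := P) (f := f) w) hm' hn'
    rw [two_mul, add_div]
    linarith
  have vt : ∫ S : Fin n → Z, (sampleVar P f (firstSamples hmn S) w + sampleVar P f S w)
      ∂(sampleLaw P n) = 2 * hessVar P f w := by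
    rw [integral_add (show Integrable (fun S : Fin n → Z =>
      sampleVar P f (firstSamples hmn S) w) (sampleLaw P n) from j6)
      (show Integrable (fun S : Fin n → Z => sampleVar P f S w) (sampleLaw P n) from i7)]
    have e6 : ∫ S : Fin n → Z, sampleVar P f (firstSamples hmn S) w ∂(sampleLaw P n) =
      hessVar P f w := k6.trans l6
    have e7 : ∫ S : Fin n → Z, sampleVar P f S w ∂(sampleLaw P n) = hessVar P f w := l7
    rw [e6, e7]; ring
  rw [vt]
  simp only [integral_const, probReal_univ, smul_eq_mul, one_mul]
  refine mul_le_mul_of_nonneg_left ?_ (by positivity)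
  have vb' := mul_le_mul_of_nonneg_left vb hκ0
  rw [← integral_const_mul] at vb'
  calc _ ≤ 4 * ε + κ * (2 * V m + V n) + 2 * hessVar P f w / m / (μ ^ 2 * ε)
        + 2 * hessVar P f w / (μ ^ 2 * ε * m) := by gcongr
    _ = _ := by field_simp; ring

end LossAssumptions

end Expectation

end AdaQN

end

/-! ### Choice of the constants -/

theorem proposition4 (c a : ℝ) (hc : 0 < c) (ha : 0 < a) :
    ∃ C : ℝ, 0 < C ∧
      ∀ (d : ℕ) (_ : 2 ≤ d) (Z : Type*) [MeasurableSpace Z] (P : Measure Z)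
        [IsProbabilityMeasure P] (f : EuclideanSpace ℝ (Fin d) → Z → ℝ) (μ L : ℝ)
        (_ : 0 < μ) (_ : 0 < L) (_ : AdaQN.LossAssumptions P f μ L)
        (V : ℕ → ℝ) (_ : AdaQN.IsStatAccuracy P f V)
        (_ : ∀ n : ℕ, 1 ≤ n → a * ((L / μ) ^ 2 * Real.log d) ≤ n → V n ≤ c / n)
        (m₀ : ℕ)
        (_ : C * max (d : ℝ) ((L / μ) ^ 2 * AdaQN.sParam P f * Real.log d) ≤ m₀)
        (w₀ : (Fin m₀ → Z) → EuclideanSpace ℝ (Fin d)) (_ : Measurable w₀)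
        (_ : AdaQN.SolvesWithin P f w₀ (V m₀))
        (n : ℕ) (hmn : m₀ ≤ n) (_ : 2 * m₀ ≤ n),
        Integrable (fun S : Fin n → Z =>
          AdaQN.relFrobError
            (AdaQN.hess (AdaQN.empRisk f (AdaQN.firstSamples hmn S))
              (w₀ (AdaQN.firstSamples hmn S)))
            (AdaQN.hess (AdaQN.empRisk f S) (AdaQN.argMin (AdaQN.empRisk f S))))
          (AdaQN.sampleLaw P n) ∧
        ∫ S : Fin n → Z,
          AdaQN.relFrobError
            (AdaQN.hess (AdaQN.empRisk f (AdaQN.firstSamples hmn S))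
              (w₀ (AdaQN.firstSamples hmn S)))
            (AdaQN.hess (AdaQN.empRisk f S) (AdaQN.argMin (AdaQN.empRisk f S)))
          ∂(AdaQN.sampleLaw P n) ≤ 1 / 7 := by
  -- The terms not improved by a large C add up to (4 + 3c) ε, and this ε gives them exactly half of
  -- 1/7.
  obtain ⟨ε, hεdef⟩ : ∃ ε : ℝ, ε = 1 / (14 * 10 ^ 18 * (4 + 3 * c)) := ⟨_, rfl⟩
  have hε : 0 < ε := by rw [hεdef]; positivity
  -- The coefficient of 1/C in the final bound: 3c/ε from d ≤ m₀/C, 6c from κ√d ≤ 2m₀/C, and 8064 =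
  -- 4·2016 from the variance.
  obtain ⟨q, hq⟩ : ∃ q : ℝ, q = 3 * c / ε + 6 * c + 8064 / ε := ⟨_, rfl⟩
  have hq0 : 0 < q := by rw [hq]; positivity
  -- The summand a, with s ≥ 1, brings m₀ into the range where V is at most c/n; the other summand
  -- gives the terms in 1/C the second half of 1/7.
  refine ⟨a + 14 * 10 ^ 18 * q, by positivity, ?_⟩
  intro d hd Z _ P _ f μ L hμ hL h V hV hVc m₀ hm w₀ hw hsol n hmn _
  obtain ⟨C, hC⟩ : ∃ C : ℝ, C = a + 14 * 10 ^ 18 * q := ⟨_, rfl⟩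
  rw [← hC] at hm
  have hC0 : 0 < C := by rw [hC]; positivity
  have haC : a ≤ C := by rw [hC]; linarith [(by positivity : 0 < 14 * 10 ^ 18 * q)]
  have hqC : 14 * 10 ^ 18 * q ≤ C := by rw [hC]; linarith
  have hd' : (2 : ℝ) ≤ d := by exact_mod_cast hd
  have hs := h.one_le_sParam hμ hL.le (by omega)
  have hlog : 1 / 2 ≤ Real.log d := by
    have := Real.log_le_log (by norm_num) hd'
    linarith [Real.log_two_gt_d9]
  have hvar := h.hessVar_le hμ hL hd (AdaQN.argMin (AdaQN.expRisk P f))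
  set s := AdaQN.sParam P f
  set σ := AdaQN.hessVar P f (AdaQN.argMin (AdaQN.expRisk P f))
  have hm1 : C * d ≤ m₀ := (mul_le_mul_of_nonneg_left (le_max_left _ _) hC0.le).trans hm
  have hm2 : C * ((L / μ) ^ 2 * s * Real.log d) ≤ m₀ :=
    (mul_le_mul_of_nonneg_left (le_max_right _ _) hC0.le).trans hm
  have hm0 : (0 : ℝ) < m₀ := lt_of_lt_of_le (by positivity) hm1
  have hm0' : 0 < m₀ := by exact_mod_cast hm0
  have hnm : (m₀ : ℝ) ≤ n := by exact_mod_cast hmn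
  have hκ : (L / μ) ^ 2 * Real.log d ≤ (L / μ) ^ 2 * s * Real.log d := by
    have : 0 ≤ (L / μ) ^ 2 * Real.log d := by positivity
    nlinarith
  have ham : a * ((L / μ) ^ 2 * Real.log d) ≤ m₀ := by
    refine le_trans ?_ hm2
    exact mul_le_mul haC hκ (by positivity) hC0.le
  have hV1 := hVc m₀ hm0' ham
  have hV2 : V n ≤ c / m₀ := (hVc n (hm0'.trans_le hmn) (ham.trans hnm)).trans
    (div_le_div_of_nonneg_left hc.le hm0 hnm)
  obtain ⟨hint, hle⟩ := h.integral_relFrobError_le hμ hL hm0' hmn hV hw hsol hε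
  refine ⟨hint, hle.trans ?_⟩
  -- Multiply the two lower bounds on m₀: since s ≥ 1 and log d ≥ 1/2, both d and κ²/2 are at most
  -- m₀/C, hence κ²d ≤ 2(m₀/C)².
  have hk : L / μ * √d ≤ 2 * m₀ / C := by
    refine abs_le_of_sq_le_sq' ?_ (by positivity) |>.2
    rw [mul_pow, Real.sq_sqrt (by positivity), div_pow (2 * (m₀ : ℝ)), le_div_iff₀ (by positivity)]
    have h1 : C * ((L / μ) ^ 2 * (1 / 2)) ≤ m₀ := by
      refine le_trans (mul_le_mul_of_nonneg_left ?_ hC0.le) hm2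
      exact (mul_le_mul_of_nonneg_left hlog (by positivity)).trans hκ
    have h2 := mul_le_mul h1 hm1 (by positivity) hm0.le
    nlinarith
  have hd1 : (d : ℝ) ≤ m₀ / C := by rw [le_div_iff₀ hC0]; linarith
  have hσ : σ ≤ 2016 * (μ ^ 2 * (m₀ / C)) := by
    refine hvar.trans (mul_le_mul_of_nonneg_left ?_ (by norm_num))
    rw [← mul_div_assoc, le_div_iff₀ hC0]
    have e : s * L ^ 2 * Real.log d * C = μ ^ 2 * (C * ((L / μ) ^ 2 * s * Real.log d)) := by
      field_simp
    rw [e]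
    exact mul_le_mul_of_nonneg_left hm2 (by positivity)
  have hb : 2 * V m₀ + V n ≤ 3 * c / m₀ := by
    have : 3 * c / (m₀ : ℝ) = 2 * (c / m₀) + c / m₀ := by ring
    linarith
  -- V dominates expectations of absolute values, so it is nonnegative; this lets the factor
  -- multiplying it be enlarged in the final estimate.
  have hb0 : 0 ≤ 2 * V m₀ + V n := by
    have h1 := (integral_nonneg fun _ => abs_nonneg _).trans (hV m₀ hm0').2
    have h2 := (integral_nonneg fun _ => abs_nonneg _).trans (hV n (hm0'.trans_le hmn)).2
    linarith
  have hfin : 4 * ε + (d / ε + ε * m₀ + L / μ * √d) * (2 * V m₀ + V n)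
      + 4 * σ / (μ ^ 2 * ε * m₀) ≤ (4 + 3 * c) * ε + q / C := by
    calc _ ≤ 4 * ε + (m₀ / C / ε + ε * m₀ + 2 * m₀ / C) * (3 * c / m₀)
          + 4 * (2016 * (μ ^ 2 * (m₀ / C))) / (μ ^ 2 * ε * m₀) := by gcongr
      _ = _ := by rw [hq]; field_simp; ring
  have h1 : 10 ^ 18 * ((4 + 3 * c) * ε) = 1 / 14 := by rw [hεdef]; field_simp
  have h2 : 10 ^ 18 * (q / C) ≤ 1 / 14 := by
    rw [← mul_div_assoc, div_le_iff₀ hC0]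
    linarith
  calc _ ≤ 10 ^ 18 * ((4 + 3 * c) * ε + q / C) := mul_le_mul_of_nonneg_left hfin (by positivity)
    _ ≤ 1 / 7 := by rw [mul_add]; linarith
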